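/- Let $L,r,u_0>0$, let $\Box=[-L,L]^2\subset\mathbb C=\mathbb R^2$, and let $X=\overline{U_r(P)}\cap\Box$, where $P\subset\mathbb C$ is locally finite and $U_r(P)$ is its $r$-neighbourhood; put $X^c=\Box\setminus X$. A curve is occupied if it lies in $X$ and vacant if it lies in $\overline{X^c}$. We say that $X^c$ dominates $\Box$ if any two different (closed) edges of $\Box$ are joined by a vacant curve and no two different edges are joined by an occupied curve; $X$ dominates $\Box$ if the same holds with the words occupied and vacant exchanged. For $0<\gamma_0<1$ let $\gamma^+=1$ on $X$, $\gamma^+=\gamma_0$ on $X^c$, and $\gamma^-=\gamma_0$ on $X$, $\gamma^-=1$ on $X^c$. The OS potential $u^+=u^+_{\gamma_0}\in H^1(\Box)$ is the weak solution of $\nabla\cdot(\gamma^+\nabla u^+)=0$ with $u^+=u_0$ on the upper edge, $u^+=0$ on the lower edge, and zero normal derivative on the left and right edges. The VS potential $u^-=u^-_{\gamma_0}\in H^1(\Box)$ is the weak solution of $\nabla\cdot(\gamma^-\nabla u^-)=0$ with $u^-=u_0$ on the right edge, $u^-=0$ on the left edge, and zero normal derivative on the upper and lower edges. The equipotential set $C_v(u)$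 of $u\in H^1(\Box)$ is the set of $z\in\Box$ such that, for all $\delta,\varepsilon>0$, the set $\{w\in\Box: |w-z|<\delta,\ |u(w)-v|<\varepsilon\}$ has positive area; it is $\{u=v\}$ when $u$ is continuous on $\Box$. (1) Suppose $X^c$ dominates $\Box$. Then $u^+_{\gamma_0}$ exists for every $0<\gamma_0<1$ and, as $\gamma_0\to0^+$, it converges in $H^1(\Box)$ to a function $u^+_*$ with the same Dirichlet boundary values. For every connected component $K$ of $X$ there is a constant $c$ with $u^+_*=c$ almost everywhere on $K$ and $K^\circ\subseteq C_c(u^+_*)$, and no other equipotential curve enters $K^\circ$: for every $v\in[0,u_0]$ with $v\ne c$, the set $C_v(u^+_*)$ is disjoint from $K^\circ$, and for every compact $Q\subset K^\circ$ the set $C_v(u^+_{\gamma_0})$ is disjoint from $Q$ for all sufficiently small $\gamma_0>0$. (2) Suppose $X$ dominates $\Box$. Then $u^-_{\gamma_0}$ exists for every $0<\gamma_0<1$ and, as $\gamma_0\to0^+$, it converges in $H^1(\Box)$ to a function $u^-_*$ with the same Dirichlet boundary values. For every connected component $K$ of $X^c$ there is a constant $c$ with $u^-_*=c$ almost everywhere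 on $K$ and $K\subseteq C_c(u^-_*)$, and for every $v\in[0,u_0]$ with $v\ne c$, the set $C_v(u^-_*)$ is disjoint from $K$, and for every compact $Q\subset K$ the set $C_v(u^-_{\gamma_0})$ is disjoint from $Q$ for all sufficiently small $\gamma_0>0$. -/

import Mathlib

open MeasureTheory Filter Topology Set

namespace PercolationPotential

/-! ### The box and its edges -/

/-- The closed box `[-L, L]²` in `ℂ = ℝ²`. -/
def box (L : ℝ) : Set ℂ := Icc (-L) L ×ℂ Icc (-L) L

/-- Names of the four edges of the box. -/
inductive Edge where
  | up
  | down
  | left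
  | right

/-- The four closed edges of the box. -/
def edge (L : ℝ) : Edge → Set ℂ
  | .up => {z ∈ box L | z.im = L}
  | .down => {z ∈ box L | z.im = -L}
  | .left => {z ∈ box L | z.re = -L}
  | .right => {z ∈ box L | z.re = L}

/-! ### Boolean configurations -/

/-- Locally finite point configurations in the plane (they are automatically countable). -/
def LocallyFiniteConfig : Set (Set ℂ) :=
  {P | ∀ K : Set ℂ, IsCompact K → (P ∩ K).Finite}

/-- Boolean configurations in the box: traces on the box of the closures of the
`r`-neighbourhoods of locally finite point configurations. -/
def boolConfig (L r : ℝ) : Set (Set ℂ) :=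
  {X | ∃ P ∈ LocallyFiniteConfig, X = closure (Metric.thickening r P) ∩ box L}

/-- The vacant region, that is, the complement in the box. -/
def vacant (L : ℝ) (X : Set ℂ) : Set ℂ := box L \ X

/-- There is a continuous curve inside `S` which meets both `A` and `B`. -/
def CurveConnected (S A B : Set ℂ) : Prop :=
  ∃ c : unitInterval → ℂ, Continuous c ∧ (∀ t, c t ∈ S) ∧ (∃ t, c t ∈ A) ∧ (∃ t, c t ∈ B)

/-- Any two different edges of the box are joined by a curve inside `S`. -/
def TotallyConnected (L : ℝ) (S : Set ℂ) : Prop :=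
  ∀ a b : Edge, a ≠ b → CurveConnected S (edge L a) (edge L b)

/-- No two different edges of the box are joined by a curve inside `S`. -/
def TotallyDisconnected (L : ℝ) (S : Set ℂ) : Prop :=
  ∀ a b : Edge, a ≠ b → ¬ CurveConnected S (edge L a) (edge L b)

/-- `X` dominates the box: occupied curves (curves in `X`) join all edges, and vacant curves
(curves in the closure of the vacant region) join no two of them. -/
def Dominates (L : ℝ) (X : Set ℂ) : Prop :=
  TotallyConnected L X ∧ TotallyDisconnected L (closure (vacant L X))

/-- The vacant region of `X` dominates the box: vacant curves join all edges, and occupied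
curves join no two of them. -/
def VacancyDominates (L : ℝ) (X : Set ℂ) : Prop :=
  TotallyConnected L (closure (vacant L X)) ∧ TotallyDisconnected L X

/-! ### The two conductivities and the mixed boundary value problem -/

open Classical in
/-- OS-type conductivity: `1` on the occupied region, `γ₀` on the vacant region. -/
noncomputable def condOS (γ₀ : ℝ) (X : Set ℂ) (z : ℂ) : ℝ := if z ∈ X then 1 else γ₀

open Classical in
/-- VS-type conductivity: `γ₀` on the occupied region, `1` on the vacant region. -/
noncomputable def condVS (γ₀ : ℝ) (X : Set ℂ) (z : ℂ) : ℝ := if z ∈ X then γ₀ else 1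

/-- `L²`-norm over the box. -/
noncomputable def l2Norm {E : Type*} [NormedAddCommGroup E] (L : ℝ) (f : ℂ → E) : ENNReal :=
  eLpNorm f 2 (volume.restrict (box L))

/-- `u` is a Sobolev function on the box with weak gradient `g` whose boundary values are
`u₀` on the edge `e₁` and `0` on the edge `e₀` (in the sense of traces): the pair `(u, ∇u)` is
the `L²`-limit of `(f n, ∇ (f n))` for functions `f n`, of class `C¹` up to the boundary, which
have these boundary values. The weak gradient `g` is determined by `u` almost everywhere. -/
def SobolevBC (L : ℝ) (e₀ e₁ : Edge) (u₀ : ℝ) (u : ℂ → ℝ) (g : ℂ → ℂ) : Prop :=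
  MemLp u 2 (volume.restrict (box L)) ∧ MemLp g 2 (volume.restrict (box L)) ∧
  ∃ f : ℕ → ℂ → ℝ,
    (∀ n, ContDiff ℝ 1 (f n) ∧ (∀ z ∈ edge L e₀, f n z = 0) ∧ (∀ z ∈ edge L e₁, f n z = u₀)) ∧
    Tendsto (fun n => l2Norm L (fun z => f n z - u z)) atTop (𝓝 0) ∧
    Tendsto (fun n => l2Norm L (fun z => gradient (f n) z - g z)) atTop (𝓝 0)

/-- `u`, with weak gradient `g`, is the weak solution of `∇ · (σ ∇u) = 0` in the box with
`u = 0` on `e₀`, `u = u₀` on `e₁`, and vanishing normal derivative on the two other edges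
(the natural boundary condition of the weak formulation). -/
def IsPotential (L : ℝ) (σ : ℂ → ℝ) (e₀ e₁ : Edge) (u₀ : ℝ) (u : ℂ → ℝ) (g : ℂ → ℂ) : Prop :=
  SobolevBC L e₀ e₁ u₀ u g ∧
  ∀ φ : ℂ → ℝ, ContDiff ℝ 1 φ → (∀ z ∈ edge L e₀, φ z = 0) → (∀ z ∈ edge L e₁, φ z = 0) →
    ∫ z in box L, σ z * inner ℝ (g z) (gradient φ z) = 0

/-- The OS potential: conductivity of OS-type, `u₀` on the upper and `0` on the lower edge. -/
def IsOSPotential (L γ₀ : ℝ) (X : Set ℂ) (u₀ : ℝ) (u : ℂ → ℝ) (g : ℂ → ℂ) : Prop :=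
  IsPotential L (condOS γ₀ X) .down .up u₀ u g

/-- The VS potential: conductivity of VS-type, `u₀` on the right and `0` on the left edge. -/
def IsVSPotential (L γ₀ : ℝ) (X : Set ℂ) (u₀ : ℝ) (u : ℂ → ℝ) (g : ℂ → ℂ) : Prop :=
  IsPotential L (condVS γ₀ X) .left .right u₀ u g

/-! ### Equipotential sets -/

/-- The equipotential set `u = v` in the box, in a form that depends only on the almost
everywhere class of `u`: the points near which `u` takes values arbitrarily close to `v` on sets
of positive area. For `u` continuous on the box it is `{z ∈ box L | u z = v}`,
see `equipotential_eq_of_continuousOn`. -/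
def equipotential (L : ℝ) (u : ℂ → ℝ) (v : ℝ) : Set ℂ :=
  {z ∈ box L | ∀ δ > 0, ∀ ε > 0, 0 < volume {w ∈ box L | dist w z < δ ∧ |u w - v| < ε}}

theorem volume_ball_inter_box_pos {L : ℝ} (hL : 0 < L) {z : ℂ} (hz : z ∈ box L) {δ : ℝ}
    (hδ : 0 < δ) : 0 < volume (Metric.ball z δ ∩ box L) := by
  have hint : interior (box L) = Ioo (-L) L ×ℂ Ioo (-L) L := by
    rw [box, Complex.interior_reProdIm, interior_Icc]
  have hcl : z ∈ closure (interior (box L)) := by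
    have hne : (-L) ≠ L := by linarith
    rw [hint, Complex.closure_reProdIm, closure_Ioo hne]
    exact hz
  obtain ⟨w, hw1, hw2⟩ := mem_closure_iff.1 hcl _ Metric.isOpen_ball (Metric.mem_ball_self hδ)
  have hpos := (Metric.isOpen_ball.inter (isOpen_interior (s := box L))).measure_pos volume
    ⟨w, hw1, hw2⟩
  exact hpos.trans_le (measure_mono (inter_subset_inter_right _ interior_subset))

theorem equipotential_eq_of_continuousOn {L : ℝ} (hL : 0 < L) {u : ℂ → ℝ}
    (hu : ContinuousOn u (box L)) (v : ℝ) :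
    equipotential L u v = {z ∈ box L | u z = v} := by
  ext z
  constructor
  · rintro ⟨hz, h⟩
    refine ⟨hz, ?_⟩
    by_contra hne
    have hε : 0 < |u z - v| / 2 := half_pos (abs_pos.2 (sub_ne_zero.2 hne))
    obtain ⟨δ, hδ, H⟩ := Metric.continuousWithinAt_iff.1 (hu z hz) _ hε
    have hemp : {w ∈ box L | dist w z < δ ∧ |u w - v| < |u z - v| / 2} = ∅ := by
      rw [eq_empty_iff_forall_notMem]
      rintro w ⟨hw, hd, hlt⟩
      have h1 := H hw hd
      rw [Real.dist_eq, abs_sub_comm] at h1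
      have h2 := abs_sub_le (u z) (u w) v
      linarith
    have h3 := h δ hδ _ hε
    rw [hemp, measure_empty] at h3
    exact lt_irrefl _ h3
  · rintro ⟨hz, rfl⟩
    refine ⟨hz, fun δ hδ ε hε => ?_⟩
    obtain ⟨η, hη, H⟩ := Metric.continuousWithinAt_iff.1 (hu z hz) _ hε
    refine (volume_ball_inter_box_pos hL hz (lt_min hδ hη)).trans_le (measure_mono ?_)
    rintro w ⟨hw, hwb⟩
    have hw' := Metric.mem_ball.1 hw
    exact ⟨hwb, hw'.trans_le (min_le_left _ _), H hwb (hw'.trans_le (min_le_right _ _))⟩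

end PercolationPotential

/-! Let `D` be the region of conductivity 1 (`X` in the OS case, the vacant region in the VS case),
the conductivity elsewhere being γ. Divided by γ, the Dirichlet energy of a gradient field is ‖g‖² +
(1/γ - 1)‖g|_D‖², so letting γ tend to 0 penalises gradients on `D`. If some field `w` with the
right boundary values vanishes on `D`, the minimal energies stay below ‖w‖². They also increase as γ
decreases, and their differences control the squared distances between minimisers. The gradients
therefore converge in L², and their limit vanishes on `D` (`exists_high_contrast_limit`). The
Poincaré inequality carries this over to the potentials (`exists_limit_potential`).

The competitor `w` is where domination enters. A closed set joining the two Dirichlet edges by no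
curve splits into a part reachable from one edge and the rest. If the set is locally path joined,
both parts are closed, and a smooth separating function has zero gradient on them
(`exists_admissible_of_not_curveConnected`). Local joining is immediate for a finite union of convex
disc pieces. For the closed vacant region, inversion at a boundary point turns discs through the
point into half-planes (`arc_mem_vacant`, `exists_escape_direction`).

A Sobolev function with zero gradient is constant on convex sets (`SobolevBC.exists_ae_eq_const`).
In the vacant region this gives local constancy, which connectedness makes global. The occupied
region may contain discs that touch in a single point; a scaling argument in dimension two shows
that the constants still agree (`SobolevBC.eq_of_touching`).

Excluding other levels for small positive γ requires locally uniform convergence. The difference of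
a potential and the limit is weakly harmonic in `D`. A mean value identity, extended across one edge
by odd or even reflection, bounds its supremum by its L² norm (`ae_abs_le_of_weaklyHarmonic`).
Corners cause no difficulty: the interiors in the OS case avoid all edges, and in the VS case a
vacant corner would itself join two edges. -/

namespace PercolationPotential

/-! ### High contrast limits in Hilbert spaces -/

section Hilbert

variable {H H' : Type*} [NormedAddCommGroup H] [InnerProductSpace ℝ H]
  [NormedAddCommGroup H'] [InnerProductSpace ℝ H']

/-- Lax-Milgram: the form is bounded, and coercive with constant `γ`. Here `f` lifts the boundary
data, `V` is the space of test gradients, and `T` restricts fields to the region of conductivity 1.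
-/
theorem exists_weak_solution [CompleteSpace H] (T : H →L[ℝ] H') (V : Submodule ℝ H)
    (hV : IsClosed (V : Set H)) (f : H) {γ : ℝ} (hγ : γ ∈ Ioo (0 : ℝ) 1) :
    ∃ v ∈ V, ∀ φ ∈ V, γ * inner ℝ (f + v) φ + (1 - γ) * inner ℝ (T (f + v)) (T φ) = 0 := by
  have : CompleteSpace V := hV.completeSpace_coe
  obtain ⟨h0, h1⟩ := hγ
  let b : H → H → ℝ := fun x y => γ * inner ℝ x y + (1 - γ) * inner ℝ (T x) (T y)
  have badd : ∀ x y z, b (x + y) z = b x z + b y z := by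
    intro x y z; simp only [b, map_add, inner_add_left]; ring
  have badd' : ∀ x y z, b x (y + z) = b x y + b x z := by
    intro x y z; simp only [b, map_add, inner_add_right]; ring
  have bsmul : ∀ (c : ℝ) x z, b (c • x) z = c * b x z := by
    intro c x z; simp only [b, map_smul, real_inner_smul_left]; ring
  have bsmul' : ∀ (c : ℝ) x z, b x (c • z) = c * b x z := by
    intro c x z; simp only [b, map_smul, real_inner_smul_right]; ring
  have hb : ∀ x y, |b x y| ≤ (γ + (1 - γ) * (‖T‖ * ‖T‖)) * ‖x‖ * ‖y‖ := by
    intro x y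
    have e1 := abs_real_inner_le_norm x y
    have e2 := abs_real_inner_le_norm (T x) (T y)
    have e3 : ‖T x‖ * ‖T y‖ ≤ (‖T‖ * ‖x‖) * (‖T‖ * ‖y‖) := by
      gcongr <;> exact T.le_opNorm _
    calc |b x y| ≤ |γ * inner ℝ x y| + |(1 - γ) * inner ℝ (T x) (T y)| := abs_add_le _ _
      _ = γ * |inner ℝ x y| + (1 - γ) * |inner ℝ (T x) (T y)| := by
        rw [abs_mul, abs_mul, abs_of_pos h0, abs_of_pos (by linarith : 0 < 1 - γ)]
      _ ≤ γ * (‖x‖ * ‖y‖) + (1 - γ) * ((‖T‖ * ‖x‖) * (‖T‖ * ‖y‖)) := by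
        have : 0 ≤ 1 - γ := by linarith
        gcongr
        exact e2.trans e3
      _ = _ := by ring
  let Bl : V →ₗ[ℝ] V →ₗ[ℝ] ℝ := LinearMap.mk₂ ℝ (fun x y : V => b x y)
    (fun x y z => badd x y z) (fun c x z => bsmul c x z) (fun x y z => badd' x y z)
    (fun c x z => bsmul' c x z)
  let B : V →L[ℝ] V →L[ℝ] ℝ := Bl.mkContinuous₂ (γ + (1 - γ) * (‖T‖ * ‖T‖)) (fun x y => hb x y)
  have hco : IsCoercive B := by
    refine ⟨γ, h0, fun u => ?_⟩
    change γ * ‖u‖ * ‖u‖ ≤ b u u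
    simp only [b, real_inner_self_eq_norm_mul_norm]
    have : 0 ≤ (1 - γ) * (‖T u‖ * ‖T u‖) := mul_nonneg (by linarith) (mul_self_nonneg _)
    have e : ‖(u : H)‖ = ‖u‖ := rfl
    rw [e]; nlinarith
  let F : V →ₗ[ℝ] ℝ :=
    { toFun := fun y => -b f y
      map_add' := fun y z => by
        change -b f ((y : H) + z) = _
        rw [badd']; ring
      map_smul' := fun c y => by
        change -b f (c • (y : H)) = _
        rw [bsmul']; simp }
  let Fc : V →L[ℝ] ℝ := F.mkContinuous ((γ + (1 - γ) * (‖T‖ * ‖T‖)) * ‖f‖) (fun y => by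
    change ‖-b f y‖ ≤ _
    rw [norm_neg]
    exact hb f y)
  let r : V := (InnerProductSpace.toDual ℝ V).symm Fc
  refine ⟨hco.continuousLinearEquivOfBilin.symm r, Subtype.prop _, fun φ hφ => ?_⟩
  have e1 := hco.continuousLinearEquivOfBilin_apply (hco.continuousLinearEquivOfBilin.symm r) ⟨φ, hφ⟩
  rw [ContinuousLinearEquiv.apply_symm_apply] at e1
  have e2 : inner ℝ r (⟨φ, hφ⟩ : V) = Fc ⟨φ, hφ⟩ := InnerProductSpace.toDual_symm_apply
  rw [e2] at e1
  have e3 : -b f φ = b (hco.continuousLinearEquivOfBilin.symm r : V) φ := e1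
  change b (f + _) φ = 0
  rw [badd, ← e3]; ring

/-- Pythagoras for the energy form: `h` says that `y` is orthogonal to the variation `x - y`, so the
cross term disappears. -/
theorem energy_expand (T : H →L[ℝ] H') (x y : H) (γ : ℝ)
    (h : γ * inner ℝ y (x - y) + (1 - γ) * inner ℝ (T y) (T (x - y)) = 0) :
    γ * ‖x‖ ^ 2 + (1 - γ) * ‖T x‖ ^ 2 = γ * ‖y‖ ^ 2 + (1 - γ) * ‖T y‖ ^ 2
      + (γ * ‖x - y‖ ^ 2 + (1 - γ) * ‖T (x - y)‖ ^ 2) := by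
  have h1 : ‖x‖ ^ 2 = ‖y‖ ^ 2 + 2 * inner ℝ y (x - y) + ‖x - y‖ ^ 2 := by
    rw [← norm_add_sq_real, add_sub_cancel]
  have h2 : ‖T x‖ ^ 2 = ‖T y‖ ^ 2 + 2 * inner ℝ (T y) (T (x - y)) + ‖T (x - y)‖ ^ 2 := by
    rw [← norm_add_sq_real, ← map_add, add_sub_cancel]
  rw [h1, h2]; linear_combination 2 * h

/-- The rescaled minimal energies are monotone in `γ` and bounded by the energy of the competitor
`w`. By orthogonality their increments dominate squared distances of minimisers, which gives the
Cauchy property without extracting subsequences. -/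
theorem exists_high_contrast_limit [CompleteSpace H] (T : H →L[ℝ] H') (V : Submodule ℝ H)
    (w : H) (hw : T w = 0) (g : ℝ → H)
    (hg : ∀ γ ∈ Ioo (0 : ℝ) 1, w - g γ ∈ V)
    (hweak : ∀ γ ∈ Ioo (0 : ℝ) 1, ∀ φ ∈ V,
      γ * inner ℝ (g γ) φ + (1 - γ) * inner ℝ (T (g γ)) (T φ) = 0) :
    ∃ l : H, Tendsto g (𝓝[>] 0) (𝓝 l) ∧ T l = 0 := by
  -- The energy divided by `γ`. In this normalisation it decreases in `γ` and always dominates `‖x‖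
  -- ^ 2`.
  let q : ℝ → H → ℝ := fun γ x => ‖x‖ ^ 2 + (1 / γ - 1) * ‖T x‖ ^ 2
  have hq : ∀ γ ∈ Ioo (0 : ℝ) 1, ∀ x, w - x ∈ V →
      q γ x = q γ (g γ) + q γ (x - g γ) := by
    intro γ hγ x hx
    have hx' : x - g γ ∈ V := by
      have := V.sub_mem (hg γ hγ) hx
      simpa using this
    have h := energy_expand T x (g γ) γ (hweak γ hγ _ hx')
    have h0 : γ ≠ 0 := hγ.1.ne'
    have key : ∀ z, q γ z = γ⁻¹ * (γ * ‖z‖ ^ 2 + (1 - γ) * ‖T z‖ ^ 2) := by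
      intro z; simp only [q]; field_simp
    rw [key, key, key, h]; ring
  have hmono : ∀ γ ∈ Ioo (0 : ℝ) 1, ∀ γ' ∈ Ioo (0 : ℝ) 1, γ ≤ γ' → ∀ x, q γ' x ≤ q γ x := by
    intro γ hγ γ' hγ' hle x
    have : 1 / γ' ≤ 1 / γ := one_div_le_one_div_of_le hγ.1 hle
    simp only [q]; gcongr
  have hnn : ∀ γ ∈ Ioo (0 : ℝ) 1, ∀ x, ‖x‖ ^ 2 ≤ q γ x := by
    intro γ hγ x
    have : 1 ≤ 1 / γ := by rw [le_div_iff₀ hγ.1]; linarith [hγ.2]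
    simp only [q]
    nlinarith [sq_nonneg ‖T x‖]
  let m : ℝ → ℝ := fun γ => q γ (g γ)
  have hmw : ∀ γ ∈ Ioo (0 : ℝ) 1, m γ ≤ ‖w‖ ^ 2 := by
    intro γ hγ
    have h := hq γ hγ w (by simp)
    have h2 : q γ w = ‖w‖ ^ 2 := by simp [q, hw]
    have h3 := hnn γ hγ (w - g γ)
    simp only [m]; nlinarith [sq_nonneg ‖w - g γ‖]
  have hdiff : ∀ γ ∈ Ioo (0 : ℝ) 1, ∀ γ' ∈ Ioo (0 : ℝ) 1, γ ≤ γ' →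
      ‖g γ - g γ'‖ ^ 2 ≤ m γ - m γ' := by
    intro γ hγ γ' hγ' hle
    have h1 := hq γ' hγ' (g γ) (hg γ hγ)
    have h2 := hmono γ hγ γ' hγ' hle (g γ)
    have h3 := hnn γ' hγ' (g γ - g γ')
    simp only [m]; linarith
  set S : Set ℝ := m '' Ioo (0 : ℝ) 1
  have hbdd : BddAbove S := ⟨‖w‖ ^ 2, by rintro _ ⟨γ, hγ, rfl⟩; exact hmw γ hγ⟩
  have hne : S.Nonempty := ⟨_, 1 / 2, by norm_num, rfl⟩
  have hcau : Cauchy (map g (𝓝[>] (0 : ℝ))) := by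
    rw [Metric.cauchy_iff]
    refine ⟨inferInstance, fun ε hε => ?_⟩
    -- Below `γ₁` the minimal energies lie within `ε ^ 2` of their supremum, so any two minimisers
    -- there are less than `ε` apart.
    obtain ⟨_, ⟨γ₁, hγ₁, rfl⟩, h1⟩ := exists_lt_of_lt_csSup hne
      (show sSup S - ε ^ 2 < sSup S by nlinarith [pow_pos hε 2])
    refine ⟨g '' Ioc 0 γ₁, image_mem_map (Ioc_mem_nhdsGT hγ₁.1), ?_⟩
    have key : ∀ γ γ', γ ∈ Ioc 0 γ₁ → γ' ∈ Ioc 0 γ₁ → γ ≤ γ' → ‖g γ - g γ'‖ < ε := by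
      intro γ γ' hγ hγ' hle
      have i1 : γ ∈ Ioo (0 : ℝ) 1 := ⟨hγ.1, hγ.2.trans_lt hγ₁.2⟩
      have i2 : γ' ∈ Ioo (0 : ℝ) 1 := ⟨hγ'.1, hγ'.2.trans_lt hγ₁.2⟩
      have a1 := hdiff γ i1 γ' i2 hle
      have a2 := hdiff γ' i2 γ₁ hγ₁ hγ'.2
      have a3 := le_csSup hbdd ⟨γ, i1, rfl⟩
      refine lt_of_pow_lt_pow_left₀ 2 hε.le ?_
      nlinarith [sq_nonneg ‖g γ' - g γ₁‖]
    rintro _ ⟨γ, hγ, rfl⟩ _ ⟨γ', hγ', rfl⟩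
    rcases le_total γ γ' with h | h
    · rw [dist_eq_norm]; exact key _ _ hγ hγ' h
    · rw [dist_comm, dist_eq_norm]; exact key _ _ hγ' hγ h
  obtain ⟨l, hl⟩ := CompleteSpace.complete hcau
  refine ⟨l, hl, ?_⟩
  have hev : ∀ᶠ γ in 𝓝[>] (0 : ℝ), γ ∈ Ioo (0 : ℝ) 1 := Ioo_mem_nhdsGT one_pos
  have hT : Tendsto (fun γ => ‖T (g γ)‖ ^ 2) (𝓝[>] 0) (𝓝 0) := by
    have hu : Tendsto (fun γ : ℝ => 2 * ‖w‖ ^ 2 * γ) (𝓝[>] 0) (𝓝 0) := by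
      have : Tendsto (fun γ : ℝ => 2 * ‖w‖ ^ 2 * γ) (𝓝 0) (𝓝 (2 * ‖w‖ ^ 2 * 0)) :=
        (continuous_const.mul continuous_id).tendsto 0
      rw [mul_zero] at this
      exact this.mono_left nhdsWithin_le_nhds
    -- The bound `γ < 1 / 2` makes `1 - γ` at least one half, which accounts for the factor 2 in the
    -- majorant.
    have hev2 : ∀ᶠ γ in 𝓝[>] (0 : ℝ), γ ∈ Ioo (0 : ℝ) (1 / 2) := Ioo_mem_nhdsGT (by norm_num)
    refine squeeze_zero' (Eventually.of_forall fun _ => sq_nonneg _) ?_ hu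
    filter_upwards [hev2] with γ hγ
    have i1 : γ ∈ Ioo (0 : ℝ) 1 := ⟨hγ.1, by linarith [hγ.2]⟩
    have h1 := hmw γ i1
    have h2 : (1 / γ - 1) * ‖T (g γ)‖ ^ 2 ≤ ‖w‖ ^ 2 := by
      simp only [m, q] at h1
      nlinarith [sq_nonneg ‖g γ‖]
    have h3 : (1 - γ) * ‖T (g γ)‖ ^ 2 ≤ ‖w‖ ^ 2 * γ := by
      have h0 : γ ≠ 0 := hγ.1.ne'
      have := mul_le_mul_of_nonneg_right h2 hγ.1.le
      have e : (1 / γ - 1) * ‖T (g γ)‖ ^ 2 * γ = (1 - γ) * ‖T (g γ)‖ ^ 2 := by field_simp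
      linarith
    nlinarith [sq_nonneg ‖T (g γ)‖, hγ.2]
  have hT' : Tendsto (fun γ => ‖T (g γ)‖ ^ 2) (𝓝[>] 0) (𝓝 (‖T l‖ ^ 2)) :=
    (((T.continuous.tendsto l).comp hl).norm.pow 2)
  have := tendsto_nhds_unique hT' hT
  simpa using this

end Hilbert

/-! ### Geometry of the box -/

/-- The outer unit normal along an edge of the box. -/
def Edge.normal : Edge → ℂ
  | .up => Complex.I
  | .down => -Complex.I
  | .left => -1
  | .right => 1

theorem norm_normal (e : Edge) : ‖e.normal‖ = 1 := by
  cases e <;> simp [Edge.normal]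

theorem mem_box_iff {L : ℝ} {z : ℂ} : z ∈ box L ↔ ∀ e : Edge, inner ℝ e.normal z ≤ L := by
  simp only [box, Complex.mem_reProdIm, mem_Icc]
  constructor
  · rintro ⟨⟨h1, h2⟩, h3, h4⟩ e
    cases e <;> simp [Edge.normal, Complex.inner] <;> linarith
  · intro h
    have h1 := h .up
    have h2 := h .down
    have h3 := h .left
    have h4 := h .right
    simp [Edge.normal, Complex.inner] at h1 h2 h3 h4
    refine ⟨⟨?_, ?_⟩, ?_, ?_⟩ <;> linarith

theorem mem_edge_iff {L : ℝ} {z : ℂ} {e : Edge} :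
    z ∈ edge L e ↔ z ∈ box L ∧ inner ℝ e.normal z = L := by
  cases e <;> simp [edge, Edge.normal, Complex.inner] <;> intro _ <;>
    constructor <;> intro h <;> linarith

theorem edge_subset_box (L : ℝ) (e : Edge) : edge L e ⊆ box L := fun _ h => (mem_edge_iff.1 h).1

theorem isCompact_box (L : ℝ) : IsCompact (box L) := isCompact_Icc.reProdIm isCompact_Icc

theorem isClosed_box (L : ℝ) : IsClosed (box L) := (isCompact_box L).isClosed

theorem measurableSet_box (L : ℝ) : MeasurableSet (box L) := (isClosed_box L).measurableSet

theorem convex_box (L : ℝ) : Convex ℝ (box L) := by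
  have : box L = ⋂ e : Edge, {z | inner ℝ e.normal z ≤ L} := by
    ext z; simp [mem_box_iff]
  rw [this]
  exact convex_iInter fun e => convex_halfSpace_le (innerₗ ℂ e.normal).isLinear L

theorem isCompact_edge (L : ℝ) (e : Edge) : IsCompact (edge L e) := by
  have : edge L e = box L ∩ {z | inner ℝ e.normal z = L} := by
    ext z; exact mem_edge_iff
  rw [this]
  exact (isCompact_box L).inter_right (isClosed_eq (by fun_prop) continuous_const)

instance isFiniteMeasure_box (L : ℝ) : IsFiniteMeasure (volume.restrict (box L)) :=
  ⟨by rw [Measure.restrict_apply_univ]; exact (isCompact_box L).measure_lt_top⟩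

/-! ### Gradients of `C¹` functions -/

theorem continuous_gradient {f : ℂ → ℝ} (hf : ContDiff ℝ 1 f) : Continuous (gradient f) := by
  have h := hf.continuous_fderiv one_ne_zero
  exact (InnerProductSpace.toDual ℝ ℂ).symm.continuous.comp h

theorem gradient_add_apply {f g : ℂ → ℝ} (hf : ContDiff ℝ 1 f) (hg : ContDiff ℝ 1 g) (z : ℂ) :
    gradient (fun z => f z + g z) z = gradient f z + gradient g z := by
  have h1 := (hf.differentiable one_ne_zero) z
  have h2 := (hg.differentiable one_ne_zero) z
  simp only [gradient]
  rw [fderiv_fun_add h1 h2, map_add]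

theorem gradient_sub_apply {f g : ℂ → ℝ} (hf : ContDiff ℝ 1 f) (hg : ContDiff ℝ 1 g) (z : ℂ) :
    gradient (fun z => f z - g z) z = gradient f z - gradient g z := by
  have h1 := (hf.differentiable one_ne_zero) z
  have h2 := (hg.differentiable one_ne_zero) z
  simp only [gradient]
  rw [fderiv_fun_sub h1 h2, map_sub]

theorem gradient_const_mul_apply {f : ℂ → ℝ} (hf : ContDiff ℝ 1 f) (c : ℝ) (z : ℂ) :
    gradient (fun z => c * f z) z = c • gradient f z := by
  have h1 := (hf.differentiable one_ne_zero) z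
  simp only [gradient]
  rw [fderiv_const_mul h1 c, map_smul]

theorem memLp_box_of_continuous {E : Type*} [NormedAddCommGroup E] {f : ℂ → E}
    [SecondCountableTopology E] [MeasurableSpace E] [BorelSpace E]
    (hf : Continuous f) (L : ℝ) (p : ENNReal) : MemLp f p (volume.restrict (box L)) := by
  obtain ⟨C, hC⟩ := (isCompact_box L).exists_bound_of_continuousOn hf.continuousOn
  refine MemLp.of_bound hf.aestronglyMeasurable C ?_
  filter_upwards [ae_restrict_mem (measurableSet_box L)] with z hz using hC z hz

theorem enorm_sub_le_lintegral_gradient {f : ℂ → ℝ} (hf : ContDiff ℝ 1 f) (z v : ℂ) {T : ℝ}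
    (hT : 0 ≤ T) :
    ‖f (z + T • v) - f z‖ₑ ≤ ‖v‖ₑ * ∫⁻ s in Ioc 0 T, ‖gradient f (z + s • v)‖ₑ := by
  have hd : ∀ s : ℝ, HasDerivAt (fun s : ℝ => f (z + s • v)) (inner ℝ (gradient f (z + s • v)) v) s := by
    intro s
    have h1 : HasDerivAt (fun s : ℝ => z + s • v) v s := by
      simpa using ((hasDerivAt_id s).smul_const v).const_add z
    have h2 := ((hf.differentiable one_ne_zero) (z + s • v)).hasFDerivAt.comp_hasDerivAt s h1
    rw [inner_gradient_left]
    exact h2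
  have hc : Continuous fun s : ℝ => inner ℝ (gradient f (z + s • v)) v := by
    have := continuous_gradient hf
    fun_prop
  have h := intervalIntegral.integral_eq_sub_of_hasDerivAt (a := 0) (b := T) (fun s _ => hd s)
    (hc.intervalIntegrable _ _)
  rw [zero_smul, add_zero, intervalIntegral.integral_of_le hT] at h
  rw [← h]
  refine (enorm_integral_le_lintegral_enorm _).trans ?_
  rw [← lintegral_const_mul' _ _ enorm_ne_top]
  refine lintegral_mono fun s => ?_
  rw [mul_comm, ← enorm_norm, ← enorm_norm (gradient f _), ← enorm_norm v, ← enorm_mul]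
  exact enorm_le_iff_norm_le.2 (by
    simpa using abs_real_inner_le_norm (gradient f (z + s • v)) v)

theorem lintegral_sq_le {α : Type*} [MeasurableSpace α] (μ : Measure α) {F : α → ENNReal}
    (hF : AEMeasurable F μ) : (∫⁻ a, F a ∂μ) ^ 2 ≤ μ univ * ∫⁻ a, F a ^ 2 ∂μ := by
  have h := ENNReal.lintegral_mul_le_Lp_mul_Lq μ Real.HolderConjugate.two_two
    (aemeasurable_const (b := (1 : ENNReal))) hF
  simp only [Pi.mul_apply, one_mul, ENNReal.one_rpow, lintegral_const] at h
  have h2 := pow_le_pow_left' h 2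
  rw [mul_pow, ← ENNReal.rpow_natCast, ← ENNReal.rpow_natCast, ← ENNReal.rpow_mul,
    ← ENNReal.rpow_natCast, ← ENNReal.rpow_mul] at h2
  simpa using h2

theorem eLpNorm_two_sq {α E : Type*} [MeasurableSpace α] [NormedAddCommGroup E] (μ : Measure α)
    (f : α → E) : eLpNorm f 2 μ ^ 2 = ∫⁻ a, ‖f a‖ₑ ^ 2 ∂μ := by
  have h := eLpNorm_nnreal_pow_eq_lintegral (μ := μ) (f := f) (p := 2) two_ne_zero
  simpa using h

theorem eLpNorm_two_le_mul {α β E F : Type*} [MeasurableSpace α] [MeasurableSpace β]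
    [NormedAddCommGroup E] [NormedAddCommGroup F] {μ : Measure α} {ν : Measure β} {f : α → E}
    {g : β → F} {c : ENNReal} (h : ∫⁻ a, ‖f a‖ₑ ^ 2 ∂μ ≤ c ^ 2 * ∫⁻ a, ‖g a‖ₑ ^ 2 ∂ν) :
    eLpNorm f 2 μ ≤ c * eLpNorm g 2 ν := by
  rw [← eLpNorm_two_sq, ← eLpNorm_two_sq, ← mul_pow] at h
  exact (ENNReal.pow_le_pow_left_iff two_ne_zero).1 h

theorem lintegral_translate_le {F : ℂ → ENNReal} {b E : Set ℂ} (hb : MeasurableSet b)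
    (hE : MeasurableSet E) (v : ℂ) (h : ∀ z ∈ b, z + v ∈ E) :
    ∫⁻ z in b, F (z + v) ≤ ∫⁻ z in E, F z := by
  rw [← lintegral_indicator hb, ← lintegral_indicator hE,
    ← lintegral_add_right_eq_self (E.indicator F) v]
  refine lintegral_mono fun z => ?_
  by_cases hz : z ∈ b
  · simp [hz, h z hz]
  · simp [hz]

/-- Integrate the gradient along the segment from `z` to `z + v`, apply Cauchy-Schwarz in the
parameter, and exchange the integrals. Only the gradient on the set swept out by the segments
enters. -/
theorem eLpNorm_translate_sub_le {f : ℂ → ℝ} (hf : ContDiff ℝ 1 f) {b E : Set ℂ}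
    (hb : MeasurableSet b) (hE : MeasurableSet E) (v : ℂ)
    (h : ∀ z ∈ b, ∀ s ∈ Icc (0 : ℝ) 1, z + s • v ∈ E) :
    eLpNorm (fun z => f (z + v) - f z) 2 (volume.restrict b) ≤
      ‖v‖ₑ * eLpNorm (gradient f) 2 (volume.restrict E) := by
  apply eLpNorm_two_le_mul
  have hg := continuous_gradient hf
  calc ∫⁻ z in b, ‖f (z + v) - f z‖ₑ ^ 2
      ≤ ∫⁻ z in b, ‖v‖ₑ ^ 2 * ∫⁻ s in Ioc (0 : ℝ) 1, ‖gradient f (z + s • v)‖ₑ ^ 2 := by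
        refine lintegral_mono fun z => ?_
        have h1 := enorm_sub_le_lintegral_gradient hf z v zero_le_one
        rw [one_smul] at h1
        refine (pow_le_pow_left' h1 2).trans ?_
        rw [mul_pow]
        gcongr
        refine (lintegral_sq_le _ (Continuous.aemeasurable (by fun_prop))).trans ?_
        simp
    _ = ‖v‖ₑ ^ 2 * ∫⁻ s in Ioc (0 : ℝ) 1, ∫⁻ z in b, ‖gradient f (z + s • v)‖ₑ ^ 2 := by
        rw [lintegral_const_mul' _ _ (by simp), lintegral_lintegral_swap]
        exact Continuous.aemeasurable (by fun_prop)
    _ ≤ ‖v‖ₑ ^ 2 * ∫⁻ s in Ioc (0 : ℝ) 1, ∫⁻ z in E, ‖gradient f z‖ₑ ^ 2 := by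
        refine mul_le_mul_right ?_ _
        refine setLIntegral_mono' measurableSet_Ioc fun s (hs : s ∈ Ioc (0 : ℝ) 1) => ?_
        exact lintegral_translate_le (F := fun z => ‖gradient f z‖ₑ ^ 2) hb hE (s • v)
          fun z hz => h z hz s (Ioc_subset_Icc_self hs)
    _ = _ := by simp

theorem inner_normal_self (e : Edge) : inner ℝ e.normal e.normal = (1 : ℝ) := by
  rw [real_inner_self_eq_norm_sq, norm_normal]; norm_num

theorem neg_le_inner_normal {L : ℝ} {z : ℂ} (hz : z ∈ box L) (e : Edge) :
    -L ≤ inner ℝ e.normal z := by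
  rw [mem_box_iff] at hz
  have h1 := hz .up
  have h2 := hz .down
  have h3 := hz .left
  have h4 := hz .right
  cases e <;> simp [Edge.normal, Complex.inner] at * <;> linarith

theorem add_smul_normal_mem_box {L : ℝ} {z : ℂ} (hz : z ∈ box L) (e : Edge) {s : ℝ} (hs : 0 ≤ s)
    (hs' : s ≤ L - inner ℝ e.normal z) : z + s • e.normal ∈ box L := by
  have h0 := neg_le_inner_normal hz e
  rw [mem_box_iff] at hz ⊢
  intro e'
  have h1 := hz e'
  cases e <;> cases e' <;> simp [Edge.normal, Complex.inner] at * <;> linarith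

/-- Run from `z` along the normal until the edge where `f` vanishes; the path has length at most `2
* L`. Zero data on a single edge suffices. -/
theorem poincare_contDiff {L : ℝ} {f : ℂ → ℝ} (hf : ContDiff ℝ 1 f) {e : Edge}
    (h0 : ∀ z ∈ edge L e, f z = 0) :
    l2Norm L f ≤ ENNReal.ofReal (2 * L) * l2Norm L (gradient f) := by
  apply eLpNorm_two_le_mul
  have hg := continuous_gradient hf
  have hm := measurableSet_box L
  set G : ℂ → ENNReal := (box L).indicator fun z => ‖gradient f z‖ₑ with hG
  have hGm : Measurable G := (Continuous.measurable (by fun_prop)).indicator hm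
  have hGG : ∫⁻ z, G z ^ 2 = ∫⁻ z in box L, ‖gradient f z‖ₑ ^ 2 := by
    rw [← lintegral_indicator hm]
    refine lintegral_congr fun z => ?_
    by_cases hz : z ∈ box L <;> simp [hG, hz]
  have hj : Measurable fun p : ℂ × ℝ => G (p.1 + p.2 • e.normal) ^ 2 :=
    (hGm.comp (Continuous.measurable (by fun_prop))).pow_const 2
  calc ∫⁻ z in box L, ‖f z‖ₑ ^ 2
      ≤ ∫⁻ z in box L, ENNReal.ofReal (2 * L) *
          ∫⁻ s in Ioc 0 (2 * L), G (z + s • e.normal) ^ 2 := by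
        refine setLIntegral_mono' hm fun z hz => ?_
        set T := L - inner ℝ e.normal z
        have hT : 0 ≤ T := sub_nonneg.2 (mem_box_iff.1 hz e)
        have hT2 : T ≤ 2 * L := by have := neg_le_inner_normal hz e; simp only [T]; linarith
        have hend : f (z + T • e.normal) = 0 := by
          apply h0
          rw [mem_edge_iff]
          refine ⟨add_smul_normal_mem_box hz e hT le_rfl, ?_⟩
          rw [inner_add_right, real_inner_smul_right, inner_normal_self]
          simp only [T]; ring
        have h1 := enorm_sub_le_lintegral_gradient hf z e.normal hT
        rw [hend, zero_sub, enorm_neg] at h1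
        have hn : ‖e.normal‖ₑ = 1 := by rw [← enorm_norm, norm_normal]; simp
        rw [hn, one_mul] at h1
        have h2 : ‖f z‖ₑ ≤ ∫⁻ s in Ioc 0 (2 * L), G (z + s • e.normal) := by
          refine h1.trans ?_
          calc ∫⁻ s in Ioc 0 T, ‖gradient f (z + s • e.normal)‖ₑ
              = ∫⁻ s in Ioc 0 T, G (z + s • e.normal) := by
                refine setLIntegral_congr_fun measurableSet_Ioc fun s hs => ?_
                simp only [hG]
                rw [indicator_of_mem (add_smul_normal_mem_box hz e hs.1.le hs.2)]
            _ ≤ _ := lintegral_mono_set (Ioc_subset_Ioc_right hT2)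
        refine (pow_le_pow_left' h2 2).trans ?_
        refine (lintegral_sq_le _ (hGm.comp
          (Continuous.measurable (by fun_prop))).aemeasurable).trans ?_
        simp
    _ = ENNReal.ofReal (2 * L) *
          ∫⁻ s in Ioc 0 (2 * L), ∫⁻ z in box L, G (z + s • e.normal) ^ 2 := by
        rw [lintegral_const_mul' _ _ ENNReal.ofReal_ne_top, lintegral_lintegral_swap]
        exact hj.aemeasurable
    _ ≤ ENNReal.ofReal (2 * L) * ∫⁻ s in Ioc 0 (2 * L), ∫⁻ z, G z ^ 2 := by
        refine mul_le_mul_right (lintegral_mono fun s => ?_) _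
        refine (setLIntegral_le_lintegral _ _).trans_eq ?_
        exact lintegral_add_right_eq_self (fun z => G z ^ 2) _
    _ = _ := by
        rw [hGG]
        simp
        ring

/-! ### Sobolev functions with boundary values -/

/-- `C¹` functions with the boundary values `0` on `e₀` and `u₀` on `e₁`. -/
def Admissible (L : ℝ) (e₀ e₁ : Edge) (u₀ : ℝ) (f : ℂ → ℝ) : Prop :=
  ContDiff ℝ 1 f ∧ (∀ z ∈ edge L e₀, f z = 0) ∧ (∀ z ∈ edge L e₁, f z = u₀)

variable {L : ℝ} {e₀ e₁ : Edge} {u₀ : ℝ}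

theorem Admissible.sub {f g : ℂ → ℝ} {a b : ℝ} (hf : Admissible L e₀ e₁ a f)
    (hg : Admissible L e₀ e₁ b g) : Admissible L e₀ e₁ (a - b) (fun z => f z - g z) :=
  ⟨hf.1.sub hg.1, fun z hz => by simp [hf.2.1 z hz, hg.2.1 z hz],
    fun z hz => by simp [hf.2.2 z hz, hg.2.2 z hz]⟩

theorem Admissible.add {f g : ℂ → ℝ} {a b : ℝ} (hf : Admissible L e₀ e₁ a f)
    (hg : Admissible L e₀ e₁ b g) : Admissible L e₀ e₁ (a + b) (fun z => f z + g z) :=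
  ⟨hf.1.add hg.1, fun z hz => by simp [hf.2.1 z hz, hg.2.1 z hz],
    fun z hz => by simp [hf.2.2 z hz, hg.2.2 z hz]⟩

theorem Admissible.const_mul {f : ℂ → ℝ} {a : ℝ} (hf : Admissible L e₀ e₁ a f) (c : ℝ) :
    Admissible L e₀ e₁ (c * a) (fun z => c * f z) :=
  ⟨contDiff_const.mul hf.1, fun z hz => by simp [hf.2.1 z hz], fun z hz => by simp [hf.2.2 z hz]⟩

theorem Admissible.memLp {f : ℂ → ℝ} (hf : Admissible L e₀ e₁ u₀ f) :
    MemLp f 2 (volume.restrict (box L)) := memLp_box_of_continuous hf.1.continuous L 2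

theorem Admissible.memLp_gradient {f : ℂ → ℝ} (hf : Admissible L e₀ e₁ u₀ f) :
    MemLp (gradient f) 2 (volume.restrict (box L)) :=
  memLp_box_of_continuous (continuous_gradient hf.1) L 2

theorem l2Norm_sub_sub_le {E : Type*} [NormedAddCommGroup E] {f g f' g' : ℂ → E}
    (hf : MemLp f 2 (volume.restrict (box L))) (hg : MemLp g 2 (volume.restrict (box L)))
    (hf' : MemLp f' 2 (volume.restrict (box L))) (hg' : MemLp g' 2 (volume.restrict (box L))) :
    l2Norm L (fun z => (f z - f' z) - (g z - g' z)) ≤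
      l2Norm L (fun z => f z - g z) + l2Norm L (fun z => f' z - g' z) := by
  have h := eLpNorm_sub_le (hf.sub hg).1 (hf'.sub hg').1 one_le_two
  refine le_trans (le_of_eq ?_) h
  refine eLpNorm_congr_ae (Eventually.of_forall fun z => ?_)
  simp only [Pi.sub_apply]; abel

theorem SobolevBC.sub {u u' : ℂ → ℝ} {g g' : ℂ → ℂ} {a b : ℝ} (h : SobolevBC L e₀ e₁ a u g)
    (h' : SobolevBC L e₀ e₁ b u' g') :
    SobolevBC L e₀ e₁ (a - b) (fun z => u z - u' z) (fun z => g z - g' z) := by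
  obtain ⟨hu, hg, f, hf, h1, h2⟩ := h
  obtain ⟨hu', hg', f', hf', h1', h2'⟩ := h'
  refine ⟨hu.sub hu', hg.sub hg', fun n z => f n z - f' n z,
    fun n => Admissible.sub (hf n) (hf' n), ?_, ?_⟩
  · have h3 := h1.add h1'
    rw [add_zero] at h3
    refine tendsto_of_tendsto_of_tendsto_of_le_of_le tendsto_const_nhds h3 (fun _ => zero_le)
      fun n => ?_
    exact l2Norm_sub_sub_le (Admissible.memLp (hf n)) hu (Admissible.memLp (hf' n)) hu'
  · have h3 := h2.add h2'
    rw [add_zero] at h3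
    refine tendsto_of_tendsto_of_tendsto_of_le_of_le tendsto_const_nhds h3 (fun _ => zero_le)
      fun n => ?_
    have := l2Norm_sub_sub_le (Admissible.memLp_gradient (hf n)) hg
      (Admissible.memLp_gradient (hf' n)) hg'
    refine le_trans (le_of_eq ?_) this
    congr 1
    funext z
    rw [gradient_sub_apply (hf n).1 (hf' n).1]

theorem tendsto_eLpNorm_of_sub {E : Type*} [NormedAddCommGroup E] {μ : Measure ℂ}
    {f : ℕ → ℂ → E} {u : ℂ → E}
    (hf : ∀ n, AEStronglyMeasurable (f n) μ) (hu : MemLp u 2 μ)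
    (h : Tendsto (fun n => eLpNorm (fun z => f n z - u z) 2 μ) atTop (𝓝 0)) :
    Tendsto (fun n => eLpNorm (f n) 2 μ) atTop (𝓝 (eLpNorm u 2 μ)) := by
  refine tendsto_of_tendsto_of_tendsto_of_le_of_le
    (g := fun n => eLpNorm u 2 μ - eLpNorm (fun z => f n z - u z) 2 μ)
    (h := fun n => eLpNorm u 2 μ + eLpNorm (fun z => f n z - u z) 2 μ) ?_ ?_ ?_ ?_
  · have := ENNReal.Tendsto.sub (tendsto_const_nhds (x := eLpNorm u 2 μ)) h (Or.inl hu.2.ne)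
    simpa using this
  · have := (tendsto_const_nhds (x := eLpNorm u 2 μ) (f := (atTop : Filter ℕ))).add h
    simpa using this
  · intro n
    simp only
    rw [tsub_le_iff_right]
    have := eLpNorm_sub_le (hf n) ((hf n).sub hu.1) (one_le_two)
    rwa [sub_sub_cancel] at this
  · intro n
    have := eLpNorm_add_le hu.1 ((hf n).sub hu.1) (one_le_two)
    rwa [add_sub_cancel] at this

theorem SobolevBC.poincare {u : ℂ → ℝ} {g : ℂ → ℂ} (h : SobolevBC L e₀ e₁ 0 u g) :
    l2Norm L u ≤ ENNReal.ofReal (2 * L) * l2Norm L g := by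
  obtain ⟨hu, hg, f, hf, h1, h2⟩ := h
  have t1 := tendsto_eLpNorm_of_sub (fun n => (Admissible.memLp (hf n)).1) hu h1
  have t2 := tendsto_eLpNorm_of_sub (fun n => (Admissible.memLp_gradient (hf n)).1) hg h2
  exact le_of_tendsto_of_tendsto' t1
    (ENNReal.Tendsto.const_mul t2 (Or.inr ENNReal.ofReal_ne_top))
    fun n => poincare_contDiff (hf n).1 (hf n).2.1

theorem eLpNorm_translate_le {f : ℂ → ℝ} {b E : Set ℂ} (hb : MeasurableSet b)
    (hE : MeasurableSet E) (v : ℂ) (h : ∀ z ∈ b, z + v ∈ E) :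
    eLpNorm (fun z => f (z + v)) 2 (volume.restrict b) ≤ eLpNorm f 2 (volume.restrict E) := by
  rw [← one_mul (eLpNorm f 2 _)]
  apply eLpNorm_two_le_mul
  rw [one_pow, one_mul]
  exact lintegral_translate_le (F := fun z => ‖f z‖ₑ ^ 2) hb hE v h

theorem aestronglyMeasurable_translate {f : ℂ → ℝ} {b E : Set ℂ}
    (hE : MeasurableSet E) (v : ℂ) (h : ∀ z ∈ b, z + v ∈ E)
    (hf : AEStronglyMeasurable f (volume.restrict E)) :
    AEStronglyMeasurable (fun z => f (z + v)) (volume.restrict b) := by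
  have hp : MeasurePreserving (fun z : ℂ => z + v) (volume.restrict ((fun z => z + v) ⁻¹' E))
      (volume.restrict E) := (measurePreserving_add_right volume v).restrict_preimage hE
  exact (hf.comp_measurePreserving hp).mono_measure (Measure.restrict_mono h le_rfl)

/-- The difference estimate for C¹ functions survives the passage to the L² limit. It is the only
access to weak gradients used in the constancy arguments. -/
theorem SobolevBC.translate {u : ℂ → ℝ} {g : ℂ → ℂ} (hs : SobolevBC L e₀ e₁ u₀ u g)
    {b E : Set ℂ} (hb : MeasurableSet b) (hE : MeasurableSet E) (hEL : E ⊆ box L) (v : ℂ)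
    (h : ∀ z ∈ b, ∀ s ∈ Icc (0 : ℝ) 1, z + s • v ∈ E) :
    eLpNorm (fun z => u (z + v) - u z) 2 (volume.restrict b) ≤
      ‖v‖ₑ * eLpNorm g 2 (volume.restrict E) := by
  obtain ⟨hu, hg, f, hf, h1, h2⟩ := hs
  have hv : ∀ z ∈ b, z + v ∈ E := fun z hz => by simpa using h z hz 1 (by simp)
  have hbE : b ⊆ E := fun z hz => by simpa using h z hz 0 (by simp)
  have hmono : ∀ {F : Type} [NormedAddCommGroup F] (k : ℂ → F),
      eLpNorm k 2 (volume.restrict E) ≤ l2Norm L k := fun k =>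
    eLpNorm_mono_measure _ (Measure.restrict_mono hEL le_rfl)
  have huE : MemLp u 2 (volume.restrict E) := hu.mono_measure (Measure.restrict_mono hEL le_rfl)
  have hgE : MemLp g 2 (volume.restrict E) := hg.mono_measure (Measure.restrict_mono hEL le_rfl)
  have hub : MemLp (fun z => u (z + v) - u z) 2 (volume.restrict b) := by
    refine MemLp.sub ⟨aestronglyMeasurable_translate hE v hv huE.1, ?_⟩
      (huE.mono_measure (Measure.restrict_mono hbE le_rfl))
    exact (eLpNorm_translate_le hb hE v hv).trans_lt huE.2
  have t2 : Tendsto (fun n => eLpNorm (gradient (f n)) 2 (volume.restrict E)) atTop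
      (𝓝 (eLpNorm g 2 (volume.restrict E))) := by
    refine tendsto_eLpNorm_of_sub
      (fun n => (continuous_gradient (hf n).1).aestronglyMeasurable) hgE ?_
    exact tendsto_of_tendsto_of_tendsto_of_le_of_le tendsto_const_nhds h2 (fun _ => zero_le)
      fun n => hmono _
  have t1 : Tendsto (fun n => eLpNorm (fun z => f n (z + v) - f n z) 2 (volume.restrict b)) atTop
      (𝓝 (eLpNorm (fun z => u (z + v) - u z) 2 (volume.restrict b))) := by
    have hc : ∀ n, Continuous (f n) := fun n => (hf n).1.continuous
    refine tendsto_eLpNorm_of_sub (fun n => Continuous.aestronglyMeasurable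
      (by have := hc n; fun_prop)) hub ?_
    have h3 := h1.add h1
    rw [add_zero] at h3
    refine tendsto_of_tendsto_of_tendsto_of_le_of_le tendsto_const_nhds h3 (fun _ => zero_le)
      fun n => ?_
    have hm : AEStronglyMeasurable (fun z => f n z - u z) (volume.restrict E) :=
      (hc n).aestronglyMeasurable.sub huE.1
    have a1 := eLpNorm_sub_le (aestronglyMeasurable_translate hE v hv hm)
      (hm.mono_measure (Measure.restrict_mono hbE le_rfl)) one_le_two
    have a2 := eLpNorm_translate_le (f := fun z => f n z - u z) hb hE v hv
    have a3 : eLpNorm (fun z => f n z - u z) 2 (volume.restrict b) ≤ _ :=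
      eLpNorm_mono_measure _ (Measure.restrict_mono hbE le_rfl)
    refine le_trans (le_of_eq ?_) (a1.trans
      (add_le_add (a2.trans (hmono _)) (a3.trans (hmono _))))
    congr 1
    funext z
    simp only [Pi.sub_apply]; ring
  exact le_of_tendsto_of_tendsto' t1
    (ENNReal.Tendsto.const_mul t2 (Or.inr enorm_ne_top))
    fun n => eLpNorm_translate_sub_le (hf n).1 hb hE v h

/-! ### The space of gradients -/

/-- The `L²`-space of vector fields over the box. -/
noncomputable abbrev FieldSpace (L : ℝ) := Lp ℂ 2 (volume.restrict (box L))

/-- Gradients of `C¹` functions which vanish on the edges `e₀` and `e₁`. -/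
noncomputable def smoothGradients (L : ℝ) (e₀ e₁ : Edge) : Submodule ℝ (FieldSpace L) where
  carrier := {x | ∃ f, Admissible L e₀ e₁ 0 f ∧ x =ᵐ[volume.restrict (box L)] gradient f}
  zero_mem' := by
    refine ⟨fun _ => 0, ⟨contDiff_const, fun _ _ => rfl, fun _ _ => rfl⟩, ?_⟩
    filter_upwards [Lp.coeFn_zero ℂ 2 (volume.restrict (box L))] with z hz
    rw [hz]
    simp
  add_mem' := by
    rintro x y ⟨f, hf, hx⟩ ⟨g, hg, hy⟩
    refine ⟨fun z => f z + g z, by simpa using hf.add hg, ?_⟩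
    filter_upwards [Lp.coeFn_add x y, hx, hy] with z h1 h2 h3
    rw [h1, Pi.add_apply, h2, h3, gradient_add_apply hf.1 hg.1]
  smul_mem' := by
    rintro c x ⟨f, hf, hx⟩
    refine ⟨fun z => c * f z, by simpa using hf.const_mul c, ?_⟩
    filter_upwards [Lp.coeFn_smul c x, hx] with z h1 h2
    rw [h1, Pi.smul_apply, h2, gradient_const_mul_apply hf.1]

theorem mem_smoothGradients {f : ℂ → ℝ} (hf : Admissible L e₀ e₁ 0 f) :
    hf.memLp_gradient.toLp ∈ smoothGradients L e₀ e₁ := ⟨f, hf, hf.memLp_gradient.coeFn_toLp⟩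

/-- The closure of the gradients of `C¹` functions which vanish on `e₀` and `e₁`. -/
noncomputable def gradientSpace (L : ℝ) (e₀ e₁ : Edge) : Submodule ℝ (FieldSpace L) :=
  (smoothGradients L e₀ e₁).topologicalClosure

theorem SobolevBC.mem_gradientSpace {u : ℂ → ℝ} {g : ℂ → ℂ} (h : SobolevBC L e₀ e₁ 0 u g) :
    h.2.1.toLp ∈ gradientSpace L e₀ e₁ := by
  obtain ⟨hu, hg, f, hf, h1, h2⟩ := h
  have hf' : ∀ n, Admissible L e₀ e₁ 0 (f n) := hf
  have ht : Tendsto (fun n => (hf' n).memLp_gradient.toLp) atTop (𝓝 hg.toLp) := by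
    rw [Lp.tendsto_Lp_iff_tendsto_eLpNorm'']
    exact h2
  exact mem_closure_of_tendsto ht (Eventually.of_forall fun n => mem_smoothGradients (hf' n))

theorem SobolevBC.of_admissible {f : ℂ → ℝ} (hf : Admissible L e₀ e₁ u₀ f) :
    SobolevBC L e₀ e₁ u₀ f (gradient f) := by
  refine ⟨hf.memLp, hf.memLp_gradient, fun _ => f, fun _ => hf, ?_, ?_⟩ <;> simp [l2Norm]

/-- A limit of gradients is again a gradient: by the Poincaré inequality the approximating
potentials are Cauchy in L² as soon as their gradients are. -/
theorem exists_sobolevBC_of_mem {f : ℂ → ℝ} (hf : Admissible L e₀ e₁ u₀ f) {x : FieldSpace L}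
    (hx : x ∈ gradientSpace L e₀ e₁) :
    ∃ u, SobolevBC L e₀ e₁ u₀ u (⇑(hf.memLp_gradient.toLp + x)) := by
  obtain ⟨y, hy, hyx⟩ := mem_closure_iff_seq_limit.1 hx
  choose φ hφ hyφ' using hy
  have hyφ : ∀ n, y n = (hφ n).memLp_gradient.toLp := fun n =>
    Lp.ext ((hyφ' n).trans (hφ n).memLp_gradient.coeFn_toLp.symm)
  have hcau : CauchySeq fun n => (hφ n).memLp.toLp := by
    have hyc := hyx.cauchySeq
    rw [EMetric.cauchySeq_iff] at hyc ⊢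
    intro ε hε
    rcases eq_or_ne ε ⊤ with rfl | hεt
    · refine ⟨0, fun m _ n _ => ?_⟩
      rw [Lp.edist_toLp_toLp]
      exact ((hφ m).memLp.sub (hφ n).memLp).2
    -- The added 1 keeps the divisor nonzero, since no sign of `L` is assumed here.
    · have hC : (0 : ENNReal) < ENNReal.ofReal (2 * L) + 1 := by simp
      have hC' : ENNReal.ofReal (2 * L) + 1 ≠ ⊤ :=
        ENNReal.add_ne_top.2 ⟨ENNReal.ofReal_ne_top, ENNReal.one_ne_top⟩
      obtain ⟨N, hN⟩ := hyc (ε / (ENNReal.ofReal (2 * L) + 1)) (ENNReal.div_pos hε.ne' hC')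
      refine ⟨N, fun m hm n hn => ?_⟩
      have h1 := hN m hm n hn
      rw [hyφ m, hyφ n, Lp.edist_toLp_toLp] at h1
      rw [Lp.edist_toLp_toLp]
      have h2 := poincare_contDiff (L := L) ((hφ m).1.sub (hφ n).1) (e := e₀)
        fun z hz => by simp [(hφ m).2.1 z hz, (hφ n).2.1 z hz]
      have h3 : l2Norm L (gradient fun z => φ m z - φ n z) =
          eLpNorm (gradient (φ m) - gradient (φ n)) 2 (volume.restrict (box L)) := by
        rw [l2Norm]
        congr 1
        funext z
        exact gradient_sub_apply (hφ m).1 (hφ n).1 z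
      have h2' : eLpNorm (φ m - φ n) 2 (volume.restrict (box L)) ≤ _ := h2
      refine h2'.trans_lt ?_
      rw [h3]
      rw [ENNReal.lt_div_iff_mul_lt (Or.inl hC.ne') (Or.inl hC'), mul_comm] at h1
      refine lt_of_le_of_lt ?_ h1
      gcongr
      exact le_self_add
  obtain ⟨U, hU⟩ := cauchySeq_tendsto_of_complete hcau
  have hUm := Lp.memLp U
  refine ⟨fun z => f z + U z, hf.memLp.add hUm, Lp.memLp _, fun n z => f z + φ n z,
    fun n => ?_, ?_, ?_⟩
  · have := hf.add (hφ n)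
    rwa [add_zero] at this
  · rw [← Lp.toLp_coeFn U hUm, Lp.tendsto_Lp_iff_tendsto_eLpNorm''] at hU
    refine hU.congr fun n => ?_
    rw [l2Norm]
    congr 1
    funext z
    simp
  · have hxm := Lp.memLp x
    have hyx' : Tendsto (fun n => (hφ n).memLp_gradient.toLp) atTop (𝓝 (hxm.toLp)) := by
      rw [Lp.toLp_coeFn]
      exact hyx.congr fun n => hyφ n
    rw [Lp.tendsto_Lp_iff_tendsto_eLpNorm''] at hyx'
    refine hyx'.congr fun n => ?_
    refine eLpNorm_congr_ae ?_
    filter_upwards [Lp.coeFn_add (hf.memLp_gradient.toLp) x, hf.memLp_gradient.coeFn_toLp]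
      with z h1 h2
    rw [gradient_add_apply hf.1 (hφ n).1, h1]
    simp only [Pi.add_apply, Pi.sub_apply]
    rw [h2]; abel

/-! ### Existence of potentials and their high contrast limit -/

section Variational

variable {L : ℝ} {e₀ e₁ : Edge} {u₀ : ℝ} {D : Set ℂ}

/-- Dictionary between the conductivity problem and the abstract form: the conductivity is `γ` plus
`1 - γ` times the indicator of `D`. -/
theorem integral_cond_mul_inner (hD : MeasurableSet D) (hDL : D ⊆ box L) {σ : ℂ → ℝ} {γ : ℝ}
    (hσ : ∀ z ∈ D, σ z = 1) (hσ' : ∀ z ∈ box L \ D, σ z = γ) {g : ℂ → ℂ} {h : ℂ → ℂ}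
    (hg : MemLp g 2 (volume.restrict (box L))) (hh : MemLp h 2 (volume.restrict (box L))) :
    ∫ z in box L, σ z * inner ℝ (g z) (h z) =
      γ * inner ℝ hg.toLp hh.toLp + (1 - γ) *
        inner ℝ (LpToLpRestrictCLM ℂ ℂ ℝ (volume.restrict (box L)) 2 D hg.toLp)
          (LpToLpRestrictCLM ℂ ℂ ℝ (volume.restrict (box L)) 2 D hh.toLp) := by
  have hi : Integrable (fun z => inner ℝ (hg.toLp g z) (hh.toLp h z)) (volume.restrict (box L)) :=
    L2.integrable_inner _ _
  have hi' : Integrable (fun z => inner ℝ (g z) (h z)) (volume.restrict (box L)) := by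
    refine hi.congr ?_
    filter_upwards [hg.coeFn_toLp, hh.coeFn_toLp] with z h1 h2
    rw [h1, h2]
  have hrr : (volume.restrict (box L)).restrict D = volume.restrict D := by
    rw [Measure.restrict_restrict hD, inter_eq_left.2 hDL]
  have hle : volume.restrict D ≤ volume.restrict (box L) := Measure.restrict_mono hDL le_rfl
  have e1 : inner ℝ hg.toLp hh.toLp = ∫ z in box L, inner ℝ (g z) (h z) := by
    rw [L2.inner_def]
    refine integral_congr_ae ?_
    filter_upwards [hg.coeFn_toLp, hh.coeFn_toLp] with z h1 h2
    rw [h1, h2]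
  have e2 : inner ℝ (LpToLpRestrictCLM ℂ ℂ ℝ (volume.restrict (box L)) 2 D hg.toLp)
          (LpToLpRestrictCLM ℂ ℂ ℝ (volume.restrict (box L)) 2 D hh.toLp) =
        ∫ z in D, inner ℝ (g z) (h z) := by
    rw [L2.inner_def, ← hrr]
    refine integral_congr_ae ?_
    have a1 := LpToLpRestrictCLM_coeFn (μ := volume.restrict (box L)) ℝ D hg.toLp
    have a2 := LpToLpRestrictCLM_coeFn (μ := volume.restrict (box L)) ℝ D hh.toLp
    have b1 := ae_mono (Measure.restrict_le_self (s := D)) hg.coeFn_toLp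
    have b2 := ae_mono (Measure.restrict_le_self (s := D)) hh.coeFn_toLp
    filter_upwards [a1, a2, b1, b2] with z h1 h2 h3 h4
    rw [h1, h2, h3, h4]
  rw [e1, e2, ← integral_const_mul, ← integral_const_mul]
  have e3 : ∫ z in D, (1 - γ) * inner ℝ (g z) (h z) =
      ∫ z in box L, D.indicator (fun z => (1 - γ) * inner ℝ (g z) (h z)) z := by
    rw [integral_indicator hD, hrr]
  rw [e3, ← integral_add (hi'.const_mul γ) ((hi'.const_mul _).indicator hD)]
  refine integral_congr_ae ?_
  filter_upwards [ae_restrict_mem (measurableSet_box L)] with z hz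
  by_cases hzD : z ∈ D
  · simp only [indicator_of_mem hzD, hσ z hzD]; ring
  · simp only [indicator_of_notMem hzD, hσ' z ⟨hz, hzD⟩]; ring

theorem exists_isPotential (hD : MeasurableSet D) (hDL : D ⊆ box L) {σ : ℂ → ℝ} {γ : ℝ}
    (hγ : γ ∈ Ioo (0 : ℝ) 1) (hσ : ∀ z ∈ D, σ z = 1) (hσ' : ∀ z ∈ box L \ D, σ z = γ) {f : ℂ → ℝ}
    (hf : Admissible L e₀ e₁ u₀ f) : ∃ u g, IsPotential L σ e₀ e₁ u₀ u g := by
  obtain ⟨v, hv, hw⟩ := exists_weak_solution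
    (LpToLpRestrictCLM ℂ ℂ ℝ (volume.restrict (box L)) 2 D) (gradientSpace L e₀ e₁)
    (Submodule.isClosed_topologicalClosure _) hf.memLp_gradient.toLp hγ
  obtain ⟨u, hu⟩ := exists_sobolevBC_of_mem hf hv
  refine ⟨u, _, hu, fun φ h1 h2 h3 => ?_⟩
  have hφ : Admissible L e₀ e₁ 0 φ := ⟨h1, h2, h3⟩
  rw [integral_cond_mul_inner hD hDL hσ hσ' (Lp.memLp _) hφ.memLp_gradient, Lp.toLp_coeFn]
  exact hw _ (Submodule.le_topologicalClosure _ (mem_smoothGradients hφ))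

theorem weak_form_of_mem_gradientSpace {H' : Type*} [NormedAddCommGroup H']
    [InnerProductSpace ℝ H'] (T : FieldSpace L →L[ℝ] H') {γ : ℝ} {x : FieldSpace L}
    (h : ∀ φ ∈ smoothGradients L e₀ e₁, γ * inner ℝ x φ + (1 - γ) * inner ℝ (T x) (T φ) = 0) :
    ∀ φ ∈ gradientSpace L e₀ e₁, γ * inner ℝ x φ + (1 - γ) * inner ℝ (T x) (T φ) = 0 := by
  intro φ hφ
  have hc : IsClosed {φ : FieldSpace L | γ * inner ℝ x φ + (1 - γ) * inner ℝ (T x) (T φ) = 0} :=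
    isClosed_eq (by fun_prop) continuous_const
  exact closure_minimal (fun φ hφ => h φ hφ) hc hφ

/-- The abstract limit theorem is applied with `T` the restriction to `D`, so that `T l = 0` says
that the limit gradient vanishes there. Closedness of the gradient space keeps the boundary values,
and the Poincaré inequality recovers convergence of the potentials. -/
theorem exists_limit_potential (hD : MeasurableSet D) (hDL : D ⊆ box L) {σ : ℝ → ℂ → ℝ}
    (hσ : ∀ γ, ∀ z ∈ D, σ γ z = 1) (hσ' : ∀ γ, ∀ z ∈ box L \ D, σ γ z = γ) {w : ℂ → ℝ}
    (hw : Admissible L e₀ e₁ u₀ w) (hwD : ∀ z ∈ D, gradient w z = 0)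
    {u : ℝ → ℂ → ℝ} {g : ℝ → ℂ → ℂ}
    (hu : ∀ γ ∈ Ioo (0 : ℝ) 1, IsPotential L (σ γ) e₀ e₁ u₀ (u γ) (g γ)) :
    ∃ (ulim : ℂ → ℝ) (glim : ℂ → ℂ), SobolevBC L e₀ e₁ u₀ ulim glim ∧
      Tendsto (fun γ => l2Norm L (fun z => u γ z - ulim z)) (𝓝[>] 0) (𝓝 0) ∧
      Tendsto (fun γ => l2Norm L (fun z => g γ z - glim z)) (𝓝[>] 0) (𝓝 0) ∧
      ∀ᵐ z ∂(volume.restrict D), glim z = 0 := by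
  classical
  set T := LpToLpRestrictCLM ℂ ℂ ℝ (volume.restrict (box L)) 2 D with hT
  have hrr : (volume.restrict (box L)).restrict D = volume.restrict D := by
    rw [Measure.restrict_restrict hD, inter_eq_left.2 hDL]
  have hle : volume.restrict D ≤ volume.restrict (box L) := Measure.restrict_mono hDL le_rfl
  have hTzero : ∀ x : FieldSpace L, T x = 0 ↔ ∀ᵐ z ∂(volume.restrict D), x z = 0 := by
    intro x
    have a1 := LpToLpRestrictCLM_coeFn (μ := volume.restrict (box L)) ℝ D x
    rw [Lp.eq_zero_iff_ae_eq_zero, ← hrr]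
    constructor
    · intro h; filter_upwards [a1, h] with z h1 h2; rw [← h1, h2]; rfl
    · intro h; filter_upwards [a1, h] with z h1 h2; rw [h1, h2]; rfl
  -- Nothing is known about `g γ` outside (0, 1); the value 0 there is arbitrary and does not affect
  -- the limit at 0⁺.
  let G : ℝ → FieldSpace L := fun γ =>
    if h : γ ∈ Ioo (0 : ℝ) 1 then (hu γ h).1.2.1.toLp else 0
  have hG : ∀ γ (h : γ ∈ Ioo (0 : ℝ) 1), G γ = (hu γ h).1.2.1.toLp := fun γ h => dif_pos h
  have hws := SobolevBC.of_admissible hw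
  have hTw : T hw.memLp_gradient.toLp = 0 := by
    rw [hTzero]
    filter_upwards [ae_mono hle hw.memLp_gradient.coeFn_toLp, ae_restrict_mem hD] with z h1 h2
    rw [h1, hwD z h2]
  have hmem : ∀ {u₁ u₂ : ℂ → ℝ} {g₁ g₂ : ℂ → ℂ} (h₁ : SobolevBC L e₀ e₁ u₀ u₁ g₁)
      (h₂ : SobolevBC L e₀ e₁ u₀ u₂ g₂), h₁.2.1.toLp - h₂.2.1.toLp ∈ gradientSpace L e₀ e₁ := by
    intro u₁ u₂ g₁ g₂ h₁ h₂
    have h := h₁.sub h₂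
    rw [sub_self] at h
    have h' := h.mem_gradientSpace
    rw [← MemLp.toLp_sub]
    exact h'
  obtain ⟨l, hl, hTl⟩ := exists_high_contrast_limit T (gradientSpace L e₀ e₁)
    hw.memLp_gradient.toLp hTw G
    (fun γ hγ => by rw [hG γ hγ]; exact hmem hws (hu γ hγ).1)
    (fun γ hγ => by
      refine weak_form_of_mem_gradientSpace T ?_
      rintro x ⟨φ, hφ, hx⟩
      have hx' : x = hφ.memLp_gradient.toLp := Lp.ext (hx.trans hφ.memLp_gradient.coeFn_toLp.symm)
      have := (hu γ hγ).2 φ hφ.1 hφ.2.1 hφ.2.2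
      rw [integral_cond_mul_inner hD hDL (hσ γ) (hσ' γ) (hu γ hγ).1.2.1 hφ.memLp_gradient] at this
      rw [hG γ hγ, hx']
      exact this)
  have hev : ∀ᶠ γ in 𝓝[>] (0 : ℝ), γ ∈ Ioo (0 : ℝ) 1 := Ioo_mem_nhdsGT one_pos
  have hlm : l - hw.memLp_gradient.toLp ∈ gradientSpace L e₀ e₁ := by
    have hc : IsClosed (gradientSpace L e₀ e₁ : Set (FieldSpace L)) :=
      Submodule.isClosed_topologicalClosure _
    refine hc.mem_of_tendsto (hl.sub_const _) ?_
    filter_upwards [hev] with γ hγ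
    rw [hG γ hγ]
    exact hmem (hu γ hγ).1 hws
  obtain ⟨ulim, hul⟩ := exists_sobolevBC_of_mem hw hlm
  rw [add_sub_cancel] at hul
  have hgl : Tendsto (fun γ => l2Norm L (fun z => g γ z - l z)) (𝓝[>] 0) (𝓝 0) := by
    have := (Lp.tendsto_Lp_iff_tendsto_eLpNorm' _ _).1 hl
    refine this.congr' ?_
    filter_upwards [hev] with γ hγ
    refine eLpNorm_congr_ae ?_
    filter_upwards [(hu γ hγ).1.2.1.coeFn_toLp] with z hz
    rw [Pi.sub_apply, hG γ hγ, hz]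
  refine ⟨ulim, l, hul, ?_, hgl, (hTzero l).1 hTl⟩
  have hm := ENNReal.Tendsto.const_mul (a := ENNReal.ofReal (2 * L)) hgl
    (Or.inr ENNReal.ofReal_ne_top)
  rw [mul_zero] at hm
  refine tendsto_of_tendsto_of_tendsto_of_le_of_le' tendsto_const_nhds hm
    (Eventually.of_forall fun _ => zero_le) ?_
  filter_upwards [hev] with γ hγ
  have h := (hu γ hγ).1.sub hul
  rw [sub_self] at h
  exact h.poincare

end Variational

/-! ### Regions with vanishing gradient -/

section Constancy

variable {L : ℝ} {e₀ e₁ : Edge} {u₀ : ℝ}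

theorem SobolevBC.congr_left {u u' : ℂ → ℝ} {g : ℂ → ℂ} (h : SobolevBC L e₀ e₁ u₀ u g)
    (hu : u =ᵐ[volume.restrict (box L)] u') : SobolevBC L e₀ e₁ u₀ u' g := by
  obtain ⟨h1, h2, f, hf, h3, h4⟩ := h
  refine ⟨h1.ae_eq hu, h2, f, hf, h3.congr fun n => ?_, h4⟩
  refine eLpNorm_congr_ae ?_
  filter_upwards [hu] with z hz
  rw [hz]

theorem SobolevBC.ae_eq_translate {u : ℂ → ℝ} {g : ℂ → ℂ} (hs : SobolevBC L e₀ e₁ u₀ u g)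
    {E : Set ℂ} (hE : MeasurableSet E) (hEc : Convex ℝ E) (hEL : E ⊆ box L)
    (hg : ∀ᵐ z ∂(volume.restrict E), g z = 0) (v : ℂ) :
    ∀ᵐ z : ℂ, z ∈ E → z + v ∈ E → u (z + v) = u z := by
  set b : Set ℂ := E ∩ (fun z => z + v) ⁻¹' E
  have hb : MeasurableSet b := hE.inter (hE.preimage (by fun_prop))
  have h := hs.translate hb hE hEL v (fun z hz s hs => by
    have := hEc.add_smul_mem hz.1 (y := v) hz.2 hs
    exact this)
  have h0 : eLpNorm g 2 (volume.restrict E) = 0 := by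
    rw [eLpNorm_congr_ae (g := fun _ => (0 : ℂ)) hg]; simp
  rw [h0, mul_zero, nonpos_iff_eq_zero, eLpNorm_eq_zero_iff _ two_ne_zero] at h
  · rw [EventuallyEq, ae_restrict_iff' hb] at h
    filter_upwards [h] with z hz h1 h2
    have := hz ⟨h1, h2⟩
    simpa [sub_eq_zero] using this
  · have hu := hs.1.1
    have hE' := hu.mono_measure (Measure.restrict_mono hEL le_rfl)
    exact (aestronglyMeasurable_translate hE v (fun z hz => hz.2) hE').sub
      (hE'.mono_measure (Measure.restrict_mono inter_subset_left le_rfl))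

/-- For each translation `v`, convexity gives `u (z + v) = u z` for almost every admissible `z`. By
Fubini some fixed `z` in `E` satisfies this for almost every `v`, and its value is the constant. -/
theorem SobolevBC.exists_ae_eq_const {u : ℂ → ℝ} {g : ℂ → ℂ} (hs : SobolevBC L e₀ e₁ u₀ u g)
    {E : Set ℂ} (hE : MeasurableSet E) (hEc : Convex ℝ E) (hEL : E ⊆ box L)
    (hg : ∀ᵐ z ∂(volume.restrict E), g z = 0) :
    ∃ c, ∀ᵐ z ∂(volume.restrict E), u z = c := by
  -- Exchanging the two almost-everywhere quantifiers requires a measurable set, hence a measurable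
  -- representative.
  obtain ⟨u', hu'm, huu'⟩ := hs.1.1
  have hs' := hs.congr_left huu'
  suffices h : ∃ c, ∀ᵐ z ∂(volume.restrict E), u' z = c by
    obtain ⟨c, hc⟩ := h
    refine ⟨c, ?_⟩
    filter_upwards [hc, ae_mono (Measure.restrict_mono hEL le_rfl) huu'] with z h1 h2
    rw [h2, h1]
  have hm := hu'm.measurable
  have h1 : ∀ᵐ v : ℂ, ∀ᵐ z : ℂ, z ∈ E → z + v ∈ E → u' (z + v) = u' z :=
    Eventually.of_forall fun v => hs'.ae_eq_translate hE hEc hEL hg v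
  have hmeas : MeasurableSet {p : ℂ × ℂ | p.2 ∈ E → p.2 + p.1 ∈ E → u' (p.2 + p.1) = u' p.2} := by
    have a1 : MeasurableSet {p : ℂ × ℂ | p.2 ∈ E} := measurable_snd hE
    have a2 : MeasurableSet {p : ℂ × ℂ | p.2 + p.1 ∈ E} :=
      (measurable_snd.add measurable_fst) hE
    have a3 : MeasurableSet {p : ℂ × ℂ | u' (p.2 + p.1) = u' p.2} :=
      measurableSet_eq_fun (hm.comp (measurable_snd.add measurable_fst)) (hm.comp measurable_snd)
    exact a1.imp (a2.imp a3)
  have h2 : ∀ᵐ z : ℂ, ∀ᵐ v : ℂ, z ∈ E → z + v ∈ E → u' (z + v) = u' z :=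
    (Measure.ae_ae_comm hmeas).1 h1
  rcases eq_or_ne (volume E) 0 with h0 | h0
  · refine ⟨0, ?_⟩
    rw [Measure.restrict_eq_zero.2 h0]
    simp
  · have h3 : ∃ᶠ z in ae (volume : Measure ℂ), z ∈ E := frequently_ae_mem_iff.2 h0
    obtain ⟨z, hz, hz2⟩ := (h3.and_eventually h2).exists
    refine ⟨u' z, ?_⟩
    rw [ae_restrict_iff' hE]
    have h4 := (measurePreserving_add_left volume (-z)).quasiMeasurePreserving.ae hz2
    filter_upwards [h4] with w hw hwE
    have := hw hz
    simp only [add_neg_cancel_left] at this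
    exact this hwE

/-- Shrink a ball in each set towards `p` by a factor `t` and compare `u` on the two copies by
translation. The areas and the squared translation length both scale like t², which cancels. What
remains bounds `(c₂ - c₁)²`, up to a constant, by the energy in a disc shrinking to `p`, which tends
to zero. No overlap is needed, so tangent discs are covered. -/
theorem SobolevBC.eq_of_touching {u : ℂ → ℝ} {g : ℂ → ℂ} (hs : SobolevBC L e₀ e₁ u₀ u g)
    {D₁ D₂ : Set ℂ} (h₁ : Convex ℝ D₁) (h₂ : Convex ℝ D₂) (hL₁ : D₁ ⊆ box L) (hL₂ : D₂ ⊆ box L)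
    {p : ℂ} (hp₁ : p ∈ D₁) (hp₂ : p ∈ D₂) (hi₁ : (interior D₁).Nonempty)
    (hi₂ : (interior D₂).Nonempty) {c₁ c₂ : ℝ} (hc₁ : ∀ᵐ z ∂(volume.restrict D₁), u z = c₁)
    (hc₂ : ∀ᵐ z ∂(volume.restrict D₂), u z = c₂) : c₁ = c₂ := by
  obtain ⟨a₁, ha₁⟩ := hi₁
  obtain ⟨a₂, ha₂⟩ := hi₂
  obtain ⟨ρ₁, hρ₁, hb₁⟩ := Metric.isOpen_iff.1 isOpen_interior a₁ ha₁
  obtain ⟨ρ₂, hρ₂, hb₂⟩ := Metric.isOpen_iff.1 isOpen_interior a₂ ha₂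
  set ρ := min ρ₁ ρ₂
  have hρ : 0 < ρ := lt_min hρ₁ hρ₂
  set M := dist a₁ p + dist a₂ p + ρ
  have hM : 0 < M := by positivity
  -- The homothety with centre `p` and ratio `t` maps a convex set containing `p` into itself; `M *
  -- t` bounds the distance of the shrunken ball from `p`.
  have hball : ∀ {D : Set ℂ} {a : ℂ} {ρ' : ℝ}, Convex ℝ D → p ∈ D →
      Metric.ball a ρ' ⊆ interior D → ρ ≤ ρ' → dist a p + ρ ≤ M → ∀ t ∈ Ioc (0 : ℝ) 1,
      ∀ z ∈ Metric.ball (p + t • (a - p)) (t * ρ), z ∈ D ∧ dist z p ≤ M * t := by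
    intro D a ρ' hD hp hb hρ' hMa t ht z hz
    have ht0 := ht.1
    set y := p + t⁻¹ • (z - p) with hy
    have hzy : z = p + t • (y - p) := by
      rw [hy, add_sub_cancel_left, smul_smul, mul_inv_cancel₀ ht0.ne', one_smul]; ring
    have hya : dist y a < ρ := by
      rw [Metric.mem_ball, dist_eq_norm] at hz
      have e : z - (p + t • (a - p)) = t • (y - a) := by
        rw [hzy]; simp only [smul_sub]; ring
      rw [e, norm_smul, Real.norm_of_nonneg ht0.le] at hz
      rw [dist_eq_norm]
      exact lt_of_mul_lt_mul_left hz ht0.le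
    refine ⟨?_, ?_⟩
    · rw [hzy]
      exact hD.add_smul_sub_mem hp (interior_subset (hb (Metric.mem_ball.2 (hya.trans_le hρ'))))
        ⟨ht0.le, ht.2⟩
    · rw [hzy, dist_eq_norm, add_sub_cancel_left, norm_smul, Real.norm_of_nonneg ht0.le,
        mul_comm]
      gcongr
      have := dist_triangle y a p
      rw [dist_eq_norm] at this
      linarith
  have key : ∀ t ∈ Ioc (0 : ℝ) 1, ‖c₂ - c₁‖ₑ ^ 2 * volume (Metric.ball (0 : ℂ) ρ) ≤
      ‖a₂ - a₁‖ₑ ^ 2 * ∫⁻ z in Metric.closedBall p (M * t), ‖g z‖ₑ ^ 2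
        ∂(volume.restrict (box L)) := by
    intro t ht
    have ht0 := ht.1
    set b := Metric.ball (p + t • (a₁ - p)) (t * ρ)
    set v := t • (a₂ - a₁)
    set E := Metric.closedBall p (M * t) ∩ box L
    have hbD₁ : ∀ z ∈ b, z ∈ D₁ ∧ dist z p ≤ M * t :=
      hball h₁ hp₁ hb₁ (min_le_left _ _) (by simp only [M]; linarith [dist_nonneg (x := a₂) (y := p)])
        t ht
    have hbD₂ : ∀ z ∈ b, z + v ∈ D₂ ∧ dist (z + v) p ≤ M * t := by
      intro z hz
      refine hball h₂ hp₂ hb₂ (min_le_right _ _)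
        (by simp only [M]; linarith [dist_nonneg (x := a₁) (y := p)]) t ht _ ?_
      rw [Metric.mem_ball, dist_eq_norm] at hz ⊢
      convert hz using 2
      simp only [v, smul_sub]; ring
    have hEc : Convex ℝ E := (convex_closedBall _ _).inter (convex_box L)
    have hEm : MeasurableSet E := Metric.isClosed_closedBall.measurableSet.inter
      (measurableSet_box L)
    have hbm : MeasurableSet b := Metric.isOpen_ball.measurableSet
    have h := hs.translate hbm hEm inter_subset_right v (fun z hz s hs =>
      hEc.add_smul_mem ⟨(hbD₁ z hz).2, hL₁ (hbD₁ z hz).1⟩ ⟨(hbD₂ z hz).2, hL₂ (hbD₂ z hz).1⟩ hs)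
    have hae : (fun z => u (z + v) - u z) =ᵐ[volume.restrict b] fun _ => c₂ - c₁ := by
      have e1 := ae_mono (Measure.restrict_mono (fun z hz => (hbD₁ z hz).1 : b ⊆ D₁) le_rfl) hc₁
      have e2 : ∀ᵐ z ∂(volume.restrict ((fun z => z + v) '' b)), u z = c₂ :=
        ae_mono (Measure.restrict_mono
          (by rintro _ ⟨z, hz, rfl⟩; exact (hbD₂ z hz).1) le_rfl) hc₂
      have hbm2 : MeasurableSet ((fun z => z + v) '' b) :=
        (MeasurableEquiv.addRight v).measurableSet_image.2 hbm
      rw [ae_restrict_iff' hbm2] at e2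
      have e3 := (measurePreserving_add_right volume v).quasiMeasurePreserving.ae e2
      filter_upwards [e1, ae_restrict_mem hbm, ae_restrict_of_ae e3] with z h1 h2 h3
      rw [h1, h3 (mem_image_of_mem _ h2)]
    rw [eLpNorm_congr_ae hae] at h
    have h2 := pow_le_pow_left' h 2
    rw [mul_pow, eLpNorm_two_sq, eLpNorm_two_sq, lintegral_const, Measure.restrict_apply_univ] at h2
    have hvol : volume b = ENNReal.ofReal t ^ 2 * volume (Metric.ball (0 : ℂ) ρ) := by
      simp only [b, Complex.volume_ball]
      rw [ENNReal.ofReal_mul ht0.le, mul_pow]; ring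
    have hv : ‖v‖ₑ = ENNReal.ofReal t * ‖a₂ - a₁‖ₑ := by
      simp only [v]
      rw [enorm_smul, Real.enorm_of_nonneg ht0.le]
    rw [hvol, hv, mul_pow, mul_assoc, mul_left_comm] at h2
    have hE : volume.restrict E = (volume.restrict (box L)).restrict (Metric.closedBall p (M * t)) := by
      rw [Measure.restrict_restrict Metric.isClosed_closedBall.measurableSet]
    rw [hE] at h2
    refine (ENNReal.mul_le_mul_iff_right ?_ ?_).1 h2
    · simpa using ht0
    · simp
  have hlim : Tendsto (fun t : ℝ => ∫⁻ z in Metric.closedBall p (M * t), ‖g z‖ₑ ^ 2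
        ∂(volume.restrict (box L))) (𝓝[>] 0) (𝓝 0) := by
    refine tendsto_setLIntegral_zero ?_ ?_
    · rw [← eLpNorm_two_sq]
      exact ENNReal.pow_ne_top hs.2.1.2.ne
    · have h1 : Tendsto (fun t : ℝ => volume (Metric.closedBall p (M * t))) (𝓝[>] 0) (𝓝 0) := by
        simp only [Complex.volume_closedBall]
        have : Tendsto (fun t : ℝ => ENNReal.ofReal (M * t) ^ 2 * NNReal.pi) (𝓝 0)
            (𝓝 (ENNReal.ofReal (M * 0) ^ 2 * NNReal.pi)) := by
          refine ENNReal.Tendsto.mul_const ?_ (Or.inr ENNReal.coe_ne_top)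
          refine ENNReal.Tendsto.pow ?_
          exact ENNReal.tendsto_ofReal ((continuous_const.mul continuous_id).tendsto 0)
        simp only [mul_zero, ENNReal.ofReal_zero, ne_eq, OfNat.ofNat_ne_zero, not_false_eq_true,
          zero_pow, zero_mul] at this
        exact this.mono_left nhdsWithin_le_nhds
      exact tendsto_of_tendsto_of_tendsto_of_le_of_le tendsto_const_nhds h1 (fun _ => zero_le)
        fun t => Measure.restrict_apply_le _ _
  have hlim2 := ENNReal.Tendsto.const_mul (a := ‖a₂ - a₁‖ₑ ^ 2) hlim (Or.inr (by simp))
  rw [mul_zero] at hlim2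
  have hle : ‖c₂ - c₁‖ₑ ^ 2 * volume (Metric.ball (0 : ℂ) ρ) ≤ 0 :=
    ge_of_tendsto hlim2 (by
      filter_upwards [Ioc_mem_nhdsGT (one_pos (α := ℝ))] with t ht using key t ht)
  rw [nonpos_iff_eq_zero, mul_eq_zero] at hle
  rcases hle with h | h
  · have : c₂ - c₁ = 0 := by simpa using h
    linarith
  · exact absurd h (Metric.measure_ball_pos volume _ hρ).ne'

end Constancy

/-! ### Reflections across the edges -/

section Reflection

/-- The linear part of the reflection across the line carrying an edge. -/
noncomputable def Edge.linRefl (e : Edge) : ℂ ≃ₗᵢ[ℝ] ℂ :=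
  (Submodule.reflection (Submodule.span ℝ {e.normal})).trans (LinearIsometryEquiv.neg ℝ)

theorem linRefl_apply (e : Edge) (y : ℂ) :
    e.linRefl y = y - (2 * inner ℝ e.normal y) • e.normal := by
  simp only [Edge.linRefl, LinearIsometryEquiv.trans_apply, Submodule.reflection_apply,
    LinearIsometryEquiv.coe_neg, Submodule.starProjection_unit_singleton ℝ (norm_normal e)]
  module

theorem linRefl_linRefl (e : Edge) (y : ℂ) : e.linRefl (e.linRefl y) = y := by
  rw [linRefl_apply, linRefl_apply, inner_sub_right, real_inner_smul_right, inner_normal_self]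
  module

theorem inner_linRefl (e : Edge) (a b : ℂ) : inner ℝ (e.linRefl a) b = inner ℝ a (e.linRefl b) := by
  rw [← e.linRefl.inner_map_map a, linRefl_linRefl]

/-- The reflection across the line carrying an edge of the box. -/
noncomputable def Edge.refl (L : ℝ) (e : Edge) (w : ℂ) : ℂ := e.linRefl w + (2 * L) • e.normal

variable {L : ℝ} {e : Edge}

theorem refl_apply (w : ℂ) : e.refl L w = w + (2 * (L - inner ℝ e.normal w)) • e.normal := by
  rw [Edge.refl, linRefl_apply]; module

theorem inner_normal_refl (w : ℂ) :
    inner ℝ e.normal (e.refl L w) = 2 * L - inner ℝ e.normal w := by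
  rw [refl_apply, inner_add_right, real_inner_smul_right, inner_normal_self]; ring

theorem refl_refl (w : ℂ) : e.refl L (e.refl L w) = w := by
  rw [refl_apply (e.refl L w), inner_normal_refl, refl_apply]; module

theorem refl_sub_refl (w z : ℂ) : e.refl L w - e.refl L z = e.linRefl (w - z) := by
  simp only [Edge.refl, map_sub]; ring

theorem refl_sub (w z : ℂ) : e.refl L w - z = e.linRefl (w - e.refl L z) := by
  rw [← refl_sub_refl (L := L), refl_refl]

theorem norm_refl_sub (w z : ℂ) : ‖e.refl L w - z‖ = ‖w - e.refl L z‖ := by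
  rw [refl_sub, LinearIsometryEquiv.norm_map]

theorem refl_eq_self {w : ℂ} (h : inner ℝ e.normal w = L) : e.refl L w = w := by
  rw [refl_apply, h]; simp

/-- Points on the inner side of the line are no farther from `z` than from its mirror image. Hence a
bump around the mirror image vanishes on that side wherever the ball around `z` does not reach. -/
theorem norm_sub_le_norm_sub_refl {w z : ℂ} (hw : inner ℝ e.normal w ≤ L)
    (hz : inner ℝ e.normal z ≤ L) : ‖w - z‖ ≤ ‖w - e.refl L z‖ := by
  refine le_of_sq_le_sq ?_ (norm_nonneg _)
  have h : w - e.refl L z = (w - z) - (2 * (L - inner ℝ e.normal z)) • e.normal := by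
    rw [refl_apply]; abel
  rw [h, norm_sub_sq_real (w - z), real_inner_smul_right, norm_smul, norm_normal, mul_one,
    real_inner_comm e.normal (w - z), inner_sub_right, Real.norm_eq_abs, sq_abs]
  nlinarith [mul_nonneg (sub_nonneg.2 hw) (sub_nonneg.2 hz)]

theorem continuous_refl : Continuous (e.refl L) := by
  unfold Edge.refl
  exact e.linRefl.continuous.add continuous_const

theorem measurePreserving_refl : MeasurePreserving (e.refl L) :=
  (measurePreserving_add_right volume ((2 * L) • e.normal)).comp e.linRefl.measurePreserving

theorem volume_line_eq_zero (L : ℝ) (e : Edge) : volume {z : ℂ | inner ℝ e.normal z = L} = 0 := by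
  have h : {z : ℂ | inner ℝ e.normal z = L} =
      (fun z => z + -(L • e.normal)) ⁻¹' (LinearMap.ker (innerₗ ℂ e.normal) : Set ℂ) := by
    ext z
    simp only [mem_ofPred_eq, mem_preimage, SetLike.mem_coe, LinearMap.mem_ker, innerₗ_apply_apply,
      inner_add_right, inner_neg_right, real_inner_smul_right, inner_normal_self]
    constructor <;> intro h <;> linarith
  rw [h, measure_preimage_add_right]
  refine Measure.addHaar_submodule volume _ fun htop => ?_
  have : e.normal ∈ LinearMap.ker (innerₗ ℂ e.normal) := by rw [htop]; trivial
  rw [LinearMap.mem_ker, innerₗ_apply_apply, inner_normal_self] at this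
  exact one_ne_zero this

/-- The reflection preserves area and exchanges the two open half-planes, while the line itself is
null. -/
theorem integral_fold {F : ℂ → ℝ} (hF : Integrable F) :
    ∫ w, F w = ∫ w in {w | inner ℝ e.normal w ≤ L}, (F w + F (e.refl L w)) := by
  set H : Set ℂ := {w | inner ℝ e.normal w ≤ L} with hH
  have hc : Continuous fun w : ℂ => (inner ℝ e.normal w : ℝ) := by fun_prop
  have hHm : MeasurableSet H := (isClosed_le hc continuous_const).measurableSet
  have hmp := measurePreserving_refl (L := L) (e := e)
  have hinv : Function.Involutive (e.refl L) := refl_refl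
  have hemb : MeasurableEmbedding (e.refl L) :=
    (hinv.toPerm.toHomeomorphOfContinuousOpen continuous_refl (by
      intro U hU
      have : hinv.toPerm '' U = (e.refl L) ⁻¹' U := hinv.image_eq_preimage_symm ▸ rfl
      rw [this]
      exact hU.preimage continuous_refl)).measurableEmbedding
  have hi2 : Integrable (fun w => F (e.refl L w)) := hmp.integrable_comp_of_integrable hF
  rw [integral_add hF.integrableOn hi2.integrableOn, ← integral_add_compl hHm hF]
  congr 1
  have hs : Hᶜ = (e.refl L) ⁻¹' {w | inner ℝ e.normal w < L} := by
    ext w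
    simp only [hH, mem_compl_iff, mem_ofPred_eq, mem_preimage, inner_normal_refl, not_le]
    constructor <;> intro h <;> linarith
  have h1 := hmp.setIntegral_preimage_emb hemb (fun w => F (e.refl L w))
    {w | inner ℝ e.normal w < L}
  simp only [refl_refl] at h1
  rw [hs, h1]
  refine setIntegral_congr_set ?_
  have h0 : ∀ᵐ w : ℂ, inner ℝ e.normal w ≠ L := by
    rw [ae_iff]; simpa using volume_line_eq_zero L e
  filter_upwards [h0] with w hw
  exact propext ⟨fun h => le_of_lt h, fun h => lt_of_le_of_ne h hw⟩

end Reflection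

/-! ### A radial mollifier -/

section Mollifier

/-- A radial mollifier, not normalised. -/
noncomputable def moll (y : ℂ) : ℝ := max (1 - ‖y‖ ^ 2) 0

/-- A radial potential whose gradient at `y` is `moll y • y`. -/
noncomputable def mollPot (y : ℂ) : ℝ := (-1 / 4) * max (1 - ‖y‖ ^ 2) 0 ^ 2

theorem hasDerivAt_max_zero_sq (t : ℝ) :
    HasDerivAt (fun t : ℝ => max t 0 ^ 2) (2 * max t 0) t := by
  have hc : Continuous fun t : ℝ => max t 0 ^ 2 := by fun_prop
  have hc' : Continuous fun t : ℝ => 2 * max t 0 := by fun_prop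
  refine hasDerivAt_of_hasDerivAt_of_ne' (x := 0) (fun y hy => ?_) hc.continuousAt
    hc'.continuousAt t
  rcases lt_or_gt_of_ne hy with h | h
  · have : (fun t : ℝ => max t 0 ^ 2) =ᶠ[𝓝 y] fun _ => 0 := by
      filter_upwards [Iio_mem_nhds h] with s hs
      simp [max_eq_right (mem_Iio.1 hs).le]
    rw [max_eq_right h.le, mul_zero]
    exact (hasDerivAt_const y (0 : ℝ)).congr_of_eventuallyEq this
  · have : (fun t : ℝ => max t 0 ^ 2) =ᶠ[𝓝 y] fun t => t ^ 2 := by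
      filter_upwards [Ioi_mem_nhds h] with s hs
      simp [max_eq_left (mem_Ioi.1 hs).le]
    rw [max_eq_left h.le]
    have h2 := (hasDerivAt_pow 2 y).congr_of_eventuallyEq this
    simpa using h2

theorem contDiff_mollPot : ContDiff ℝ 1 mollPot := by
  have h1 : ContDiff ℝ 1 fun t : ℝ => max t 0 ^ 2 := by
    rw [contDiff_one_iff_deriv]
    refine ⟨fun t => (hasDerivAt_max_zero_sq t).differentiableAt, ?_⟩
    have : deriv (fun t : ℝ => max t 0 ^ 2) = fun t => 2 * max t 0 :=
      funext fun t => (hasDerivAt_max_zero_sq t).deriv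
    rw [this]
    fun_prop
  have h2 : ContDiff ℝ 1 fun y : ℂ => 1 - ‖y‖ ^ 2 := contDiff_const.sub (contDiff_norm_sq ℝ)
  exact contDiff_const.mul (h1.comp h2)

theorem hasGradientAt_mollPot (y : ℂ) : HasGradientAt mollPot (moll y • y) y := by
  rw [hasGradientAt_iff_hasFDerivAt]
  have h1 := ((hasFDerivAt_id (𝕜 := ℝ) y).norm_sq).const_sub 1
  have h2 := (((hasDerivAt_max_zero_sq (1 - ‖y‖ ^ 2)).comp_hasFDerivAt y h1).const_mul (-1 / 4))
  refine h2.congr_fderiv ?_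
  ext v
  simp [moll]
  ring

theorem continuous_moll : Continuous moll := by unfold moll; fun_prop

theorem moll_nonneg (y : ℂ) : 0 ≤ moll y := le_max_right _ _

theorem moll_le_one (y : ℂ) : moll y ≤ 1 := max_le (by linarith [sq_nonneg ‖y‖]) zero_le_one

theorem moll_eq_zero {y : ℂ} (h : 1 ≤ ‖y‖) : moll y = 0 := max_eq_right (by nlinarith)

theorem mollPot_eq_zero {y : ℂ} (h : 1 ≤ ‖y‖) : mollPot y = 0 := by
  rw [mollPot, max_eq_right (by nlinarith)]; simp

theorem moll_congr {y y' : ℂ} (h : ‖y‖ = ‖y'‖) : moll y = moll y' := by simp [moll, h]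

theorem mollPot_congr {y y' : ℂ} (h : ‖y‖ = ‖y'‖) : mollPot y = mollPot y' := by simp [mollPot, h]

theorem hasCompactSupport_moll : HasCompactSupport moll := by
  refine HasCompactSupport.intro (isCompact_closedBall (0 : ℂ) 1) fun y hy => moll_eq_zero ?_
  rw [mem_closedBall_zero_iff, not_le] at hy
  exact hy.le

theorem integral_moll_pos : 0 < ∫ y, moll y := by
  refine continuous_moll.integral_pos_of_hasCompactSupport_nonneg_nonzero hasCompactSupport_moll
    moll_nonneg (x := 0) ?_
  simp [moll]

theorem integral_comp_add_smul (F : ℂ → ℝ) (z : ℂ) {s : ℝ} (hs : 0 < s) :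
    ∫ y : ℂ, F (z + s • y) = (s ^ 2)⁻¹ * ∫ w, F w := by
  rw [Measure.integral_comp_smul volume (fun y => F (z + y)) s, integral_add_left_eq_self F z,
    Complex.finrank_real_complex, abs_of_pos (by positivity), smul_eq_mul]

end Mollifier

/-! ### The mean value identity for `C¹` functions extended by reflection -/

section MeanValue

variable {L : ℝ} {e : Edge}

open Classical in
/-- Extension of a function across an edge, even for `τ = 1` and odd for `τ = -1`. -/
noncomputable def foldExt (L : ℝ) (e : Edge) (τ : ℝ) (f : ℂ → ℝ) (w : ℂ) : ℝ :=
  if inner ℝ e.normal w ≤ L then f w else τ * f (e.refl L w)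

open Classical in
/-- The gradient of `foldExt`. -/
noncomputable def foldGrad (L : ℝ) (e : Edge) (τ : ℝ) (f : ℂ → ℝ) (w : ℂ) : ℂ :=
  if inner ℝ e.normal w ≤ L then gradient f w else τ • e.linRefl (gradient f (e.refl L w))

theorem continuous_inner_normal (e : Edge) : Continuous fun w : ℂ => (inner ℝ e.normal w : ℝ) := by
  fun_prop

theorem measurable_foldExt {f : ℂ → ℝ} (hf : ContDiff ℝ 1 f) (τ : ℝ) :
    Measurable (foldExt L e τ f) :=
  Measurable.ite (isClosed_le (continuous_inner_normal e) continuous_const).measurableSet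
    hf.continuous.measurable
    ((continuous_const.mul (hf.continuous.comp continuous_refl)).measurable)

theorem measurable_foldGrad {f : ℂ → ℝ} (hf : ContDiff ℝ 1 f) (τ : ℝ) :
    Measurable (foldGrad L e τ f) := by
  refine Measurable.ite (isClosed_le (continuous_inner_normal e) continuous_const).measurableSet
    (continuous_gradient hf).measurable (Continuous.measurable ?_)
  exact (e.linRefl.continuous.comp ((continuous_gradient hf).comp continuous_refl)).const_smul τ

theorem exists_bound_foldExt {f : ℂ → ℝ} (hf : ContDiff ℝ 1 f) (τ : ℝ) (z : ℂ) (ρ : ℝ) :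
    ∃ C, ∀ w ∈ Metric.closedBall z ρ, ‖foldExt L e τ f w‖ ≤ C := by
  obtain ⟨C₁, h₁⟩ := (isCompact_closedBall z ρ).exists_bound_of_continuousOn
    hf.continuous.continuousOn
  obtain ⟨C₂, h₂⟩ := (isCompact_closedBall z ρ).exists_bound_of_continuousOn
    ((continuous_const (y := τ)).mul (hf.continuous.comp (continuous_refl (L := L) (e := e)))).continuousOn
  refine ⟨max C₁ C₂, fun w hw => ?_⟩
  unfold foldExt
  split_ifs
  · exact (h₁ w hw).trans (le_max_left _ _)
  · exact (h₂ w hw).trans (le_max_right _ _)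

theorem exists_bound_foldGrad {f : ℂ → ℝ} (hf : ContDiff ℝ 1 f) (τ : ℝ) (z : ℂ) (ρ : ℝ) :
    ∃ C, ∀ w ∈ Metric.closedBall z ρ, ‖foldGrad L e τ f w‖ ≤ C := by
  obtain ⟨C₁, h₁⟩ := (isCompact_closedBall z ρ).exists_bound_of_continuousOn
    (continuous_gradient hf).continuousOn
  obtain ⟨C₂, h₂⟩ := (isCompact_closedBall z ρ).exists_bound_of_continuousOn
    ((e.linRefl.continuous.comp ((continuous_gradient hf).comp
      (continuous_refl (L := L) (e := e)))).const_smul τ).continuousOn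
  refine ⟨max C₁ C₂, fun w hw => ?_⟩
  unfold foldGrad
  split_ifs
  · exact (h₁ w hw).trans (le_max_left _ _)
  · exact (h₂ w hw).trans (le_max_right _ _)

/-- The two branches agree on the line exactly when `τ * f = f` there: automatic for `τ = 1`, and
for `τ = -1` the Dirichlet condition. -/
theorem continuousAt_foldExt {f : ℂ → ℝ} (hf : ContDiff ℝ 1 f) {τ : ℝ} {w : ℂ}
    (hw : inner ℝ e.normal w = L → τ * f w = f w) : ContinuousAt (foldExt L e τ f) w := by
  have hn := continuous_inner_normal e
  have h1 := hf.continuous.tendsto w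
  have h2 : Tendsto (fun w => τ * f (e.refl L w)) (𝓝 w) (𝓝 (τ * f (e.refl L w))) :=
    (continuous_const.mul (hf.continuous.comp continuous_refl)).tendsto w
  rcases lt_trichotomy (inner ℝ e.normal w) L with h | h | h
  · refine hf.continuous.continuousAt.congr ?_
    filter_upwards [(isOpen_lt hn continuous_const).mem_nhds h] with x hx
    exact (if_pos (le_of_lt hx)).symm
  · have e1 : foldExt L e τ f w = f w := if_pos h.le
    have e2 : τ * f (e.refl L w) = f w := by rw [refl_eq_self h, hw h]
    rw [ContinuousAt, e1]
    rw [e2] at h2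
    exact Tendsto.if (h1.mono_left inf_le_left) (h2.mono_left inf_le_left)
  · refine ContinuousAt.congr (f := fun w => τ * f (e.refl L w)) ?_ ?_
    · exact h2
    · filter_upwards [(isOpen_lt continuous_const hn).mem_nhds h] with x hx
      exact (if_neg (not_le_of_gt hx)).symm

theorem hasFDerivAt_foldExt {f : ℂ → ℝ} (hf : ContDiff ℝ 1 f) {τ : ℝ} {w : ℂ}
    (hw : inner ℝ e.normal w ≠ L) :
    HasFDerivAt (foldExt L e τ f) (InnerProductSpace.toDual ℝ ℂ (foldGrad L e τ f w)) w := by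
  have hn := continuous_inner_normal e
  rcases lt_or_gt_of_ne hw with h | h
  · have e1 : foldGrad L e τ f w = gradient f w := if_pos h.le
    rw [e1, toDual_gradient]
    refine ((hf.differentiable one_ne_zero) w).hasFDerivAt.congr_of_eventuallyEq ?_
    filter_upwards [(isOpen_lt hn continuous_const).mem_nhds h] with x hx
    exact if_pos (le_of_lt hx)
  · have e1 : foldGrad L e τ f w = τ • e.linRefl (gradient f (e.refl L w)) := if_neg (not_le_of_gt h)
    have h1 : HasFDerivAt (e.refl L) (e.linRefl : ℂ →L[ℝ] ℂ) w :=
      (e.linRefl : ℂ →L[ℝ] ℂ).hasFDerivAt.add_const _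
    have h2 := (((hf.differentiable one_ne_zero) (e.refl L w)).hasFDerivAt.comp w h1).const_mul τ
    refine (h2.congr_fderiv ?_).congr_of_eventuallyEq ?_
    · ext v
      rw [e1, InnerProductSpace.toDual_apply_apply, real_inner_smul_left, inner_linRefl,
        inner_gradient_left]
      rfl
    · filter_upwards [(isOpen_lt continuous_const hn).mem_nhds h] with x hx
      exact if_neg (not_le_of_gt hx)

/-- The extension is not assumed differentiable on the line. Since `z` lies strictly inside, a ray
from `z` crosses the line at most once, so the fundamental theorem with a countable exceptional set
applies. -/
theorem foldExt_sub_eq_integral {f : ℂ → ℝ} (hf : ContDiff ℝ 1 f) {τ : ℝ} {z : ℂ} {ε ρ : ℝ}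
    (hε : 0 < ε) (hερ : ε ≤ ρ) (hz : inner ℝ e.normal z < L)
    (h0 : ∀ w ∈ Metric.ball z ρ, inner ℝ e.normal w = L → τ * f w = f w) {y : ℂ} (hy : ‖y‖ < 1) :
    foldExt L e τ f (z + ρ • y) - foldExt L e τ f (z + ε • y) =
      ∫ s in Ioc ε ρ, inner ℝ (foldGrad L e τ f (z + s • y)) y := by
  have hρ : 0 < ρ := hε.trans_le hερ
  have hmem : ∀ s ∈ Icc ε ρ, z + s • y ∈ Metric.ball z ρ := by
    intro s hs
    rw [mem_ball_iff_norm, add_sub_cancel_left, norm_smul, Real.norm_of_nonneg (hε.le.trans hs.1)]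
    nlinarith [hs.2, norm_nonneg y, hs.1]
  have hsm : Measurable fun s : ℝ => inner ℝ (foldGrad L e τ f (z + s • y)) y :=
    ((measurable_foldGrad hf τ).comp (Continuous.measurable (by fun_prop))).inner measurable_const
  obtain ⟨C, hC⟩ := exists_bound_foldGrad (L := L) (e := e) hf τ z ρ
  rw [← intervalIntegral.integral_of_le hερ]
  symm
  refine integral_eq_of_hasDerivAt_off_countable (fun s : ℝ => foldExt L e τ f (z + s • y)) _
    (s := {s | inner ℝ e.normal (z + s • y) = L}) ?_ ?_ ?_ ?_
  · refine Set.Subsingleton.countable fun s hs t ht => ?_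
    simp only [mem_ofPred_eq, inner_add_right, real_inner_smul_right] at hs ht
    have hne : inner ℝ e.normal y ≠ (0 : ℝ) := by
      intro h; rw [h, mul_zero, add_zero] at hs; exact hz.ne hs
    have : (s - t) * inner ℝ e.normal y = 0 := by linear_combination hs - ht
    rcases mul_eq_zero.1 this with h | h
    · linarith
    · exact absurd h hne
  · rw [uIcc_of_le hερ]
    intro s hs
    refine ContinuousAt.continuousWithinAt ?_
    refine ContinuousAt.comp (f := fun s : ℝ => z + s • y) (g := foldExt L e τ f)
      (continuousAt_foldExt hf fun h => h0 _ (hmem s hs) h) (by fun_prop)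
  · rintro s ⟨-, hs⟩
    have h1 : HasDerivAt (fun s : ℝ => z + s • y) y s := by
      simpa using ((hasDerivAt_id s).smul_const y).const_add z
    exact (hasFDerivAt_foldExt hf hs).comp_hasDerivAt s h1
  · rw [intervalIntegrable_iff_integrableOn_Ioc_of_le hερ]
    refine Measure.integrableOn_of_bounded (M := C * 1) (by simp) hsm.aestronglyMeasurable ?_
    filter_upwards [ae_restrict_mem measurableSet_Ioc] with s hs
    have h1 := hC _ (Metric.ball_subset_closedBall (hmem s (Ioc_subset_Icc_self hs)))
    exact (norm_inner_le_norm _ _).trans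
      (mul_le_mul h1 hy.le (norm_nonneg _) ((norm_nonneg _).trans h1))

theorem integral_moll_foldExt_sub {f : ℂ → ℝ} (hf : ContDiff ℝ 1 f) {τ : ℝ} {z : ℂ} {ε ρ : ℝ}
    (hε : 0 < ε) (hερ : ε ≤ ρ) (hz : inner ℝ e.normal z < L)
    (h0 : ∀ w ∈ Metric.ball z ρ, inner ℝ e.normal w = L → τ * f w = f w) :
    ∫ y, moll y * (foldExt L e τ f (z + ρ • y) - foldExt L e τ f (z + ε • y)) =
      ∫ s in Ioc ε ρ, ∫ y, moll y * inner ℝ (foldGrad L e τ f (z + s • y)) y := by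
  obtain ⟨C, hC⟩ := exists_bound_foldGrad (L := L) (e := e) hf τ z ρ
  have hball : ∀ F : ℂ → ℝ, ∫ y, moll y * F y = ∫ y in Metric.ball 0 1, moll y * F y := by
    intro F
    rw [← setIntegral_univ]
    refine setIntegral_eq_of_subset_of_forall_sdiff_eq_zero MeasurableSet.univ (subset_univ _) ?_
    rintro y ⟨-, hy⟩
    rw [mem_ball_zero_iff, not_lt] at hy
    rw [moll_eq_zero hy, zero_mul]
  have hC0 : 0 ≤ C := (norm_nonneg _).trans
    (hC z (Metric.mem_closedBall_self (hε.le.trans hερ)))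
  have hint : Integrable (Function.uncurry fun (s : ℝ) (y : ℂ) =>
      moll y * inner ℝ (foldGrad L e τ f (z + s • y)) y)
      ((volume.restrict (Ioc ε ρ)).prod (volume.restrict (Metric.ball (0 : ℂ) 1))) := by
    have hm : Measurable (Function.uncurry fun (s : ℝ) (y : ℂ) =>
        moll y * inner ℝ (foldGrad L e τ f (z + s • y)) y) := by
      refine (continuous_moll.measurable.comp measurable_snd).mul ?_
      exact ((measurable_foldGrad hf τ).comp (Continuous.measurable (by fun_prop))).inner
        measurable_snd
    have : IsFiniteMeasure (volume.restrict (Ioc ε ρ)) := ⟨by simp⟩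
    have : IsFiniteMeasure (volume.restrict (Metric.ball (0 : ℂ) 1)) :=
      ⟨by rw [Measure.restrict_apply_univ]; exact measure_ball_lt_top⟩
    refine Integrable.of_bound hm.aestronglyMeasurable (1 * (C * 1)) ?_
    rw [Measure.prod_restrict]
    filter_upwards [ae_restrict_mem (measurableSet_Ioc.prod Metric.isOpen_ball.measurableSet)]
      with p hp
    obtain ⟨⟨hs1, hs2⟩, hy⟩ := hp
    have hy' : ‖p.2‖ < 1 := mem_ball_zero_iff.1 hy
    have h1 : ‖foldGrad L e τ f (z + p.1 • p.2)‖ ≤ C := by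
      refine hC _ ?_
      rw [mem_closedBall_iff_norm, add_sub_cancel_left, norm_smul,
        Real.norm_of_nonneg (hε.trans hs1).le]
      nlinarith [norm_nonneg p.2]
    change ‖moll p.2 * inner ℝ (foldGrad L e τ f (z + p.1 • p.2)) p.2‖ ≤ _
    rw [norm_mul, Real.norm_of_nonneg (moll_nonneg _)]
    refine mul_le_mul (moll_le_one _) ((norm_inner_le_norm _ _).trans ?_) (norm_nonneg _)
      zero_le_one
    exact mul_le_mul h1 hy'.le (norm_nonneg _) hC0
  rw [hball]
  have e1 : ∀ s : ℝ, ∫ y, moll y * inner ℝ (foldGrad L e τ f (z + s • y)) y =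
      ∫ y in Metric.ball 0 1, moll y * inner ℝ (foldGrad L e τ f (z + s • y)) y :=
    fun s => hball fun y => inner ℝ (foldGrad L e τ f (z + s • y)) y
  simp only [e1]
  rw [integral_integral_swap hint]
  refine setIntegral_congr_fun Metric.isOpen_ball.measurableSet fun y hy => ?_
  rw [integral_const_mul, foldExt_sub_eq_integral hf hε hερ hz h0 (mem_ball_zero_iff.1 hy)]

/-- The test function whose gradient is the reflected mollifier field. -/
noncomputable def foldTest (L : ℝ) (e : Edge) (τ : ℝ) (z : ℂ) (s : ℝ) (w : ℂ) : ℝ :=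
  mollPot (s⁻¹ • (w - z)) + τ * mollPot (s⁻¹ • (w - e.refl L z))

/-- The mollifier at scale `s` around `z`, reflected across an edge. -/
noncomputable def foldMoll (L : ℝ) (e : Edge) (τ : ℝ) (z : ℂ) (s : ℝ) (w : ℂ) : ℝ :=
  (s ^ 2)⁻¹ * (moll (s⁻¹ • (w - z)) + τ * moll (s⁻¹ • (w - e.refl L z)))

theorem contDiff_foldTest (τ : ℝ) (z : ℂ) (s : ℝ) : ContDiff ℝ 1 (foldTest L e τ z s) := by
  have h : ∀ a : ℂ, ContDiff ℝ 1 fun w : ℂ => mollPot (s⁻¹ • (w - a)) := fun a =>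
    contDiff_mollPot.comp (by fun_prop : ContDiff ℝ 1 fun w : ℂ => s⁻¹ • (w - a))
  exact (h z).add (contDiff_const.mul (h _))

theorem gradient_foldTest (τ : ℝ) (z : ℂ) (s : ℝ) (w : ℂ) :
    gradient (foldTest L e τ z s) w = s⁻¹ • (moll (s⁻¹ • (w - z)) • (s⁻¹ • (w - z)) +
      τ • moll (s⁻¹ • (w - e.refl L z)) • (s⁻¹ • (w - e.refl L z))) := by
  have h : ∀ a : ℂ, HasGradientAt (fun w : ℂ => mollPot (s⁻¹ • (w - a)))
      (s⁻¹ • (moll (s⁻¹ • (w - a)) • (s⁻¹ • (w - a)))) w := by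
    intro a
    have h1 : HasFDerivAt (fun w : ℂ => s⁻¹ • (w - a)) (s⁻¹ • ContinuousLinearMap.id ℝ ℂ) w :=
      ((hasFDerivAt_id w).sub_const a).const_smul s⁻¹
    have h2 := (hasGradientAt_mollPot (s⁻¹ • (w - a))).hasFDerivAt.comp w h1
    rw [hasGradientAt_iff_hasFDerivAt]
    refine h2.congr_fderiv ?_
    ext v
    simp
    ring
  refine HasGradientAt.gradient ?_
  have h1 := (h z).hasFDerivAt.add ((h (e.refl L z)).hasFDerivAt.const_mul τ)
  rw [hasGradientAt_iff_hasFDerivAt]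
  refine h1.congr_fderiv ?_
  rw [smul_add, map_add, smul_comm s⁻¹ τ, map_smul (InnerProductSpace.toDual ℝ ℂ) τ]

theorem integral_eq_box_integral_of_fold {F F₁ : ℂ → ℝ} (hF : Integrable F)
    (h : ∀ w, inner ℝ e.normal w < L → F w + F (e.refl L w) = F₁ w)
    (h' : ∀ w, inner ℝ e.normal w ≤ L → w ∉ box L → F₁ w = 0) :
    ∫ w, F w = ∫ w in box L, F₁ w := by
  have hHm : MeasurableSet {w : ℂ | inner ℝ e.normal w ≤ L} :=
    (isClosed_le (continuous_inner_normal e) continuous_const).measurableSet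
  rw [integral_fold (L := L) (e := e) hF,
    ← setIntegral_eq_of_subset_of_forall_sdiff_eq_zero hHm (fun w hw => mem_box_iff.1 hw e)
      (fun w hw => h' w hw.1 hw.2)]
  refine integral_congr_ae ?_
  have h0 : ∀ᵐ w : ℂ, inner ℝ e.normal w ≠ L := by
    rw [ae_iff]; simpa using volume_line_eq_zero L e
  filter_upwards [ae_restrict_mem hHm, ae_restrict_of_ae h0] with w h1 h2
  exact h w (lt_of_le_of_ne h1 h2)

theorem integrable_of_bound_ball {F : ℂ → ℝ} (hF : Measurable F) {z : ℂ} {s C : ℝ}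
    (h : ∀ w ∈ Metric.closedBall z s, ‖F w‖ ≤ C) (h' : ∀ w, w ∉ Metric.closedBall z s → F w = 0) :
    Integrable F := by
  rw [← integrableOn_iff_integrable_of_support_subset (s := Metric.closedBall z s)
    (fun w hw => by_contra fun hw' => hw (h' w hw'))]
  refine Measure.integrableOn_of_bounded (M := C) measure_closedBall_lt_top.ne
    hF.aestronglyMeasurable ?_
  filter_upwards [ae_restrict_mem Metric.isClosed_closedBall.measurableSet] with w hw using h w hw

theorem one_le_norm_inv_smul {a w : ℂ} {s ρ : ℝ} (hs : 0 < s) (hsρ : s ≤ ρ) (h : ρ ≤ ‖w - a‖) :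
    1 ≤ ‖s⁻¹ • (w - a)‖ := by
  rw [norm_smul, norm_inv, Real.norm_of_nonneg hs.le, ← div_eq_inv_mul, le_div_iff₀ hs, one_mul]
  linarith

theorem le_norm_sub_of_notMem {z w : ℂ} {ρ : ℝ} (hz : inner ℝ e.normal z ≤ L)
    (hw : inner ℝ e.normal w ≤ L) (h : w ∉ Metric.ball z ρ) :
    ρ ≤ ‖w - z‖ ∧ ρ ≤ ‖w - e.refl L z‖ := by
  rw [mem_ball_iff_norm, not_lt] at h
  exact ⟨h, h.trans (norm_sub_le_norm_sub_refl hw hz)⟩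

theorem moll_smul_refl_sub (w z : ℂ) (s : ℝ) :
    moll (s⁻¹ • (e.refl L w - z)) = moll (s⁻¹ • (w - e.refl L z)) :=
  moll_congr (by rw [norm_smul, norm_smul, norm_refl_sub])

/-- Rescale, then fold the outer half-plane back onto the inner one: the mollifier acquires a
reflected copy, and everything is expressed inside the box. -/
theorem integral_moll_foldExt {f : ℂ → ℝ} (hf : ContDiff ℝ 1 f) (τ : ℝ) {z : ℂ} {s ρ : ℝ}
    (hs : 0 < s) (hsρ : s ≤ ρ) (hz : inner ℝ e.normal z ≤ L)
    (hball : ∀ w ∈ Metric.ball z ρ, inner ℝ e.normal w ≤ L → w ∈ box L) :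
    ∫ y, moll y * foldExt L e τ f (z + s • y) = ∫ w in box L, f w * foldMoll L e τ z s w := by
  obtain ⟨C, hC⟩ := exists_bound_foldExt (L := L) (e := e) hf τ z s
  set F : ℂ → ℝ := fun w => moll (s⁻¹ • (w - z)) * foldExt L e τ f w with hFdef
  have hF : Integrable F := by
    refine integrable_of_bound_ball (z := z) (s := s) (C := 1 * C) ?_ ?_ ?_
    · exact (continuous_moll.measurable.comp (Continuous.measurable (by fun_prop))).mul
        (measurable_foldExt hf τ)
    · intro w hw
      rw [hFdef, norm_mul, Real.norm_of_nonneg (moll_nonneg _)]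
      exact mul_le_mul (moll_le_one _) (hC w hw) (norm_nonneg _) zero_le_one
    · intro w hw
      rw [mem_closedBall_iff_norm, not_le] at hw
      rw [hFdef]
      simp only [moll_eq_zero (one_le_norm_inv_smul hs le_rfl hw.le), zero_mul]
  have h1 : ∫ y, moll y * foldExt L e τ f (z + s • y) = ∫ y, F (z + s • y) := by
    simp only [hFdef, add_sub_cancel_left, smul_smul, inv_mul_cancel₀ hs.ne', one_smul]
  rw [h1, integral_comp_add_smul F z hs, ← integral_const_mul]
  refine integral_eq_box_integral_of_fold (e := e) (hF.const_mul _) (fun w hw => ?_)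
    (fun w hw hwb => ?_)
  · have hw' : ¬ inner ℝ e.normal (e.refl L w) ≤ L := by rw [inner_normal_refl]; linarith
    simp only [hFdef, foldMoll, foldExt, if_pos hw.le, if_neg hw', refl_refl, moll_smul_refl_sub]
    ring
  · have h2 : w ∉ Metric.ball z ρ := fun h => hwb (hball w h hw)
    obtain ⟨h3, h4⟩ := le_norm_sub_of_notMem hz hw h2
    rw [foldMoll, moll_eq_zero (one_le_norm_inv_smul hs hsρ h3),
      moll_eq_zero (one_le_norm_inv_smul hs hsρ h4)]
    ring

/-- Since `moll y • y` is the gradient of `mollPot`, the folded radial derivative is the pairing of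
`gradient f` with the gradient of a single test function. Weak harmonicity can then be applied to
that pairing. -/
theorem integral_moll_foldGrad {f : ℂ → ℝ} (hf : ContDiff ℝ 1 f) (τ : ℝ) {z : ℂ} {s ρ : ℝ}
    (hs : 0 < s) (hsρ : s ≤ ρ) (hz : inner ℝ e.normal z ≤ L)
    (hball : ∀ w ∈ Metric.ball z ρ, inner ℝ e.normal w ≤ L → w ∈ box L) :
    ∫ y, moll y * inner ℝ (foldGrad L e τ f (z + s • y)) y =
      s⁻¹ * ∫ w in box L, inner ℝ (gradient f w) (gradient (foldTest L e τ z s) w) := by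
  obtain ⟨C, hC⟩ := exists_bound_foldGrad (L := L) (e := e) hf τ z s
  set F : ℂ → ℝ := fun w =>
    moll (s⁻¹ • (w - z)) * inner ℝ (foldGrad L e τ f w) (s⁻¹ • (w - z)) with hFdef
  have hF : Integrable F := by
    refine integrable_of_bound_ball (z := z) (s := s) (C := 1 * (C * 1)) ?_ ?_ ?_
    · exact (continuous_moll.measurable.comp (Continuous.measurable (by fun_prop))).mul
        ((measurable_foldGrad hf τ).inner (Continuous.measurable (by fun_prop)))
    · intro w hw
      have h1 : ‖s⁻¹ • (w - z)‖ ≤ 1 := by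
        rw [norm_smul, norm_inv, Real.norm_of_nonneg hs.le, ← div_eq_inv_mul, div_le_one hs]
        exact mem_closedBall_iff_norm.1 hw
      rw [hFdef, norm_mul, Real.norm_of_nonneg (moll_nonneg _)]
      refine mul_le_mul (moll_le_one _) ((norm_inner_le_norm _ _).trans ?_) (norm_nonneg _)
        zero_le_one
      exact mul_le_mul (hC w hw) h1 (norm_nonneg _) ((norm_nonneg _).trans (hC w hw))
    · intro w hw
      rw [mem_closedBall_iff_norm, not_le] at hw
      rw [hFdef]
      simp only [moll_eq_zero (one_le_norm_inv_smul hs le_rfl hw.le), zero_mul]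
  have h1 : ∫ y, moll y * inner ℝ (foldGrad L e τ f (z + s • y)) y = ∫ y, F (z + s • y) := by
    simp only [hFdef, add_sub_cancel_left, smul_smul, inv_mul_cancel₀ hs.ne', one_smul]
  rw [h1, integral_comp_add_smul F z hs, ← integral_const_mul, ← integral_const_mul]
  refine integral_eq_box_integral_of_fold (e := e) (hF.const_mul _) (fun w hw => ?_)
    (fun w hw hwb => ?_)
  · have hw' : ¬ inner ℝ e.normal (e.refl L w) ≤ L := by rw [inner_normal_refl]; linarith
    have e1 : inner ℝ (e.linRefl (gradient f w)) (s⁻¹ • (e.refl L w - z)) =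
        inner ℝ (gradient f w) (s⁻¹ • (w - e.refl L z)) := by
      rw [inner_linRefl, map_smul, refl_sub, linRefl_linRefl]
    simp only [hFdef, foldGrad, if_pos hw.le, if_neg hw', refl_refl, moll_smul_refl_sub,
      gradient_foldTest]
    rw [real_inner_smul_left, e1]
    simp only [real_inner_smul_right, inner_add_right]
    field_simp
  · have h2 : w ∉ Metric.ball z ρ := fun h => hwb (hball w h hw)
    obtain ⟨h3, h4⟩ := le_norm_sub_of_notMem hz hw h2
    rw [gradient_foldTest, moll_eq_zero (one_le_norm_inv_smul hs hsρ h3),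
      moll_eq_zero (one_le_norm_inv_smul hs hsρ h4)]
    simp

end MeanValue

/-! ### The mean value identity and the sup bound for weak solutions -/

section WeakMeanValue

variable {L : ℝ} {e e₀ e₁ : Edge}

/-- The `L¹`-norm over the box is controlled by the `L²`-norm. -/
theorem integral_norm_le_l2Norm {E : Type*} [NormedAddCommGroup E] {a : ℂ → E}
    (ha : MemLp a 2 (volume.restrict (box L))) :
    ∫ z in box L, ‖a z‖ ≤
      (volume (box L) ^ (1 / 2 : ℝ)).toReal * (l2Norm L a).toReal := by
  rw [integral_norm_eq_lintegral_enorm ha.1, ← eLpNorm_one_eq_lintegral_enorm, mul_comm,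
    ← ENNReal.toReal_mul]
  have h := eLpNorm_le_eLpNorm_mul_rpow_measure_univ (p := 1) (q := 2) one_le_two ha.1
  rw [Measure.restrict_apply_univ] at h
  have e1 : (1 / (1 : ENNReal).toReal - 1 / (2 : ENNReal).toReal) = (1 / 2 : ℝ) := by norm_num
  rw [e1] at h
  refine ENNReal.toReal_mono ?_ h
  exact ENNReal.mul_ne_top ha.2.ne
    (ENNReal.rpow_ne_top_of_nonneg (by norm_num) (isCompact_box L).measure_lt_top.ne)

theorem tendsto_integral_norm {ι : Type*} {l : Filter ι} {E : Type*} [NormedAddCommGroup E]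
    {a : ι → ℂ → E} (ha : ∀ n, MemLp (a n) 2 (volume.restrict (box L)))
    (h : Tendsto (fun n => l2Norm L (a n)) l (𝓝 0)) :
    Tendsto (fun n => ∫ z in box L, ‖a n z‖) l (𝓝 0) := by
  have h1 := (ENNReal.tendsto_toReal ENNReal.zero_ne_top).comp h
  have h2 := h1.const_mul (volume (box L) ^ (1 / 2 : ℝ)).toReal
  rw [ENNReal.toReal_zero, mul_zero] at h2
  exact squeeze_zero (fun n => integral_nonneg fun _ => norm_nonneg _)
    (fun n => integral_norm_le_l2Norm (ha n)) h2

theorem norm_gradient_foldTest_le {τ : ℝ} (hτ : |τ| ≤ 1) (z : ℂ) {s : ℝ} (hs : 0 < s) (w : ℂ) :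
    ‖gradient (foldTest L e τ z s) w‖ ≤ 2 * s⁻¹ := by
  have h : ∀ y : ℂ, ‖moll y • y‖ ≤ 1 := by
    intro y
    rw [norm_smul, Real.norm_of_nonneg (moll_nonneg y)]
    rcases le_total 1 ‖y‖ with hy | hy
    · rw [moll_eq_zero hy, zero_mul]; exact zero_le_one
    · exact mul_le_one₀ (moll_le_one y) (norm_nonneg _) hy
  rw [gradient_foldTest, norm_smul, norm_inv, Real.norm_of_nonneg hs.le, mul_comm]
  refine mul_le_mul_of_nonneg_right ((norm_add_le _ _).trans ?_) (inv_nonneg.2 hs.le)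
  rw [norm_smul τ, Real.norm_eq_abs]
  have h1 := h (s⁻¹ • (w - z))
  have h2 := h (s⁻¹ • (w - e.refl L z))
  have h3 := mul_le_one₀ hτ (norm_nonneg _) h2
  linarith

theorem abs_foldMoll_le {τ : ℝ} (hτ : |τ| ≤ 1) (z : ℂ) (s : ℝ) (w : ℂ) :
    |foldMoll L e τ z s w| ≤ 2 * (s ^ 2)⁻¹ := by
  rw [foldMoll, abs_mul, abs_of_nonneg (by positivity : 0 ≤ (s ^ 2)⁻¹), mul_comm]
  refine mul_le_mul_of_nonneg_right ((abs_add_le _ _).trans ?_) (by positivity)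
  rw [abs_mul, abs_of_nonneg (moll_nonneg _), abs_of_nonneg (moll_nonneg _)]
  have h1 := moll_le_one (s⁻¹ • (w - z))
  have h3 := mul_le_one₀ hτ (moll_nonneg _) (moll_le_one (s⁻¹ • (w - e.refl L z)))
  linarith

theorem continuous_foldMoll (τ : ℝ) (z : ℂ) (s : ℝ) : Continuous (foldMoll L e τ z s) := by
  have h : ∀ a : ℂ, Continuous fun w : ℂ => moll (s⁻¹ • (w - a)) := fun a =>
    continuous_moll.comp (by fun_prop)
  exact continuous_const.mul ((h z).add (continuous_const.mul (h _)))

/-- The ball `B(z, ρ)` meets the box in a subset of `D`, is cut by at most the edge `e`, and meets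
no other edge. -/
structure GoodBall (L : ℝ) (e : Edge) (D : Set ℂ) (z : ℂ) (ρ : ℝ) : Prop where
  mem_box : ∀ w ∈ Metric.ball z ρ, inner ℝ e.normal w ≤ L → w ∈ box L
  notMem_edge : ∀ e', e' ≠ e → ∀ w ∈ Metric.ball z ρ, w ∉ edge L e'
  mem : ∀ w ∈ Metric.ball z ρ, w ∈ box L → w ∈ D

/-- The parity of the reflection: odd across Dirichlet edges, even across Neumann edges. -/
noncomputable def parity (e₀ e₁ e : Edge) : ℝ :=
  open Classical in if e = e₀ ∨ e = e₁ then -1 else 1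

theorem abs_parity_le (e₀ e₁ e : Edge) : |parity e₀ e₁ e| ≤ 1 := by
  unfold parity; split_ifs <;> simp

/-- On the reflecting line a point is equidistant from `z` and its mirror image, so odd parity
cancels the two bumps on a Dirichlet edge. On the other edges both bumps vanish. -/
theorem admissible_foldTest {D : Set ℂ} {z : ℂ} {s ρ : ℝ} (hG : GoodBall L e D z ρ) (hs : 0 < s)
    (hsρ : s ≤ ρ) (hz : inner ℝ e.normal z ≤ L) :
    Admissible L e₀ e₁ 0 (foldTest L e (parity e₀ e₁ e) z s) := by
  have key : ∀ e', (e' = e₀ ∨ e' = e₁) → ∀ w ∈ edge L e',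
      foldTest L e (parity e₀ e₁ e) z s w = 0 := by
    intro e' he' w hw
    rcases eq_or_ne e' e with rfl | hne
    · have h1 : parity e₀ e₁ e' = -1 := if_pos he'
      have h2 : mollPot (s⁻¹ • (w - e'.refl L z)) = mollPot (s⁻¹ • (w - z)) := by
        refine mollPot_congr ?_
        rw [norm_smul, norm_smul, ← norm_refl_sub, refl_eq_self (mem_edge_iff.1 hw).2]
      rw [foldTest, h1, h2]; ring
    · have h1 : w ∉ Metric.ball z ρ := fun h => hG.notMem_edge e' hne w h hw
      obtain ⟨h3, h4⟩ := le_norm_sub_of_notMem hz (mem_box_iff.1 (edge_subset_box L e' hw) e) h1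
      rw [foldTest, mollPot_eq_zero (one_le_norm_inv_smul hs hsρ h3),
        mollPot_eq_zero (one_le_norm_inv_smul hs hsρ h4)]
      ring
  exact ⟨contDiff_foldTest _ _ _, key e₀ (Or.inl rfl), key e₁ (Or.inr rfl)⟩

theorem gradient_foldTest_eq_zero {D : Set ℂ} {τ : ℝ} {z : ℂ} {s ρ : ℝ} (hG : GoodBall L e D z ρ)
    (hs : 0 < s) (hsρ : s ≤ ρ) (hz : inner ℝ e.normal z ≤ L) {w : ℂ} (hw : w ∈ box L)
    (hwD : w ∉ D) : gradient (foldTest L e τ z s) w = 0 := by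
  have h1 : w ∉ Metric.ball z ρ := fun h => hwD (hG.mem w h hw)
  obtain ⟨h3, h4⟩ := le_norm_sub_of_notMem hz (mem_box_iff.1 hw e) h1
  rw [gradient_foldTest, moll_eq_zero (one_le_norm_inv_smul hs hsρ h3),
    moll_eq_zero (one_le_norm_inv_smul hs hsρ h4)]
  simp

theorem integrable_inner_box {E : Type*} [NormedAddCommGroup E] [InnerProductSpace ℝ E]
    {a b : ℂ → E} (ha : MemLp a 2 (volume.restrict (box L)))
    (hb : MemLp b 2 (volume.restrict (box L))) :
    Integrable (fun z => inner ℝ (a z) (b z)) (volume.restrict (box L)) := by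
  refine (L2.integrable_inner (𝕜 := ℝ) (ha.toLp a) (hb.toLp b)).congr ?_
  filter_upwards [ha.coeFn_toLp, hb.coeFn_toLp] with z h1 h2
  rw [h1, h2]

/-- Weak harmonicity in the part `D` of the box, with natural boundary conditions off `e₀`, `e₁`. -/
def WeaklyHarmonic (L : ℝ) (e₀ e₁ : Edge) (D : Set ℂ) (h : ℂ → ℂ) : Prop :=
  ∀ φ, Admissible L e₀ e₁ 0 φ → (∀ w ∈ box L, w ∉ D → gradient φ w = 0) →
    ∫ w in box L, inner ℝ (h w) (gradient φ w) = 0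

/-- Differentiating the mollified mean in its scale produces the weak equation tested with
`foldTest`, which is zero. The mean is therefore independent of the scale. -/
theorem integral_mul_foldMoll_eq {u : ℂ → ℝ} {h : ℂ → ℂ} (hu : SobolevBC L e₀ e₁ 0 u h)
    {D : Set ℂ} (hh : WeaklyHarmonic L e₀ e₁ D h) {z : ℂ} {ε ρ : ℝ} (hG : GoodBall L e D z ρ)
    (hz : inner ℝ e.normal z < L) (hε : 0 < ε) (hερ : ε ≤ ρ) :
    ∫ w in box L, u w * foldMoll L e (parity e₀ e₁ e) z ρ w =
      ∫ w in box L, u w * foldMoll L e (parity e₀ e₁ e) z ε w := by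
  obtain ⟨hu2, hh2, f, hf, hfu, hfh⟩ := hu
  have hf' : ∀ n, Admissible L e₀ e₁ 0 (f n) := hf
  set τ := parity e₀ e₁ e with hτdef
  have hτ : |τ| ≤ 1 := abs_parity_le e₀ e₁ e
  have hρ : 0 < ρ := hε.trans_le hερ
  set A : (ℂ → ℝ) → ℝ → ℝ := fun f s => ∫ w in box L, f w * foldMoll L e τ z s w with hA
  set I : ℕ → ℝ := fun n => ∫ w in box L, ‖gradient (f n) w - h w‖ with hI
  have hIlim : Tendsto I atTop (𝓝 0) :=
    tendsto_integral_norm (fun n => (hf' n).memLp_gradient.sub hh2) hfh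
  have hAlim : ∀ s, Tendsto (fun n => A (f n) s) atTop (𝓝 (A u s)) := by
    intro s
    have hm : MemLp (foldMoll L e τ z s) 2 (volume.restrict (box L)) :=
      memLp_box_of_continuous (continuous_foldMoll τ z s) L 2
    have hint : ∀ v : ℂ → ℝ, MemLp v 2 (volume.restrict (box L)) →
        Integrable (fun w => v w * foldMoll L e τ z s w) (volume.restrict (box L)) :=
      fun v hv => hv.integrable_mul hm
    rw [tendsto_iff_norm_sub_tendsto_zero]
    have h0 := (tendsto_integral_norm (fun n => (hf' n).memLp.sub hu2) hfu).const_mul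
      (2 * (s ^ 2)⁻¹)
    rw [mul_zero] at h0
    refine squeeze_zero (fun _ => norm_nonneg _) (fun n => ?_) h0
    simp only [hA]
    rw [← integral_sub (hint _ (hf' n).memLp) (hint _ hu2), ← integral_const_mul]
    refine norm_integral_le_of_norm_le ((((hf' n).memLp.sub hu2).integrable
      one_le_two).norm.const_mul _) (Eventually.of_forall fun w => ?_)
    rw [← sub_mul, norm_mul, mul_comm]
    exact mul_le_mul_of_nonneg_right (abs_foldMoll_le hτ z s w) (norm_nonneg _)
  -- The pointwise identity is available only for the smooth `f n`. Replacing `gradient (f n)` by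
  -- `h` costs its L¹ distance times the bound `2 * ε⁻¹` for the test gradient, uniformly over
  -- scales above `ε`.
  have hdiff : ∀ n, ‖A (f n) ρ - A (f n) ε‖ ≤ ε⁻¹ * (2 * ε⁻¹ * I n) * (ρ - ε) := by
    intro n
    have h0 : ∀ w ∈ Metric.ball z ρ, inner ℝ e.normal w = L → τ * f n w = f n w := by
      intro w hw hwL
      have hwe : w ∈ edge L e := mem_edge_iff.2 ⟨hG.mem_box w hw hwL.le, hwL⟩
      by_cases he : e = e₀ ∨ e = e₁
      · have : f n w = 0 := by
          rcases he with rfl | rfl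
          · exact (hf n).2.1 w hwe
          · exact (hf n).2.2 w hwe
        rw [this, mul_zero]
      · have : τ = 1 := if_neg he
        rw [this, one_mul]
    have hint : ∀ s : ℝ, Integrable fun y => moll y * foldExt L e τ (f n) (z + s • y) := by
      intro s
      obtain ⟨C, hC⟩ := exists_bound_foldExt (L := L) (e := e) (hf n).1 τ z |s|
      refine integrable_of_bound_ball (z := 0) (s := 1) (C := 1 * C) ?_ ?_ ?_
      · exact continuous_moll.measurable.mul ((measurable_foldExt (hf n).1 τ).comp
          (Continuous.measurable (by fun_prop)))
      · intro y hy
        rw [norm_mul, Real.norm_of_nonneg (moll_nonneg _)]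
        refine mul_le_mul (moll_le_one _) (hC _ ?_) (norm_nonneg _) zero_le_one
        rw [mem_closedBall_iff_norm, add_sub_cancel_left, norm_smul, Real.norm_eq_abs]
        exact mul_le_of_le_one_right (abs_nonneg _) (mem_closedBall_zero_iff.1 hy)
      · intro y hy
        rw [mem_closedBall_zero_iff, not_le] at hy
        rw [moll_eq_zero hy.le, zero_mul]
    have e1 := integral_moll_foldExt_sub (hf n).1 (τ := τ) hε hερ hz h0
    simp only [mul_sub] at e1
    rw [integral_sub (hint ρ) (hint ε),
      integral_moll_foldExt (hf n).1 τ hρ le_rfl hz.le hG.mem_box,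
      integral_moll_foldExt (hf n).1 τ hε hερ hz.le hG.mem_box] at e1
    rw [show A (f n) ρ - A (f n) ε = _ from e1]
    have hvol : ρ - ε = volume.real (Ioc ε ρ) := by
      rw [Real.volume_real_Ioc_of_le hερ]
    rw [hvol]
    refine norm_setIntegral_le_of_norm_le_const measure_Ioc_lt_top fun s hs => ?_
    have hs0 : 0 < s := hε.trans hs.1
    have hadm := admissible_foldTest (e₀ := e₀) (e₁ := e₁) hG hs0 hs.2 hz.le
    rw [integral_moll_foldGrad (hf n).1 τ hs0 hs.2 hz.le hG.mem_box, norm_mul, norm_inv,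
      Real.norm_of_nonneg hs0.le]
    have hw := hh _ hadm fun w hw hwD => gradient_foldTest_eq_zero hG hs0 hs.2 hz.le hw hwD
    have hsi : s⁻¹ ≤ ε⁻¹ := inv_anti₀ hε hs.1.le
    refine mul_le_mul hsi ?_ (norm_nonneg _) (inv_nonneg.2 hε.le)
    rw [← sub_zero (∫ w in box L, inner ℝ (gradient (f n) w) _), ← hw,
      ← integral_sub (integrable_inner_box (hf' n).memLp_gradient hadm.memLp_gradient)
        (integrable_inner_box hh2 hadm.memLp_gradient), hI, ← integral_const_mul]
    refine norm_integral_le_of_norm_le ((((hf' n).memLp_gradient.sub hh2).integrable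
      one_le_two).norm.const_mul _) (Eventually.of_forall fun w => ?_)
    rw [← inner_sub_left, mul_comm]
    refine (norm_inner_le_norm _ _).trans (mul_le_mul_of_nonneg_left ?_ (norm_nonneg _))
    refine (norm_gradient_foldTest_le hτ z hs0 w).trans ?_
    linarith
  have hlim0 : Tendsto (fun n => A (f n) ρ - A (f n) ε) atTop (𝓝 0) := by
    have h1 := ((hIlim.const_mul (2 * ε⁻¹)).const_mul ε⁻¹).mul_const (ρ - ε)
    simp only [mul_zero, zero_mul] at h1
    exact squeeze_zero_norm hdiff h1
  have := tendsto_nhds_unique ((hAlim ρ).sub (hAlim ε)) hlim0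
  exact sub_eq_zero.1 this

/-- Approximate identity at Lebesgue points. Off the line, the reflected bump no longer reaches the
box once the scale is small. -/
theorem ae_tendsto_integral_foldMoll {u : ℂ → ℝ} (hu : MemLp u 2 (volume.restrict (box L)))
    (τ : ℝ) :
    ∀ᵐ z : ℂ, z ∈ interior (box L) → inner ℝ e.normal z < L →
      Tendsto (fun ε => ∫ w in box L, u w * foldMoll L e τ z ε w) (𝓝[>] 0)
        (𝓝 (u z * ∫ y, moll y)) := by
  set U : ℂ → ℝ := (box L).indicator u with hU
  have hm := measurableSet_box L
  have hUi : Integrable U := (integrable_indicator_iff hm).2 (hu.integrable one_le_two)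
  filter_upwards [IsUnifLocDoublingMeasure.ae_tendsto_average_norm_sub volume
    hUi.locallyIntegrable 1] with z hz hzi hzL
  have hlim := hz (l := 𝓝[>] (0 : ℝ)) (fun _ => z) (fun ε => ε) tendsto_id (by
    filter_upwards [self_mem_nhdsWithin] with ε hε
    exact Metric.mem_closedBall_self (by rw [one_mul]; exact le_of_lt hε))
  obtain ⟨δ, hδ, hδb⟩ := Metric.isOpen_iff.1 isOpen_interior z hzi
  have hUz : U z = u z := indicator_of_mem (interior_subset hzi) u
  rw [tendsto_iff_norm_sub_tendsto_zero]
  have hlim2 := hlim.const_mul Real.pi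
  rw [mul_zero] at hlim2
  refine squeeze_zero' (Eventually.of_forall fun _ => norm_nonneg _) ?_ hlim2
  have hδ' : 0 < min δ (L - inner ℝ e.normal z) := lt_min hδ (sub_pos.2 hzL)
  filter_upwards [Ioo_mem_nhdsGT hδ'] with ε hε
  have hε0 : 0 < ε := hε.1
  have hsub : Metric.closedBall z ε ⊆ box L := fun w hw =>
    interior_subset (hδb (lt_of_le_of_lt hw (hε.2.trans_le (min_le_left _ _))))
  have hcb : MeasurableSet (Metric.closedBall z ε) := Metric.isClosed_closedBall.measurableSet
  have e1 : ∫ w in box L, u w * foldMoll L e τ z ε w =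
      ∫ w in Metric.closedBall z ε, U w * ((ε ^ 2)⁻¹ * moll (ε⁻¹ • (w - z))) := by
    rw [setIntegral_eq_of_subset_of_forall_sdiff_eq_zero hm hsub]
    · refine setIntegral_congr_fun hcb fun w hw => ?_
      have hwb := hsub hw
      have h1 : ε ≤ ‖w - e.refl L z‖ := by
        have h2 := abs_real_inner_le_norm e.normal (e.refl L z - w)
        rw [norm_normal, one_mul, inner_sub_right, inner_normal_refl, norm_sub_rev] at h2
        have h3 := mem_box_iff.1 hwb e
        have h4 := le_abs_self (2 * L - inner ℝ e.normal z - inner ℝ e.normal w)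
        have h5 := hε.2.trans_le (min_le_right _ _)
        linarith
      simp only [hU, indicator_of_mem hwb, foldMoll,
        moll_eq_zero (one_le_norm_inv_smul hε0 le_rfl h1), mul_zero, add_zero]
    · rintro w ⟨hwb, hw⟩
      rw [mem_closedBall_iff_norm, not_le] at hw
      have h1 : ε ≤ ‖w - e.refl L z‖ :=
        hw.le.trans (norm_sub_le_norm_sub_refl (mem_box_iff.1 hwb e) hzL.le)
      rw [foldMoll, moll_eq_zero (one_le_norm_inv_smul hε0 le_rfl h1),
        moll_eq_zero (one_le_norm_inv_smul hε0 le_rfl hw.le)]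
      ring
  have hki : Continuous fun w => (ε ^ 2)⁻¹ * moll (ε⁻¹ • (w - z)) :=
    continuous_const.mul (continuous_moll.comp (by fun_prop))
  have e2 : ∫ y, moll y = ∫ w in Metric.closedBall z ε, (ε ^ 2)⁻¹ * moll (ε⁻¹ • (w - z)) := by
    have h1 := integral_comp_add_smul (fun w => moll (ε⁻¹ • (w - z))) z hε0
    simp only [add_sub_cancel_left, smul_smul, inv_mul_cancel₀ hε0.ne', one_smul] at h1
    rw [h1, ← integral_const_mul, ← setIntegral_univ]
    refine setIntegral_eq_of_subset_of_forall_sdiff_eq_zero MeasurableSet.univ (subset_univ _) ?_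
    rintro w ⟨-, hw⟩
    rw [mem_closedBall_iff_norm, not_le] at hw
    rw [moll_eq_zero (one_le_norm_inv_smul hε0 le_rfl hw.le), mul_zero]
  have hkb : ∀ w, ‖(ε ^ 2)⁻¹ * moll (ε⁻¹ • (w - z))‖ ≤ (ε ^ 2)⁻¹ := by
    intro w
    rw [norm_mul, Real.norm_of_nonneg (moll_nonneg _), norm_inv, norm_pow, Real.norm_eq_abs,
      sq_abs]
    exact mul_le_of_le_one_right (by positivity) (moll_le_one _)
  have hfin : IsFiniteMeasure (volume.restrict (Metric.closedBall z ε)) :=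
    ⟨by rw [Measure.restrict_apply_univ]; exact measure_closedBall_lt_top⟩
  rw [e1, e2, ← integral_const_mul, ← integral_sub]
  · rw [average_eq, smul_eq_mul, measureReal_restrict_apply_univ]
    have hv : volume.real (Metric.closedBall z ε) = ε ^ 2 * Real.pi := by
      rw [Measure.real, Complex.volume_closedBall, ENNReal.toReal_mul, ENNReal.toReal_pow,
        ENNReal.toReal_ofReal hε0.le]
      rfl
    have e3 : Real.pi * ((volume.real (Metric.closedBall z ε))⁻¹ *
        ∫ w in Metric.closedBall z ε, ‖U w - U z‖) =
        ∫ w in Metric.closedBall z ε, (ε ^ 2)⁻¹ * ‖U w - U z‖ := by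
      rw [hv, integral_const_mul]
      field_simp
    rw [e3]
    refine norm_integral_le_of_norm_le
      (((hUi.integrableOn.sub (integrable_const _)).norm).const_mul _)
      (Eventually.of_forall fun w => ?_)
    rw [← hUz, ← sub_mul, norm_mul, mul_comm]
    exact mul_le_mul_of_nonneg_right (hkb w) (norm_nonneg _)
  · exact hUi.integrableOn.mul_bdd hki.aestronglyMeasurable (Eventually.of_forall hkb)
  · exact (Integrable.of_bound hki.aestronglyMeasurable _ (Eventually.of_forall hkb)).const_mul _

/-- Sup bound for weakly harmonic functions with vanishing Dirichlet data, up to the boundary. -/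
theorem ae_abs_le_of_weaklyHarmonic (L ρ : ℝ) (e e₀ e₁ : Edge) (hρ : 0 < ρ) :
    ∃ C : ℝ, ∀ (u : ℂ → ℝ) (h : ℂ → ℂ) (D : Set ℂ), SobolevBC L e₀ e₁ 0 u h →
      WeaklyHarmonic L e₀ e₁ D h → ∀ᵐ z : ℂ, z ∈ interior (box L) → GoodBall L e D z ρ →
        |u z| ≤ C * (l2Norm L u).toReal := by
  have hm := integral_moll_pos
  -- The kernel at scale `ρ` is at most `2 * (ρ ^ 2)⁻¹`, and Cauchy-Schwarz on the box turns L¹ into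
  -- L². None of these factors depends on `u`, `h` or `D`.
  refine ⟨(∫ y, moll y)⁻¹ * (2 * (ρ ^ 2)⁻¹ * (volume (box L) ^ (1 / 2 : ℝ)).toReal),
    fun u h D hu hh => ?_⟩
  have h0 : ∀ᵐ z : ℂ, inner ℝ e.normal z ≠ L := by
    rw [ae_iff]; simpa using volume_line_eq_zero L e
  filter_upwards [ae_tendsto_integral_foldMoll (e := e) hu.1 (parity e₀ e₁ e), h0]
    with z hz hzL hzi hG
  have hzL' : inner ℝ e.normal z < L :=
    lt_of_le_of_ne (mem_box_iff.1 (interior_subset hzi) e) hzL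
  have hconst : ∫ w in box L, u w * foldMoll L e (parity e₀ e₁ e) z ρ w = u z * ∫ y, moll y := by
    refine tendsto_nhds_unique (l := 𝓝[>] (0 : ℝ)) ?_ (hz hzi hzL')
    refine tendsto_const_nhds.congr' ?_
    filter_upwards [Ioc_mem_nhdsGT hρ] with ε hε
    exact integral_mul_foldMoll_eq hu hh hG hzL' hε.1 hε.2
  have hle : |u z * ∫ y, moll y| ≤
      2 * (ρ ^ 2)⁻¹ * ((volume (box L) ^ (1 / 2 : ℝ)).toReal * (l2Norm L u).toReal) := by
    rw [← hconst, ← Real.norm_eq_abs]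
    refine le_trans ?_ (mul_le_mul_of_nonneg_left (integral_norm_le_l2Norm hu.1) (by positivity))
    rw [← integral_const_mul]
    refine norm_integral_le_of_norm_le ((hu.1.integrable one_le_two).norm.const_mul _)
      (Eventually.of_forall fun w => ?_)
    rw [norm_mul, mul_comm]
    exact mul_le_mul_of_nonneg_right (abs_foldMoll_le (abs_parity_le _ _ _) z ρ w) (norm_nonneg _)
  rw [abs_mul, abs_of_pos hm] at hle
  rw [mul_assoc, ← div_eq_inv_mul, le_div_iff₀ hm]
  linarith

end WeakMeanValue

/-! ### Separating potentials -/

section Separation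

open scoped Manifold

variable {L r u₀ : ℝ} {e₀ e₁ : Edge}

/-- The function takes values in [0, 1], so every point of the two sets is an extremum. The gradient
vanishes there even if the sets have empty interior. -/
theorem exists_contDiff_separating {A B : Set ℂ} (hA : IsClosed A) (hB : IsClosed B)
    (hAB : Disjoint A B) : ∃ f : ℂ → ℝ, ContDiff ℝ 1 f ∧ (∀ z ∈ A, f z = 0) ∧ (∀ z ∈ B, f z = 1) ∧
      ∀ z ∈ A ∪ B, gradient f z = 0 := by
  obtain ⟨f, h0, h1, h01⟩ := exists_contMDiffMap_zero_one_of_isClosed (n := 1) 𝓘(ℝ, ℂ) hA hB hAB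
  refine ⟨f, f.contMDiff.contDiff, fun z hz => h0 hz, fun z hz => h1 hz, fun z hz => ?_⟩
  have : IsLocalExtr f z := by
    rcases hz with hz | hz
    · exact Or.inl (Eventually.of_forall fun w => by rw [h0 hz]; exact (h01 w).1)
    · exact Or.inr (Eventually.of_forall fun w => by rw [h1 hz]; exact (h01 w).2)
  rw [gradient, this.fderiv_eq_zero, map_zero]

/-- Every point of `Z` has a neighbourhood whose points in `Z` are joined to it inside `Z`. -/
def LocallyJoined (Z : Set ℂ) : Prop :=
  ∀ p ∈ Z, ∃ ε > 0, ∀ q ∈ Z, dist q p < ε → JoinedIn Z q p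

/-- `B` is the part of `Z` that curves in `Z` reach from `e₁`. Local joining makes both `B` and `Z \
B` closed; the absence of a crossing keeps `B` off `e₀`. Separating the two parts together with
their edges gives the competitor. -/
theorem exists_admissible_of_not_curveConnected {Z : Set ℂ} (hZ : IsClosed Z)
    (hloc : LocallyJoined Z) (hcon : ¬ CurveConnected Z (edge L e₀) (edge L e₁))
    (he : Disjoint (edge L e₀) (edge L e₁)) :
    ∃ w, Admissible L e₀ e₁ u₀ w ∧ ∀ z ∈ Z, gradient w z = 0 := by
  set B : Set ℂ := {z | ∃ a ∈ edge L e₁, JoinedIn Z a z}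
  have hBZ : B ⊆ Z := fun z ⟨a, _, h⟩ => h.target_mem
  have hB : IsClosed B := by
    refine isClosed_of_closure_subset fun p hp => ?_
    have hpZ : p ∈ Z := closure_minimal hBZ hZ hp
    obtain ⟨ε, hε, h⟩ := hloc p hpZ
    obtain ⟨q, ⟨a, ha, haq⟩, hq⟩ := Metric.mem_closure_iff.1 hp ε hε
    rw [dist_comm] at hq
    exact ⟨a, ha, haq.trans (h q haq.target_mem hq)⟩
  have hA : IsClosed (Z \ B) := by
    refine isClosed_of_closure_subset fun p hp => ?_
    have hpZ : p ∈ Z := closure_minimal sdiff_subset hZ hp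
    refine ⟨hpZ, ?_⟩
    rintro ⟨a, ha, hap⟩
    obtain ⟨ε, hε, h⟩ := hloc p hpZ
    obtain ⟨q, hqZ, hq⟩ := Metric.mem_closure_iff.1 hp ε hε
    rw [dist_comm] at hq
    exact hqZ.2 ⟨a, ha, hap.trans (h q hqZ.1 hq).symm⟩
  have hdisj : Disjoint (Z \ B ∪ edge L e₀) (B ∪ edge L e₁) := by
    rw [Set.disjoint_left]
    rintro z (⟨hz1, hz2⟩ | hz) (hz' | hz')
    · exact hz2 hz'
    · exact hz2 ⟨z, hz', JoinedIn.refl hz1⟩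
    · obtain ⟨a, ha, γ, hγ⟩ := hz'
      exact hcon ⟨γ, γ.continuous, hγ, ⟨1, by rw [γ.target]; exact hz⟩, ⟨0, by rw [γ.source]; exact ha⟩⟩
    · exact Set.disjoint_left.1 he hz hz'
  obtain ⟨f, hf, h0, h1, hg⟩ := exists_contDiff_separating (hA.union (isCompact_edge L e₀).isClosed)
    (hB.union (isCompact_edge L e₁).isClosed) hdisj
  refine ⟨fun z => u₀ * f z, ⟨contDiff_const.mul hf, fun z hz => ?_, fun z hz => ?_⟩,
    fun z hz => ?_⟩
  · simp only [h0 z (Or.inr hz), mul_zero]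
  · simp only [h1 z (Or.inr hz), mul_one]
  · rw [gradient_const_mul_apply hf, hg z, smul_zero]
    by_cases h : z ∈ B
    · exact Or.inr (Or.inl h)
    · exact Or.inl (Or.inl ⟨hz, h⟩)

/-! ### The local structure of the two regions -/

instance : Finite Edge := Finite.of_injective
  (fun e : Edge => match e with | .up => (0 : Fin 4) | .down => 1 | .left => 2 | .right => 3)
  (fun a b h => by cases a <;> cases b <;> simp_all)

theorem exists_finset_of_mem_boolConfig {X : Set ℂ} (hr : 0 < r) (hX : X ∈ boolConfig L r) :
    ∃ F : Finset ℂ, X = (⋃ c ∈ F, Metric.closedBall c r) ∩ box L := by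
  obtain ⟨P, hP, rfl⟩ := hX
  obtain ⟨M, hM⟩ := (isCompact_box L).isBounded.subset_closedBall 0
  -- A point of the box in the closure has a point of the neighbourhood within distance 1, whose
  -- centre is within `r` of it; hence the radius `M + 1 + r`.
  have hfin := hP _ (isCompact_closedBall (0 : ℂ) (M + 1 + r))
  refine ⟨hfin.toFinset, ?_⟩
  have hcl : IsClosed (⋃ c ∈ hfin.toFinset, Metric.closedBall c r) :=
    hfin.toFinset.finite_toSet.isClosed_biUnion fun c _ => Metric.isClosed_closedBall
  ext z
  refine ⟨fun ⟨hz, hzb⟩ => ⟨?_, hzb⟩, fun ⟨hz, hzb⟩ => ⟨?_, hzb⟩⟩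
  · rw [← hcl.closure_eq, Metric.mem_closure_iff]
    intro ε hε
    obtain ⟨w, hw, hzw⟩ := Metric.mem_closure_iff.1 hz (min ε 1) (lt_min hε one_pos)
    obtain ⟨c, hc, hwc⟩ := Metric.mem_thickening_iff.1 hw
    refine ⟨w, mem_biUnion (x := c) ?_ hwc.le, hzw.trans_le (min_le_left _ _)⟩
    rw [Finset.mem_coe, Set.Finite.mem_toFinset]
    refine ⟨hc, ?_⟩
    have h1 := Metric.mem_closedBall.1 (hM hzb)
    have h2 := hzw.trans_le (min_le_right _ _)
    have h3 := dist_triangle4 c w z 0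
    rw [dist_comm c w, dist_comm w z] at h3
    rw [Metric.mem_closedBall]
    linarith
  · simp only [mem_iUnion, Set.Finite.mem_toFinset] at hz
    obtain ⟨c, hc, hz⟩ := hz
    rw [← closure_ball c hr.ne'] at hz
    exact closure_mono (Metric.ball_subset_thickening hc.1 r) hz

/-- The part of a closed disc which lies in the box. -/
def discPiece (L r : ℝ) (c : ℂ) : Set ℂ := Metric.closedBall c r ∩ box L

theorem convex_discPiece (c : ℂ) : Convex ℝ (discPiece L r c) :=
  (convex_closedBall c r).inter (convex_box L)

theorem isClosed_discPiece (c : ℂ) : IsClosed (discPiece L r c) :=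
  Metric.isClosed_closedBall.inter (isClosed_box L)

theorem mem_iff_exists_discPiece {X : Set ℂ} {F : Finset ℂ}
    (hX : X = (⋃ c ∈ F, Metric.closedBall c r) ∩ box L) {z : ℂ} :
    z ∈ X ↔ ∃ c ∈ F, z ∈ discPiece L r c := by
  rw [hX]; simp only [discPiece, mem_inter_iff, mem_iUnion, exists_prop]; aesop

theorem isClosed_of_finset {X : Set ℂ} {F : Finset ℂ}
    (hX : X = (⋃ c ∈ F, Metric.closedBall c r) ∩ box L) : IsClosed X := by
  rw [hX]
  exact (F.finite_toSet.isClosed_biUnion fun c _ => Metric.isClosed_closedBall).inter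
    (isClosed_box L)

/-- Near `p` only the disc pieces containing `p` are met, and in such a convex piece the segment to
`p` is available. -/
theorem locallyJoined_occupied {X : Set ℂ} {F : Finset ℂ}
    (hX : X = (⋃ c ∈ F, Metric.closedBall c r) ∩ box L) : LocallyJoined X := by
  intro p hp
  have h : ∀ᶠ q in 𝓝 p, ∀ c ∈ F, p ∉ discPiece L r c → q ∉ discPiece L r c := by
    rw [Filter.eventually_all_finset]
    intro c _
    by_cases hpc : p ∈ discPiece L r c
    · exact Eventually.of_forall fun q hq => absurd hpc hq
    · filter_upwards [(isClosed_discPiece c).isOpen_compl.mem_nhds hpc] with q hq _ using hq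
  obtain ⟨ε, hε, h⟩ := Metric.eventually_nhds_iff.1 h
  refine ⟨ε, hε, fun q hq hqp => ?_⟩
  obtain ⟨c, hc, hqc⟩ := (mem_iff_exists_discPiece hX).1 hq
  have hpc : p ∈ discPiece L r c := by_contra fun hpc => h hqp c hc hpc hqc
  refine JoinedIn.of_segment_subset fun z hz => ?_
  exact (mem_iff_exists_discPiece hX).2 ⟨c, hc, (convex_discPiece c).segment_subset hqc hpc hz⟩

theorem mem_vacant_iff {X : Set ℂ} {F : Finset ℂ}
    (hX : X = (⋃ c ∈ F, Metric.closedBall c r) ∩ box L) {z : ℂ} :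
    z ∈ vacant L X ↔ z ∈ box L ∧ ∀ c ∈ F, r < ‖z - c‖ := by
  rw [vacant, Set.mem_sdiff, mem_iff_exists_discPiece hX]
  constructor
  · rintro ⟨h1, h2⟩
    refine ⟨h1, fun c hc => ?_⟩
    by_contra h
    exact h2 ⟨c, hc, mem_closedBall_iff_norm.2 (not_lt.1 h), h1⟩
  · rintro ⟨h1, h2⟩
    refine ⟨h1, ?_⟩
    rintro ⟨c, hc, h, -⟩
    exact absurd (mem_closedBall_iff_norm.1 h) (not_le.2 (h2 c hc))

/-- A circular arc from `p` (at `s = 0`) to `q` (at `s = 1`), with initial direction `e`. -/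
noncomputable def arc (p e q : ℂ) (s : ℝ) : ℂ :=
  p + (s / ‖s • (‖q - p‖ ^ 2)⁻¹ • (q - p) + (1 - s) • e‖ ^ 2) •
    (s • (‖q - p‖ ^ 2)⁻¹ • (q - p) + (1 - s) • e)

theorem arc_dir_ne_zero {p e q : ℂ} {s : ℝ} (hs : s ∈ Icc (0 : ℝ) 1) (he : ‖e‖ = 1)
    (hq : 0 < inner ℝ (q - p) e) : s • (‖q - p‖ ^ 2)⁻¹ • (q - p) + (1 - s) • e ≠ 0 := by
  intro h
  have hqp : q - p ≠ 0 := by rintro h; rw [h, inner_zero_left] at hq; exact lt_irrefl _ hq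
  have h1 : inner ℝ (s • (‖q - p‖ ^ 2)⁻¹ • (q - p) + (1 - s) • e) e = (0 : ℝ) := by
    rw [h, inner_zero_left]
  rw [inner_add_left, real_inner_smul_left, real_inner_smul_left, real_inner_smul_left,
    real_inner_self_eq_norm_sq, he] at h1
  have h2 : 0 < (‖q - p‖ ^ 2)⁻¹ * inner ℝ (q - p) e := by positivity
  have h3 : 0 ≤ s * ((‖q - p‖ ^ 2)⁻¹ * inner ℝ (q - p) e) := mul_nonneg hs.1 h2.le
  have h4 : s = 1 := by nlinarith [hs.2]
  rw [h4] at h1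
  linarith

theorem continuousOn_arc {p e q : ℂ} (he : ‖e‖ = 1) (hq : 0 < inner ℝ (q - p) e) :
    ContinuousOn (arc p e q) (Icc 0 1) := by
  unfold arc
  refine continuousOn_const.add (ContinuousOn.smul (ContinuousOn.div continuousOn_id
    (Continuous.continuousOn (by fun_prop)) fun s hs => ?_) (Continuous.continuousOn (by fun_prop)))
  exact pow_ne_zero 2 (norm_ne_zero_iff.2 (arc_dir_ne_zero hs he hq))

theorem continuousAt_arc {p e q : ℂ} {s : ℝ} (hs : s ∈ Icc (0 : ℝ) 1) (he : ‖e‖ = 1)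
    (hq : 0 < inner ℝ (q - p) e) : ContinuousAt (fun q => arc p e q s) q := by
  have hqp : q - p ≠ 0 := by rintro h; rw [h, inner_zero_left] at hq; exact lt_irrefl _ hq
  have h1 : ContinuousAt (fun q : ℂ => s • (‖q - p‖ ^ 2)⁻¹ • (q - p) + (1 - s) • e) q := by
    have h2 : ContinuousAt (fun q : ℂ => (‖q - p‖ ^ 2)⁻¹) q :=
      ContinuousAt.inv₀ (Continuous.continuousAt (by fun_prop))
        (pow_ne_zero 2 (norm_ne_zero_iff.2 hqp))
    exact ((h2.smul (Continuous.continuousAt (by fun_prop))).const_smul s).add continuousAt_const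
  unfold arc
  refine continuousAt_const.add (ContinuousAt.smul (ContinuousAt.div continuousAt_const
    (h1.norm.pow 2) ?_) h1)
  exact pow_ne_zero 2 (norm_ne_zero_iff.2 (arc_dir_ne_zero hs he hq))

theorem arc_zero (p e q : ℂ) : arc p e q 0 = p := by simp [arc]

theorem arc_one {p e q : ℂ} (hqp : q ≠ p) : arc p e q 1 = q := by
  have h : ‖q - p‖ ≠ 0 := norm_ne_zero_iff.2 (sub_ne_zero.2 hqp)
  simp only [arc, one_smul, sub_self, zero_smul, add_zero]
  rw [norm_smul, norm_inv, norm_pow, norm_norm, smul_smul]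
  have : 1 / ((‖q - p‖ ^ 2)⁻¹ * ‖q - p‖) ^ 2 * (‖q - p‖ ^ 2)⁻¹ = 1 := by field_simp
  rw [this, one_smul, add_sub_cancel]

/-- Under inversion at `p`, the exterior of a disc through `p` and the inner side of an edge through
`p` become half-planes, and `arc` becomes the ray in direction `e` from the image of `q`. The sign
conditions on `e` say that the ray does not leave these half-planes. Discs and edges not through `p`
are excluded by the choice of `ε`. -/
theorem arc_mem_vacant {X : Set ℂ} {F : Finset ℂ}
    (hX : X = (⋃ c ∈ F, Metric.closedBall c r) ∩ box L) {p e q : ℂ} {s ε : ℝ}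
    (hF : ∀ c ∈ F, r ≤ ‖p - c‖)
    (hε : ∀ w ∈ Metric.ball p ε, ∀ c ∈ F, r < ‖p - c‖ → r < ‖w - c‖)
    (hε' : ∀ w ∈ Metric.ball p ε, ∀ i : Edge, inner ℝ i.normal p < L → inner ℝ i.normal w < L)
    (hpb : p ∈ box L) (he : ‖e‖ = 1) (hec : ∀ c ∈ F, ‖p - c‖ = r → inner ℝ e (c - p) ≤ 0)
    (hen : ∀ i : Edge, inner ℝ i.normal p = L → inner ℝ i.normal e ≤ 0)
    (hq : q ∈ vacant L X) (hqp : q ∈ Metric.ball p ε) (hqe : 0 < inner ℝ (q - p) e)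
    (hs : s ∈ Ioc (0 : ℝ) 1) : arc p e q s ∈ vacant L X := by
  have hs' : s ∈ Icc (0 : ℝ) 1 := Ioc_subset_Icc_self hs
  have hs0 := hs.1
  have hs1 : 0 ≤ 1 - s := by linarith [hs.2]
  have hq0 : q - p ≠ 0 := by rintro h; rw [h, inner_zero_left] at hqe; exact lt_irrefl _ hqe
  have hN : 0 < ‖q - p‖ := norm_pos_iff.2 hq0
  set N := ‖q - p‖ with hNdef
  set x := s • (N ^ 2)⁻¹ • (q - p) + (1 - s) • e with hx
  have hx0 : x ≠ 0 := arc_dir_ne_zero hs' he hqe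
  have hxN : 0 < ‖x‖ := norm_pos_iff.2 hx0
  have harc : arc p e q s = p + (s / ‖x‖ ^ 2) • x := rfl
  rw [mem_vacant_iff hX] at hq
  have hxinner : ∀ v : ℂ, inner ℝ v x = s * ((N ^ 2)⁻¹ * inner ℝ v (q - p)) +
      (1 - s) * inner ℝ v e := by
    intro v
    rw [hx, inner_add_right, real_inner_smul_right, real_inner_smul_right, real_inner_smul_right]
  -- Because `q - p` and `e` form an acute angle, the arc never gets farther from `p` than `q`.
  have hxbig : s / N ≤ ‖x‖ := by
    refine le_of_sq_le_sq ?_ hxN.le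
    have h1 : ‖x‖ ^ 2 = s ^ 2 * (N ^ 2)⁻¹ + 2 * (s * (1 - s) * ((N ^ 2)⁻¹ * inner ℝ (q - p) e)) +
        (1 - s) ^ 2 := by
      rw [hx, norm_add_sq_real, norm_smul, norm_smul, norm_smul, he, real_inner_smul_left,
        real_inner_smul_left, real_inner_smul_right, Real.norm_of_nonneg hs0.le,
        Real.norm_of_nonneg hs1, Real.norm_of_nonneg (by positivity), ← hNdef]
      field_simp
    rw [h1, div_pow, div_eq_mul_inv]
    have h2 : 0 ≤ s * (1 - s) * ((N ^ 2)⁻¹ * inner ℝ (q - p) e) := by positivity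
    nlinarith [sq_nonneg (1 - s)]
  have hnear : arc p e q s ∈ Metric.ball p ε := by
    rw [mem_ball_iff_norm, harc, add_sub_cancel_left, norm_smul, norm_div, norm_pow, norm_norm,
      Real.norm_of_nonneg hs0.le]
    have h1 : s / ‖x‖ ^ 2 * ‖x‖ = s / ‖x‖ := by field_simp
    rw [h1]
    refine lt_of_le_of_lt ?_ (mem_ball_iff_norm.1 hqp)
    rw [div_le_iff₀ hxN]
    rw [div_le_iff₀ hN] at hxbig
    linarith
  rw [mem_vacant_iff hX]
  refine ⟨mem_box_iff.2 fun i => ?_, fun c hc => ?_⟩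
  · rcases (mem_box_iff.1 hpb i).lt_or_eq with h | h
    · exact (hε' _ hnear i h).le
    · rw [harc, inner_add_right, real_inner_smul_right, h, hxinner]
      have h1 : inner ℝ i.normal (q - p) ≤ 0 := by
        rw [inner_sub_right, h]; linarith [mem_box_iff.1 hq.1 i]
      have h2 := hen i h
      have h3 : s * ((N ^ 2)⁻¹ * inner ℝ i.normal (q - p)) ≤ 0 :=
        mul_nonpos_of_nonneg_of_nonpos hs0.le
          (mul_nonpos_of_nonneg_of_nonpos (by positivity) h1)
      have h4 : (1 - s) * inner ℝ i.normal e ≤ 0 := mul_nonpos_of_nonneg_of_nonpos hs1 h2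
      have h5 := mul_nonpos_of_nonneg_of_nonpos (by positivity : 0 ≤ s / ‖x‖ ^ 2)
        (by linarith : s * ((N ^ 2)⁻¹ * inner ℝ i.normal (q - p)) + (1 - s) * inner ℝ i.normal e ≤ 0)
      linarith
  · rcases (hF c hc).lt_or_eq with h | h
    · exact hε _ hnear c hc h
    · have hr0 : 0 ≤ r := by rw [h]; exact norm_nonneg _
      refine lt_of_pow_lt_pow_left₀ 2 (norm_nonneg _) ?_
      have hqc := hq.2 c hc
      have h1 : r ^ 2 < ‖q - c‖ ^ 2 := by gcongr
      have h2 : ‖q - c‖ ^ 2 = N ^ 2 - 2 * inner ℝ (c - p) (q - p) + r ^ 2 := by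
        have : q - c = (q - p) - (c - p) := by abel
        rw [this, norm_sub_sq_real, real_inner_comm (c - p) (q - p), norm_sub_rev c p, ← h]
      have h3 : ‖arc p e q s - c‖ ^ 2 =
          (s / ‖x‖) ^ 2 - 2 * (s / ‖x‖ ^ 2 * inner ℝ (c - p) x) + r ^ 2 := by
        have : arc p e q s - c = (s / ‖x‖ ^ 2) • x - (c - p) := by rw [harc]; abel
        rw [this, norm_sub_sq_real, real_inner_smul_left, real_inner_comm (c - p) x, norm_smul,
          norm_div, norm_pow, norm_norm, Real.norm_of_nonneg hs0.le, norm_sub_rev c p, ← h]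
        field_simp
      -- This is the half-plane condition for the inverted disc, multiplied by `s`.
      have h4 : inner ℝ (c - p) x < s / 2 := by
        rw [hxinner]
        have h5 := hec c hc h.symm
        rw [real_inner_comm] at h5
        have h6 : (N ^ 2)⁻¹ * inner ℝ (c - p) (q - p) < 1 / 2 := by
          rw [← div_eq_inv_mul, div_lt_iff₀ (by positivity)]
          linarith
        have h7 := mul_lt_mul_of_pos_left h6 hs0
        have h8 : (1 - s) * inner ℝ (c - p) e ≤ 0 := mul_nonpos_of_nonneg_of_nonpos hs1 h5
        linarith
      rw [h3]
      have h5 : s / ‖x‖ ^ 2 * inner ℝ (c - p) x < s / ‖x‖ ^ 2 * (s / 2) :=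
        mul_lt_mul_of_pos_left h4 (by positivity)
      have h6 : (s / ‖x‖) ^ 2 = 2 * (s / ‖x‖ ^ 2 * (s / 2)) := by field_simp
      linarith

/-- By compactness: along a sequence of counterexamples tending to `p`, the unit directions
accumulate at some `e`. This `e` satisfies the sign conditions in the limit and makes an almost zero
angle with late directions, a contradiction. -/
theorem exists_escape_direction {F : Finset ℂ} {p : ℂ} :
    ∃ ε > 0, ∀ q ∈ box L, (∀ c ∈ F, r ≤ ‖q - c‖) → q ≠ p → dist q p < ε →
      ∃ e : ℂ, ‖e‖ = 1 ∧ (∀ c ∈ F, ‖p - c‖ = r → inner ℝ e (c - p) ≤ 0) ∧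
        (∀ i : Edge, inner ℝ i.normal p = L → inner ℝ i.normal e ≤ 0) ∧
        0 < inner ℝ (q - p) e := by
  by_contra! hcon
  have hpos : ∀ k : ℕ, (0 : ℝ) < 1 / (k + 1) := fun k => by positivity
  choose q hqb hqF hqp hqd hq using fun k : ℕ => hcon _ (hpos k)
  set N : ℕ → ℝ := fun k => ‖q k - p‖
  have hN : ∀ k, 0 < N k := fun k => norm_pos_iff.2 (sub_ne_zero.2 (hqp k))
  have hNlim : Tendsto N atTop (𝓝 0) := by
    refine squeeze_zero (fun k => (hN k).le) (fun k => ?_) tendsto_one_div_add_atTop_nhds_zero_nat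
    have := (hqd k).le
    rwa [dist_eq_norm] at this
  set θ : ℕ → ℂ := fun k => (N k)⁻¹ • (q k - p)
  have hθ : ∀ k, θ k ∈ Metric.sphere (0 : ℂ) 1 := by
    intro k
    rw [mem_sphere_zero_iff_norm, norm_smul, norm_inv, norm_norm]
    exact inv_mul_cancel₀ (hN k).ne'
  obtain ⟨e, he, φ, hφ, hlim⟩ := (isCompact_sphere (0 : ℂ) 1).tendsto_subseq hθ
  rw [mem_sphere_zero_iff_norm] at he
  have hN' := hNlim.comp hφ.tendsto_atTop
  have h1 : ∀ c ∈ F, ‖p - c‖ = r → inner ℝ e (c - p) ≤ 0 := by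
    intro c hc hpc
    have hl : Tendsto (fun k => inner ℝ (θ (φ k)) (c - p)) atTop (𝓝 (inner ℝ e (c - p))) :=
      hlim.inner tendsto_const_nhds
    have hu : Tendsto (fun k => N (φ k) / 2) atTop (𝓝 0) := by
      simpa using hN'.div_const 2
    refine le_of_tendsto_of_tendsto' hl hu fun k => ?_
    have h2 : r ^ 2 ≤ ‖q (φ k) - c‖ ^ 2 := by
      have := hqF (φ k) c hc
      have hr0 : 0 ≤ r := hpc ▸ norm_nonneg _
      gcongr
    have h3 : ‖q (φ k) - c‖ ^ 2 = N (φ k) ^ 2 - 2 * inner ℝ (q (φ k) - p) (c - p) + r ^ 2 := by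
      have : q (φ k) - c = (q (φ k) - p) - (c - p) := by abel
      rw [this, norm_sub_sq_real, norm_sub_rev c p, hpc]
    rw [real_inner_smul_left, ← div_eq_inv_mul, div_le_iff₀ (hN _)]
    nlinarith
  have h2 : ∀ i : Edge, inner ℝ i.normal p = L → inner ℝ i.normal e ≤ 0 := by
    intro i hi
    have hl : Tendsto (fun k => inner ℝ i.normal (θ (φ k))) atTop (𝓝 (inner ℝ i.normal e)) :=
      tendsto_const_nhds.inner hlim
    refine le_of_tendsto' hl fun k => ?_
    rw [real_inner_smul_right, inner_sub_right, hi]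
    have := mem_box_iff.1 (hqb (φ k)) i
    exact mul_nonpos_of_nonneg_of_nonpos (inv_nonneg.2 (hN _).le) (by linarith)
  have hl : Tendsto (fun k => inner ℝ (θ (φ k)) e) atTop (𝓝 (inner ℝ e e)) :=
    hlim.inner tendsto_const_nhds
  have h3 : inner ℝ e e ≤ (0 : ℝ) := by
    refine le_of_tendsto' hl fun k => ?_
    rw [real_inner_smul_left]
    exact mul_nonpos_of_nonneg_of_nonpos (inv_nonneg.2 (hN _).le) (hq _ e he h1 h2)
  rw [real_inner_self_eq_norm_sq, he] at h3
  norm_num at h3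

/-- Segments may run into discs, and boundary points may be cusps between tangent discs. The
inverted rays of `arc` handle both, with a direction adapted to each `q`. -/
theorem locallyJoined_closure_vacant {X : Set ℂ} {F : Finset ℂ}
    (hX : X = (⋃ c ∈ F, Metric.closedBall c r) ∩ box L) :
    LocallyJoined (closure (vacant L X)) := by
  have hYb : closure (vacant L X) ⊆ box L := closure_minimal sdiff_subset (isClosed_box L)
  have hYF : ∀ q ∈ closure (vacant L X), ∀ c ∈ F, r ≤ ‖q - c‖ := by
    intro q hq c hc
    refine closure_minimal (t := {q | r ≤ ‖q - c‖}) (fun w hw => ?_)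
      (isClosed_le continuous_const (by fun_prop)) hq
    exact (((mem_vacant_iff hX).1 hw).2 c hc).le
  intro p hp
  have hpb := hYb hp
  obtain ⟨ε₁, hε₁, hesc⟩ := exists_escape_direction (L := L) (r := r) (F := F) (p := p)
  have h2 : ∀ᶠ w in 𝓝 p, ∀ c ∈ F, r < ‖p - c‖ → r < ‖w - c‖ := by
    rw [Filter.eventually_all_finset]
    intro c _
    by_cases hpc : r < ‖p - c‖
    · filter_upwards [(isOpen_lt continuous_const
        (by fun_prop : Continuous fun w : ℂ => ‖w - c‖)).mem_nhds hpc] with q hq _ using hq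
    · exact Eventually.of_forall fun q hq => absurd hq hpc
  have h3 : ∀ᶠ w in 𝓝 p, ∀ i : Edge, inner ℝ i.normal p < L → inner ℝ i.normal w < L := by
    rw [Filter.eventually_all]
    intro i
    by_cases hpc : inner ℝ i.normal p < L
    · filter_upwards [(isOpen_lt (continuous_inner_normal i) continuous_const).mem_nhds hpc]
        with q hq _ using hq
    · exact Eventually.of_forall fun q hq => absurd hq hpc
  obtain ⟨ε₂, hε₂, h23⟩ := Metric.eventually_nhds_iff.1 (h2.and h3)
  refine ⟨min ε₁ ε₂, lt_min hε₁ hε₂, fun q hq hqp => ?_⟩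
  rcases eq_or_ne q p with rfl | hne
  · exact JoinedIn.refl hq
  obtain ⟨e, he, hec, hen, hqe⟩ := hesc q (hYb hq) (hYF q hq) hne (hqp.trans_le (min_le_left _ _))
  refine JoinedIn.symm (JoinedIn.ofLine (f := arc p e q) (continuousOn_arc he hqe)
    (arc_zero p e q) (arc_one hne) ?_)
  rintro _ ⟨s, hs, rfl⟩
  rcases hs.1.eq_or_lt with rfl | hs0
  · rw [arc_zero]; exact hp
  -- `q` lies only in the closure; for fixed `s` the arc point depends continuously on the endpoint,
  -- so it is a limit of points on arcs ending at vacant points.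
  · have hev : ∀ᶠ w in 𝓝 q, dist w p < ε₂ ∧ 0 < inner ℝ (w - p) e := by
      refine Filter.Eventually.and ?_ ?_
      · exact (isOpen_lt (by fun_prop) continuous_const).mem_nhds
          (hqp.trans_le (min_le_right _ _))
      · exact (isOpen_lt continuous_const
          (by fun_prop : Continuous fun w : ℂ => (inner ℝ (w - p) e : ℝ))).mem_nhds hqe
    have hfr : ∃ᶠ w in 𝓝 q, w ∈ vacant L X := mem_closure_iff_frequently.1 hq
    refine mem_closure_iff_frequently.2 ?_
    refine (continuousAt_arc hs he hqe).tendsto.frequently ?_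
    refine (hfr.and_eventually hev).mono fun w hw => ?_
    exact arc_mem_vacant hX (hYF p hp) (fun w hw => (h23 hw).1) (fun w hw => (h23 hw).2) hpb he
      hec hen hw.1 hw.2.1 hw.2.2 ⟨hs0, hs.2⟩

end Separation

/-! ### Locally uniform convergence and equipotential sets -/

section Local

variable {L : ℝ} {e₀ e₁ : Edge} {u₀ : ℝ} {D : Set ℂ}

/-- `U` is almost everywhere equal to `c` near `z`. -/
def LocallyConstAt (L : ℝ) (U : ℂ → ℝ) (c : ℝ) (z : ℂ) : Prop :=
  ∃ ρ > 0, ∀ᵐ w : ℂ, w ∈ Metric.ball z ρ → w ∈ box L → U w = c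

/-- `u γ` converges to `U` as `γ → 0⁺`, uniformly near `z`. -/
def LocallyUniformAt (L : ℝ) (u : ℝ → ℂ → ℝ) (U : ℂ → ℝ) (z : ℂ) : Prop :=
  ∃ ρ > 0, ∀ η > 0, ∀ᶠ γ in 𝓝[>] (0 : ℝ), ∀ᵐ w : ℂ, w ∈ Metric.ball z ρ → w ∈ box L →
    |u γ w - U w| ≤ η

theorem notMem_equipotential {u : ℂ → ℝ} {v c η ρ : ℝ} {z : ℂ} (hη : η < |v - c|)
    (h : ∀ᵐ w : ℂ, w ∈ Metric.ball z ρ → w ∈ box L → |u w - c| ≤ η) {q : ℂ}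
    (hq : q ∈ Metric.ball z ρ) : q ∉ equipotential L u v := by
  rintro ⟨-, hpos⟩
  obtain ⟨δ, hδ, hsub⟩ := Metric.isOpen_iff.1 Metric.isOpen_ball q hq
  refine (hpos δ hδ (|v - c| - η) (sub_pos.2 hη)).ne' (measure_mono_null ?_ h)
  rintro w ⟨hwb, hwd, hwv⟩ hw
  have h1 := hw (hsub hwd) hwb
  have h2 := abs_sub_le v (u w) c
  rw [abs_sub_comm v (u w)] at h2
  linarith

theorem mem_equipotential (hL : 0 < L) {U : ℂ → ℝ} {c : ℝ} {z : ℂ} (hz : z ∈ box L)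
    (h : LocallyConstAt L U c z) : z ∈ equipotential L U c := by
  obtain ⟨ρ, hρ, h⟩ := h
  refine ⟨hz, fun δ hδ ε hε => ?_⟩
  have h1 := volume_ball_inter_box_pos hL hz (lt_min hδ hρ)
  refine h1.trans_le (measure_mono_ae ?_)
  filter_upwards [h] with w hw hwm
  obtain ⟨hwb, hwx⟩ := hwm
  rw [Metric.mem_ball] at hwb
  refine ⟨hwx, hwb.trans_le (min_le_left _ _), ?_⟩
  rw [hw (Metric.mem_ball.2 (hwb.trans_le (min_le_right _ _))) hwx, sub_self, abs_zero]
  exact hε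

/-- Near each point of `K` the limit is `c`, and eventually `u γ` stays within half of `|v - c|` of
it. Finitely many such neighbourhoods cover `Q`. -/
theorem equipotential_of_locally {u : ℝ → ℂ → ℝ} {U : ℂ → ℝ} {c : ℝ} {K : Set ℂ} (hL : 0 < L)
    (hK : K ⊆ box L) (hc : ∀ z ∈ K, LocallyConstAt L U c z)
    (hu : ∀ z ∈ K, LocallyUniformAt L u U z) :
    K ⊆ equipotential L U c ∧ ∀ v, v ≠ c → Disjoint (equipotential L U v) K ∧
      ∀ Q ⊆ K, IsCompact Q → ∀ᶠ γ in 𝓝[>] (0 : ℝ), Disjoint (equipotential L (u γ) v) Q := by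
  refine ⟨fun z hz => mem_equipotential hL (hK hz) (hc z hz), fun v hv => ⟨?_, fun Q hQK hQ => ?_⟩⟩
  · rw [Set.disjoint_right]
    intro z hz
    obtain ⟨ρ, hρ, h⟩ := hc z hz
    refine notMem_equipotential (η := 0) (abs_pos.2 (sub_ne_zero.2 hv)) ?_
      (Metric.mem_ball_self hρ)
    filter_upwards [h] with w hw h1 h2
    rw [hw h1 h2]; simp
  · have hη : 0 < |v - c| / 2 := half_pos (abs_pos.2 (sub_ne_zero.2 hv))
    refine hQ.induction_on (p := fun Q => ∀ᶠ γ in 𝓝[>] (0 : ℝ),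
      Disjoint (equipotential L (u γ) v) Q) ?_ ?_ ?_ ?_
    · exact Eventually.of_forall fun γ => disjoint_empty _
    · intro s t hst ht
      filter_upwards [ht] with γ hγ using hγ.mono_right hst
    · intro s t hs ht
      filter_upwards [hs, ht] with γ h1 h2 using h1.union_right h2
    · intro z hz
      obtain ⟨ρ₁, hρ₁, h1⟩ := hc z (hQK hz)
      obtain ⟨ρ₂, hρ₂, h2⟩ := hu z (hQK hz)
      refine ⟨Metric.ball z (min ρ₁ ρ₂),
        mem_nhdsWithin_of_mem_nhds (Metric.ball_mem_nhds z (lt_min hρ₁ hρ₂)), ?_⟩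
      filter_upwards [h2 _ hη] with γ hγ
      rw [Set.disjoint_right]
      intro q hq
      refine notMem_equipotential (c := c) (half_lt_self (abs_pos.2 (sub_ne_zero.2 hv))) ?_ hq
      filter_upwards [h1, hγ] with w h3 h4 h5 h6
      rw [← h3 (Metric.ball_subset_ball (min_le_left _ _) h5) h6]
      rw [← h3 (Metric.ball_subset_ball (min_le_left _ _) h5) h6] at h4
      exact h4 (Metric.ball_subset_ball (min_le_right _ _) h5) h6

theorem IsPotential.weaklyHarmonic {σ : ℂ → ℝ} {u : ℂ → ℝ} {g : ℂ → ℂ}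
    (h : IsPotential L σ e₀ e₁ u₀ u g) (hσ : ∀ z ∈ D, σ z = 1) : WeaklyHarmonic L e₀ e₁ D g := by
  intro φ hφ hφD
  rw [← h.2 φ hφ.1 hφ.2.1 hφ.2.2]
  refine setIntegral_congr_fun (measurableSet_box L) fun z hz => ?_
  by_cases hzD : z ∈ D
  · simp only [hσ z hzD, one_mul]
  · simp only [hφD z hz hzD, inner_zero_right, mul_zero]

theorem weaklyHarmonic_of_ae_eq_zero (hD : MeasurableSet D) {g : ℂ → ℂ}
    (h : ∀ᵐ z ∂(volume.restrict D), g z = 0) : WeaklyHarmonic L e₀ e₁ D g := by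
  intro φ hφ hφD
  rw [ae_restrict_iff' hD] at h
  refine integral_eq_zero_of_ae ?_
  filter_upwards [ae_restrict_mem (measurableSet_box L), ae_restrict_of_ae h] with z hz hg
  by_cases hzD : z ∈ D
  · simp [hg hzD]
  · simp [hφD z hz hzD]

theorem WeaklyHarmonic.sub {g g' : ℂ → ℂ} (h : WeaklyHarmonic L e₀ e₁ D g)
    (h' : WeaklyHarmonic L e₀ e₁ D g') (hg : MemLp g 2 (volume.restrict (box L)))
    (hg' : MemLp g' 2 (volume.restrict (box L))) :
    WeaklyHarmonic L e₀ e₁ D fun z => g z - g' z := by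
  intro φ hφ hφD
  simp only [inner_sub_left]
  rw [integral_sub (integrable_inner_box hg hφ.memLp_gradient)
    (integrable_inner_box hg' hφ.memLp_gradient), h φ hφ hφD, h' φ hφ hφD, sub_zero]

theorem exists_goodBall {z : ℂ} (hz : z ∈ box L)
    (hD : ∃ ε > 0, ∀ w ∈ Metric.ball z ε, w ∈ box L → w ∈ D)
    (hedge : ∀ a b, z ∈ edge L a → z ∈ edge L b → a = b) :
    ∃ e, ∃ ρ > 0, ∀ w ∈ Metric.ball z ρ, GoodBall L e D w ρ := by
  obtain ⟨ε, hε, hD⟩ := hD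
  obtain ⟨e, he⟩ : ∃ e, ∀ e', e' ≠ e → z ∉ edge L e' := by
    by_cases h : ∃ e, z ∈ edge L e
    · obtain ⟨e, he⟩ := h
      exact ⟨e, fun e' hne he' => hne (hedge _ _ he' he)⟩
    · exact ⟨.up, fun e' _ he' => h ⟨e', he'⟩⟩
  have h3 : ∀ᶠ w in 𝓝 z, ∀ i : Edge, i ≠ e → inner ℝ i.normal w < L := by
    rw [Filter.eventually_all]
    intro i
    by_cases hi : i = e
    · exact Eventually.of_forall fun q hq => absurd hi hq
    · have hlt : inner ℝ i.normal z < L := lt_of_le_of_ne (mem_box_iff.1 hz i)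
        fun h => he i hi (mem_edge_iff.2 ⟨hz, h⟩)
      filter_upwards [(isOpen_lt (continuous_inner_normal i) continuous_const).mem_nhds hlt]
        with q hq _ using hq
  obtain ⟨δ, hδ, h3⟩ := Metric.eventually_nhds_iff.1 h3
  -- Halving lets one radius serve every centre in the ball, as a uniform sup bound requires.
  refine ⟨e, min ε δ / 2, half_pos (lt_min hε hδ), fun w hw => ?_⟩
  have hsub : ∀ y ∈ Metric.ball w (min ε δ / 2), dist y z < ε ∧ dist y z < δ := by
    intro y hy
    rw [Metric.mem_ball] at hw hy
    have := dist_triangle y w z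
    have h4 := min_le_left ε δ
    have h5 := min_le_right ε δ
    constructor <;> linarith
  refine ⟨fun y hy hye => mem_box_iff.2 fun i => ?_, fun e' he' y hy hye => ?_, fun y hy hyb => ?_⟩
  · rcases eq_or_ne i e with rfl | hi
    · exact hye
    · exact (h3 (hsub y hy).2 i hi).le
  · exact (h3 (hsub y hy).2 e' he').ne (mem_edge_iff.1 hye).2
  · exact hD y (Metric.mem_ball.2 (hsub y hy).1) hyb

theorem ae_mem_interior_box (L : ℝ) : ∀ᵐ w : ℂ, w ∈ box L → w ∈ interior (box L) := by
  have h := (convex_box L).addHaar_frontier volume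
  rw [frontier, (isClosed_box L).closure_eq] at h
  refine measure_mono_null ?_ h
  intro w hw
  by_contra hcon
  exact hw fun h1 => by_contra fun h2 => hcon ⟨h1, h2⟩

/-- Common core of both cases. In `D` the conductivity is 1 and the limit gradient is zero, so the
difference is weakly harmonic with zero Dirichlet data; the sup bound upgrades L² convergence to
locally uniform convergence. -/
theorem high_contrast (hD : MeasurableSet D) (hDL : D ⊆ box L) {σ : ℝ → ℂ → ℝ}
    (hσ : ∀ γ, ∀ z ∈ D, σ γ z = 1) (hσ' : ∀ γ, ∀ z ∈ box L \ D, σ γ z = γ)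
    (hw : ∃ w, Admissible L e₀ e₁ u₀ w ∧ ∀ z ∈ D, gradient w z = 0) :
    (∀ γ ∈ Ioo (0 : ℝ) 1, ∃ u g, IsPotential L (σ γ) e₀ e₁ u₀ u g) ∧
    ∀ (u : ℝ → ℂ → ℝ) (g : ℝ → ℂ → ℂ),
      (∀ γ ∈ Ioo (0 : ℝ) 1, IsPotential L (σ γ) e₀ e₁ u₀ (u γ) (g γ)) →
      ∃ (ulim : ℂ → ℝ) (glim : ℂ → ℂ), SobolevBC L e₀ e₁ u₀ ulim glim ∧
        Tendsto (fun γ => l2Norm L (fun z => u γ z - ulim z)) (𝓝[>] 0) (𝓝 0) ∧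
        Tendsto (fun γ => l2Norm L (fun z => g γ z - glim z)) (𝓝[>] 0) (𝓝 0) ∧
        (∀ᵐ z ∂(volume.restrict D), glim z = 0) ∧
        ∀ z ∈ box L, (∃ ε > 0, ∀ w ∈ Metric.ball z ε, w ∈ box L → w ∈ D) →
          (∀ a b, z ∈ edge L a → z ∈ edge L b → a = b) → LocallyUniformAt L u ulim z := by
  obtain ⟨w, hw, hwD⟩ := hw
  refine ⟨fun γ hγ => exists_isPotential hD hDL hγ (hσ γ) (hσ' γ) hw, fun u g hu => ?_⟩
  obtain ⟨ulim, glim, hs, h1, h2, h3⟩ := exists_limit_potential hD hDL hσ hσ' hw hwD hu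
  refine ⟨ulim, glim, hs, h1, h2, h3, fun z hz hzD hzE => ?_⟩
  obtain ⟨e, ρ, hρ, hG⟩ := exists_goodBall hz hzD hzE
  -- `C` is fixed before `γ`, so the L² convergence transfers directly.
  obtain ⟨C, hC⟩ := ae_abs_le_of_weaklyHarmonic L ρ e e₀ e₁ hρ
  refine ⟨ρ, hρ, fun η hη => ?_⟩
  have hlim : Tendsto (fun γ => C * (l2Norm L fun z => u γ z - ulim z).toReal) (𝓝[>] 0) (𝓝 0) := by
    have := ((ENNReal.tendsto_toReal ENNReal.zero_ne_top).comp h1).const_mul C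
    simpa using this
  filter_upwards [hlim.eventually_le_const hη, Ioo_mem_nhdsGT (one_pos (α := ℝ))] with γ hγ hγ1
  have hsub := (hu γ hγ1).1.sub hs
  rw [sub_self] at hsub
  have hwh := ((hu γ hγ1).weaklyHarmonic (hσ γ)).sub (weaklyHarmonic_of_ae_eq_zero hD h3)
    (hu γ hγ1).1.2.1 hs.2.1
  filter_upwards [hC _ _ D hsub hwh, ae_mem_interior_box L] with w hw hwi hwz hwb
  exact (hw (hwi hwb) (hG w hwz)).trans hγ

end Local

/-! ### Constancy on connected components -/

section Components

variable {L r u₀ : ℝ} {e₀ e₁ : Edge}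

theorem box_subset_closure_interior (hL : 0 < L) : box L ⊆ closure (interior (box L)) := by
  have hne : (-L) ≠ L := by linarith
  rw [box, Complex.interior_reProdIm, interior_Icc, Complex.closure_reProdIm, closure_Ioo hne]

/-- By strict convexity the midpoint of two distinct points lies in the open disc. Near it the box
has interior points, so the piece would have interior. -/
theorem discPiece_subsingleton (hL : 0 < L) {c : ℂ} (h : ¬ (interior (discPiece L r c)).Nonempty) :
    (discPiece L r c).Subsingleton := by
  intro a ha b hb
  by_contra hab
  have hr : r ≠ 0 := by
    rintro rfl
    have h1 := Metric.mem_closedBall.1 ha.1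
    have h2 := Metric.mem_closedBall.1 hb.1
    exact hab ((dist_le_zero.1 h1).trans (dist_le_zero.1 h2).symm)
  have hm : midpoint ℝ a b ∈ Metric.ball c r := by
    have := (strictConvex_closedBall ℝ c r) ha.1 hb.1 hab (a := 1 / 2) (b := 1 / 2)
      (by norm_num) (by norm_num) (by norm_num)
    rw [interior_closedBall c hr] at this
    convert this using 1
    rw [midpoint_eq_smul_add, smul_add]
    norm_num
  have hmb : midpoint ℝ a b ∈ box L := (convex_box L).midpoint_mem ha.2 hb.2
  obtain ⟨w, hw1, hw2⟩ := mem_closure_iff.1 (box_subset_closure_interior hL hmb) _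
    Metric.isOpen_ball hm
  refine h ⟨w, mem_interior.2 ⟨Metric.ball c r ∩ interior (box L), ?_,
    Metric.isOpen_ball.inter isOpen_interior, hw1, hw2⟩⟩
  exact inter_subset_inter Metric.ball_subset_closedBall interior_subset

theorem volume_discPiece_eq_zero {c : ℂ} (h : ¬ (interior (discPiece L r c)).Nonempty) :
    volume (discPiece L r c) = 0 := by
  have h1 := (convex_discPiece (L := L) (r := r) c).addHaar_frontier volume
  rw [not_nonempty_iff_eq_empty] at h
  rwa [frontier, (isClosed_discPiece c).closure_eq, h, sdiff_empty] at h1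

/-- Each disc piece carries a constant, and touching pieces with interior carry the same one. The
pieces with constant `k` and the remaining ones give disjoint closed sets covering `K`, so
connectedness leaves one value. -/
theorem exists_const_on_occupied_component (hL : 0 < L) {X : Set ℂ} {F : Finset ℂ}
    (hX : X = (⋃ c ∈ F, Metric.closedBall c r) ∩ box L) {u : ℂ → ℝ} {g : ℂ → ℂ}
    (hs : SobolevBC L e₀ e₁ u₀ u g) (hg : ∀ᵐ z ∂(volume.restrict X), g z = 0) (x : ℂ) :
    ∃ k : ℝ, ∀ᵐ z ∂(volume.restrict (connectedComponentIn X x)), u z = k := by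
  classical
  set K := connectedComponentIn X x with hKdef
  have hKX : K ⊆ X := connectedComponentIn_subset X x
  have hKpre : IsPreconnected K := isPreconnected_connectedComponentIn
  have hDX : ∀ c ∈ F, discPiece L r c ⊆ X := fun c hc z hz =>
    (mem_iff_exists_discPiece hX).2 ⟨c, hc, hz⟩
  have hm : ∀ c, MeasurableSet (discPiece L r c) := fun c => (isClosed_discPiece c).measurableSet
  have hconst : ∀ c ∈ F, ∃ k, ∀ᵐ z ∂(volume.restrict (discPiece L r c)), u z = k := fun c hc =>
    hs.exists_ae_eq_const (hm c) (convex_discPiece c) inter_subset_right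
      (ae_restrict_of_ae_restrict_of_subset (hDX c hc) hg)
  -- If only degenerate pieces meet the component, it is null and any constant works.
  by_cases hN : ∃ c ∈ F, (interior (discPiece L r c)).Nonempty ∧ (discPiece L r c ∩ K).Nonempty
  swap
  · refine ⟨0, ?_⟩
    have h0 : volume K = 0 := by
      refine measure_mono_null (t := ⋃ c ∈ {c | c ∈ F ∧ (discPiece L r c ∩ K).Nonempty},
        discPiece L r c) (fun z hz => ?_) ?_
      · obtain ⟨c, hc, hzc⟩ := (mem_iff_exists_discPiece hX).1 (hKX hz)
        exact mem_biUnion (x := c) ⟨hc, z, hzc, hz⟩ hzc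
      · rw [measure_biUnion_null_iff (F.countable_toSet.mono fun c hc => hc.1)]
        exact fun c hc => volume_discPiece_eq_zero fun h => hN ⟨c, hc.1, h, hc.2⟩
    rw [Measure.restrict_eq_zero.2 h0]
    simp
  obtain ⟨c₀, hc₀, hi₀, hK₀⟩ := hN
  obtain ⟨k, hk⟩ := hconst c₀ hc₀
  set S := F.filter fun c => (interior (discPiece L r c)).Nonempty ∧
    ∀ᵐ z ∂(volume.restrict (discPiece L r c)), u z = k with hS
  set A : Set ℂ := ⋃ c ∈ S, discPiece L r c with hA
  -- A degenerate piece is at most a point and carries no value. It goes with `A` if it lies in `A`,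
  -- and otherwise into `B`; this keeps the two closed sets disjoint.
  set T := F.filter fun c => c ∉ S ∧
    ((interior (discPiece L r c)).Nonempty ∨ Disjoint (discPiece L r c) A) with hT
  set B : Set ℂ := ⋃ c ∈ T, discPiece L r c with hB
  have hAc : IsClosed A := S.finite_toSet.isClosed_biUnion fun c _ => isClosed_discPiece c
  have hBc : IsClosed B := T.finite_toSet.isClosed_biUnion fun c _ => isClosed_discPiece c
  have hcover : K ⊆ A ∪ B := by
    intro z hz
    obtain ⟨c, hc, hzc⟩ := (mem_iff_exists_discPiece hX).1 (hKX hz)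
    by_cases hcS : c ∈ S
    · exact Or.inl (mem_biUnion (x := c) hcS hzc)
    · by_cases hcT : (interior (discPiece L r c)).Nonempty ∨ Disjoint (discPiece L r c) A
      · exact Or.inr (mem_biUnion (x := c) (Finset.mem_coe.2 (Finset.mem_filter.2 ⟨hc, hcS, hcT⟩)) hzc)
      · obtain ⟨h1, h2⟩ := not_or.1 hcT
        obtain ⟨a, ha, haA⟩ := Set.not_disjoint_iff.1 h2
        rw [discPiece_subsingleton hL h1 hzc ha]
        exact Or.inl haA
  have hdisj : K ∩ (A ∩ B) = ∅ := by
    rw [eq_empty_iff_forall_notMem]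
    rintro p ⟨-, hpA, hpB⟩
    obtain ⟨c', hc', hpc'⟩ := mem_iUnion₂.1 hpB
    obtain ⟨hc'F, hc'S, hc'T⟩ := Finset.mem_filter.1 hc'
    rcases hc'T with hi' | hd
    · obtain ⟨c, hc, hpc⟩ := mem_iUnion₂.1 hpA
      obtain ⟨-, hi, hck⟩ := Finset.mem_filter.1 hc
      obtain ⟨k', hk'⟩ := hconst c' hc'F
      have : k = k' := hs.eq_of_touching (convex_discPiece c) (convex_discPiece c')
        inter_subset_right inter_subset_right hpc hpc' hi hi' hck hk'
      rw [← this] at hk'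
      exact hc'S (Finset.mem_filter.2 ⟨hc'F, hi', hk'⟩)
    · exact Set.disjoint_left.1 hd hpc' hpA
  have hc₀S : c₀ ∈ S := Finset.mem_filter.2 ⟨hc₀, hi₀, hk⟩
  have hKA : K ⊆ A := by
    rcases isPreconnected_iff_subset_of_disjoint_closed.1 hKpre A B hAc hBc hcover hdisj with h | h
    · exact h
    · exfalso
      obtain ⟨p, hp, hpK⟩ := hK₀
      have : p ∈ K ∩ (A ∩ B) := ⟨hpK, mem_biUnion (x := c₀) hc₀S hp, h hpK⟩
      rw [hdisj] at this
      exact this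
  refine ⟨k, ae_restrict_of_ae_restrict_of_subset hKA ?_⟩
  rw [hA, ae_restrict_biUnion_finset_iff]
  exact fun c hc => (Finset.mem_filter.1 hc).2.2

theorem ae_restrict_of_locallyConstAt {K : Set ℂ} (hKm : MeasurableSet K) (hK : K ⊆ box L)
    {u : ℂ → ℝ} {c : ℝ} (h : ∀ z ∈ K, LocallyConstAt L u c z) :
    ∀ᵐ z ∂(volume.restrict K), u z = c := by
  rw [ae_restrict_iff' hKm]
  refine measure_mono_null (t := {w ∈ K | u w ≠ c}) (fun w hw => ?_) ?_
  · by_contra hcon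
    exact hw fun h1 => by_contra fun h2 => hcon ⟨h1, h2⟩
  · refine measure_null_of_locally_null _ fun z hz => ?_
    obtain ⟨ρ, hρ, hae⟩ := h z hz.1
    refine ⟨Metric.ball z ρ ∩ {w ∈ K | u w ≠ c},
      inter_mem (mem_nhdsWithin_of_mem_nhds (Metric.ball_mem_nhds z hρ)) self_mem_nhdsWithin,
      measure_mono_null ?_ hae⟩
    rintro w ⟨hwb, hwK, hwc⟩ hw
    exact hwc (hw hwb (hK hwK))

theorem LocallyConstAt.of_mem_ball {u : ℂ → ℝ} {c ρ : ℝ} {z w : ℂ}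
    (h : ∀ᵐ y : ℂ, y ∈ Metric.ball z ρ → y ∈ box L → u y = c) (hw : w ∈ Metric.ball z ρ) :
    LocallyConstAt L u c w := by
  obtain ⟨δ, hδ, hsub⟩ := Metric.isOpen_iff.1 Metric.isOpen_ball w hw
  refine ⟨δ, hδ, ?_⟩
  filter_upwards [h] with y hy h1 using hy (hsub h1)

theorem LocallyConstAt.unique (hL : 0 < L) {u : ℂ → ℝ} {c c' : ℝ} {z : ℂ} (hz : z ∈ box L)
    (h : LocallyConstAt L u c z) (h' : LocallyConstAt L u c' z) : c = c' := by
  obtain ⟨ρ, hρ, h⟩ := h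
  obtain ⟨ρ', hρ', h'⟩ := h'
  have hpos := volume_ball_inter_box_pos hL hz (lt_min hρ hρ')
  obtain ⟨w, hw, h1, h2⟩ := ((frequently_ae_mem_iff.2 hpos.ne').and_eventually (h.and h')).exists
  rw [← h1 (Metric.ball_subset_ball (min_le_left _ _) hw.1) hw.2,
    h2 (Metric.ball_subset_ball (min_le_right _ _) hw.1) hw.2]

/-- The level sets of the local constant are open and, since the box has positive area near each of
its points, disjoint within it. -/
theorem exists_locallyConstAt_of_isPreconnected (hL : 0 < L) {u : ℂ → ℝ} {K : Set ℂ}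
    (hK : IsPreconnected K) (hKb : K ⊆ box L) (h : ∀ z ∈ K, ∃ c, LocallyConstAt L u c z) :
    ∃ c, ∀ z ∈ K, LocallyConstAt L u c z := by
  rcases K.eq_empty_or_nonempty with rfl | ⟨x, hx⟩
  · exact ⟨0, fun z hz => absurd hz (notMem_empty z)⟩
  obtain ⟨c, hc⟩ := h x hx
  have hopen : ∀ c, IsOpen {z | LocallyConstAt L u c z} := by
    intro c
    rw [Metric.isOpen_iff]
    rintro z ⟨ρ, hρ, hz⟩
    exact ⟨ρ, hρ, fun w hw => LocallyConstAt.of_mem_ball hz hw⟩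
  refine ⟨c, ?_⟩
  have hV : IsOpen (⋃ c' ∈ {c' | c' ≠ c}, {z | LocallyConstAt L u c' z}) :=
    isOpen_biUnion fun c' _ => hopen c'
  have hcover : K ⊆ {z | LocallyConstAt L u c z} ∪
      ⋃ c' ∈ {c' | c' ≠ c}, {z | LocallyConstAt L u c' z} := by
    intro z hz
    obtain ⟨c', hc'⟩ := h z hz
    rcases eq_or_ne c' c with rfl | hne
    · exact Or.inl hc'
    · exact Or.inr (mem_biUnion (x := c') hne hc')
  have hdisj : K ∩ ({z | LocallyConstAt L u c z} ∩
      ⋃ c' ∈ {c' | c' ≠ c}, {z | LocallyConstAt L u c' z}) = ∅ := by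
    rw [eq_empty_iff_forall_notMem]
    rintro z ⟨hz, hzc, hzV⟩
    obtain ⟨c', hc', hx'⟩ := mem_iUnion₂.1 hzV
    exact hc' (LocallyConstAt.unique hL (hKb hz) hx' hzc)
  rcases isPreconnected_iff_subset_of_disjoint.1 hK _ _ (hopen c) hV hcover hdisj with h1 | h1
  · exact fun z hz => h1 hz
  · obtain ⟨c', hc', hx'⟩ := mem_iUnion₂.1 (h1 hx)
    exact absurd (LocallyConstAt.unique hL (hKb hx) hx' hc) hc'

theorem exists_ball_subset_vacant {X : Set ℂ} (hX : IsClosed X) {z : ℂ} (hz : z ∈ vacant L X) :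
    ∃ ε > 0, ∀ w ∈ Metric.ball z ε, w ∈ box L → w ∈ vacant L X := by
  obtain ⟨ε, hε, h⟩ := Metric.isOpen_iff.1 hX.isOpen_compl z hz.2
  exact ⟨ε, hε, fun w hw hwb => ⟨hwb, h hw⟩⟩

theorem exists_ball_subset_vacant_component {X : Set ℂ} (hX : IsClosed X) {x z : ℂ}
    (hz : z ∈ connectedComponentIn (vacant L X) x) :
    ∃ ε > 0, ∀ w ∈ Metric.ball z ε, w ∈ box L → w ∈ connectedComponentIn (vacant L X) x := by
  have hzv := connectedComponentIn_subset _ _ hz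
  obtain ⟨ε, hε, h⟩ := exists_ball_subset_vacant hX hzv
  refine ⟨ε, hε, fun w hw hwb => ?_⟩
  rw [connectedComponentIn_eq hz]
  exact ((convex_ball z ε).inter (convex_box L)).isPreconnected.subset_connectedComponentIn
    ⟨Metric.mem_ball_self hε, hzv.1⟩ (fun y hy => h y hy.1 hy.2) ⟨hw, hwb⟩

theorem measurableSet_vacant_component {X : Set ℂ} (hX : IsClosed X) (x : ℂ) :
    MeasurableSet (connectedComponentIn (vacant L X) x) := by
  set K := connectedComponentIn (vacant L X) x
  have hK : ∀ z ∈ K, ∃ ε > 0, ∀ w ∈ Metric.ball z ε, w ∈ box L → w ∈ K := fun z hz =>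
    exists_ball_subset_vacant_component hX hz
  choose! ε hε h using hK
  have : K = (⋃ z ∈ K, Metric.ball z (ε z)) ∩ box L := by
    ext w
    constructor
    · intro hw
      exact ⟨mem_biUnion hw (Metric.mem_ball_self (hε w hw)),
        (connectedComponentIn_subset _ _ hw).1⟩
    · rintro ⟨hw, hwb⟩
      obtain ⟨z, hz, hwz⟩ := mem_iUnion₂.1 hw
      exact h z hz w hwz hwb
  rw [this]
  exact (isOpen_biUnion fun z _ => Metric.isOpen_ball).measurableSet.inter (measurableSet_box L)

end Components

/-! ### Assembly of the two cases -/

theorem disjoint_up_down {L : ℝ} (hL : 0 < L) : Disjoint (edge L .down) (edge L .up) := by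
  rw [Set.disjoint_left]
  rintro z ⟨-, h1⟩ ⟨-, h2⟩
  linarith

theorem disjoint_left_right {L : ℝ} (hL : 0 < L) : Disjoint (edge L .left) (edge L .right) := by
  rw [Set.disjoint_left]
  rintro z ⟨-, h1⟩ ⟨-, h2⟩
  linarith

theorem notMem_edge_of_mem_interior {L : ℝ} {z : ℂ} (hz : z ∈ interior (box L)) (e : Edge) :
    z ∉ edge L e := by
  intro he
  obtain ⟨δ, hδ, h⟩ := Metric.isOpen_iff.1 isOpen_interior z hz
  have h1 : z + (δ / 2) • e.normal ∈ Metric.ball z δ := by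
    rw [mem_ball_iff_norm, add_sub_cancel_left, norm_smul, norm_normal, Real.norm_of_nonneg
      (half_pos hδ).le]
    linarith
  have h2 := mem_box_iff.1 (interior_subset (h h1)) e
  rw [inner_add_right, real_inner_smul_right, inner_normal_self, (mem_edge_iff.1 he).2] at h2
  linarith

end PercolationPotential

theorem mainTheorem7 (L r u₀ : ℝ) (hL : 0 < L) (hr : 0 < r) (hu₀ : 0 < u₀)
    (X : Set ℂ) (hX : X ∈ PercolationPotential.boolConfig L r) :
    -- the vacant region dominates: the OS potential
    (PercolationPotential.VacancyDominates L X →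
      (∀ γ₀ ∈ Ioo (0 : ℝ) 1, ∃ (u : ℂ → ℝ) (g : ℂ → ℂ),
        PercolationPotential.IsOSPotential L γ₀ X u₀ u g) ∧
      ∀ (u : ℝ → ℂ → ℝ) (g : ℝ → ℂ → ℂ),
        (∀ γ₀ ∈ Ioo (0 : ℝ) 1, PercolationPotential.IsOSPotential L γ₀ X u₀ (u γ₀) (g γ₀)) →
        ∃ (ulim : ℂ → ℝ) (glim : ℂ → ℂ),
          PercolationPotential.SobolevBC L .down .up u₀ ulim glim ∧
          Tendsto (fun γ₀ => PercolationPotential.l2Norm L (fun z => u γ₀ z - ulim z))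
            (𝓝[>] 0) (𝓝 0) ∧
          Tendsto (fun γ₀ => PercolationPotential.l2Norm L (fun z => g γ₀ z - glim z))
            (𝓝[>] 0) (𝓝 0) ∧
          ∀ x ∈ X, ∃ c : ℝ,
            (∀ᵐ z ∂(volume.restrict (connectedComponentIn X x)), ulim z = c) ∧
            interior (connectedComponentIn X x) ⊆ PercolationPotential.equipotential L ulim c ∧
            ∀ v ∈ Icc 0 u₀, v ≠ c →
              Disjoint (PercolationPotential.equipotential L ulim v)
                (interior (connectedComponentIn X x)) ∧
              ∀ Q ⊆ interior (connectedComponentIn X x), IsCompact Q →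
                ∀ᶠ γ₀ in 𝓝[>] (0 : ℝ),
                  Disjoint (PercolationPotential.equipotential L (u γ₀) v) Q) ∧
    -- the occupied region dominates: the VS potential
    (PercolationPotential.Dominates L X →
      (∀ γ₀ ∈ Ioo (0 : ℝ) 1, ∃ (u : ℂ → ℝ) (g : ℂ → ℂ),
        PercolationPotential.IsVSPotential L γ₀ X u₀ u g) ∧
      ∀ (u : ℝ → ℂ → ℝ) (g : ℝ → ℂ → ℂ),
        (∀ γ₀ ∈ Ioo (0 : ℝ) 1, PercolationPotential.IsVSPotential L γ₀ X u₀ (u γ₀) (g γ₀)) →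
        ∃ (ulim : ℂ → ℝ) (glim : ℂ → ℂ),
          PercolationPotential.SobolevBC L .left .right u₀ ulim glim ∧
          Tendsto (fun γ₀ => PercolationPotential.l2Norm L (fun z => u γ₀ z - ulim z))
            (𝓝[>] 0) (𝓝 0) ∧
          Tendsto (fun γ₀ => PercolationPotential.l2Norm L (fun z => g γ₀ z - glim z))
            (𝓝[>] 0) (𝓝 0) ∧
          ∀ x ∈ PercolationPotential.vacant L X, ∃ c : ℝ,
            (∀ᵐ z ∂(volume.restrict (connectedComponentIn (PercolationPotential.vacant L X) x)),
              ulim z = c) ∧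
            connectedComponentIn (PercolationPotential.vacant L X) x ⊆
              PercolationPotential.equipotential L ulim c ∧
            ∀ v ∈ Icc 0 u₀, v ≠ c →
              Disjoint (PercolationPotential.equipotential L ulim v)
                (connectedComponentIn (PercolationPotential.vacant L X) x) ∧
              ∀ Q ⊆ connectedComponentIn (PercolationPotential.vacant L X) x, IsCompact Q →
                ∀ᶠ γ₀ in 𝓝[>] (0 : ℝ),
                  Disjoint (PercolationPotential.equipotential L (u γ₀) v) Q) := by
  obtain ⟨F, hF⟩ := PercolationPotential.exists_finset_of_mem_boolConfig hr hX
  have hXc : IsClosed X := PercolationPotential.isClosed_of_finset hF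
  have hXb : X ⊆ PercolationPotential.box L := by rw [hF]; exact inter_subset_right
  refine ⟨fun hdom => ?_, fun hdom => ?_⟩
  · have hcomp := PercolationPotential.exists_admissible_of_not_curveConnected (u₀ := u₀) hXc
      (PercolationPotential.locallyJoined_occupied hF)
      (hdom.2 .down .up (by simp)) (PercolationPotential.disjoint_up_down hL)
    obtain ⟨hex, hlim⟩ := PercolationPotential.high_contrast hXc.measurableSet hXb
      (σ := fun γ => PercolationPotential.condOS γ X) (fun γ z hz => if_pos hz)
      (fun γ z hz => if_neg hz.2) hcomp
    refine ⟨hex, fun u g hu => ?_⟩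
    obtain ⟨ulim, glim, hs, h1, h2, h3, h4⟩ := hlim u g hu
    refine ⟨ulim, glim, hs, h1, h2, fun x _ => ?_⟩
    obtain ⟨k, hk⟩ :=
      PercolationPotential.exists_const_on_occupied_component hL hF hs h3 x
    have hKX := connectedComponentIn_subset X x
    have hball : ∀ z ∈ interior (connectedComponentIn X x), ∃ ε > 0,
        Metric.ball z ε ⊆ connectedComponentIn X x := fun z hz => by
      obtain ⟨ε, hε, h⟩ := Metric.isOpen_iff.1 isOpen_interior z hz
      exact ⟨ε, hε, h.trans interior_subset⟩
    have hfin := PercolationPotential.equipotential_of_locally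
      (K := interior (connectedComponentIn X x)) (u := u) (U := ulim) (c := k) hL
      (interior_subset.trans (hKX.trans hXb)) (fun z hz => by
        obtain ⟨ε, hε, h⟩ := hball z hz
        refine ⟨ε, hε, ?_⟩
        have := ae_restrict_of_ae_restrict_of_subset h hk
        rw [ae_restrict_iff' Metric.isOpen_ball.measurableSet] at this
        filter_upwards [this] with w hw h5 _ using hw h5)
      (fun z hz => by
        obtain ⟨ε, hε, h⟩ := hball z hz
        refine h4 z (hXb (hKX (interior_subset hz))) ⟨ε, hε, fun w hw _ => hKX (h hw)⟩ ?_
        have hzi : z ∈ interior (PercolationPotential.box L) :=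
          interior_mono (hKX.trans hXb) hz
        intro a b ha _
        exact absurd ha (PercolationPotential.notMem_edge_of_mem_interior hzi a))
    exact ⟨k, hk, hfin.1, fun v _ hv => hfin.2 v hv⟩
  · have hvb : PercolationPotential.vacant L X ⊆ PercolationPotential.box L := sdiff_subset
    have hvm : MeasurableSet (PercolationPotential.vacant L X) :=
      (PercolationPotential.measurableSet_box L).diff hXc.measurableSet
    obtain ⟨w, hw, hwg⟩ := PercolationPotential.exists_admissible_of_not_curveConnected
      (u₀ := u₀) isClosed_closure (PercolationPotential.locallyJoined_closure_vacant hF)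
      (hdom.2 .left .right (by simp)) (PercolationPotential.disjoint_left_right hL)
    obtain ⟨hex, hlim⟩ := PercolationPotential.high_contrast hvm hvb
      (σ := fun γ => PercolationPotential.condVS γ X) (fun γ z hz => if_neg hz.2)
      (fun γ z hz => if_pos (by_contra fun h => hz.2 ⟨hz.1, h⟩))
      ⟨w, hw, fun z hz => hwg z (subset_closure hz)⟩
    refine ⟨hex, fun u g hu => ?_⟩
    obtain ⟨ulim, glim, hs, h1, h2, h3, h4⟩ := hlim u g hu
    refine ⟨ulim, glim, hs, h1, h2, fun x _ => ?_⟩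
    have hKv := connectedComponentIn_subset (PercolationPotential.vacant L X) x
    have hKb := hKv.trans hvb
    obtain ⟨k, hk⟩ := PercolationPotential.exists_locallyConstAt_of_isPreconnected hL
      (u := ulim) (isPreconnected_connectedComponentIn (F := PercolationPotential.vacant L X)
        (x := x)) hKb (fun z hz => by
        obtain ⟨ε, hε, h⟩ := PercolationPotential.exists_ball_subset_vacant hXc (hKv hz)
        have hm : MeasurableSet (Metric.ball z ε ∩ PercolationPotential.box L) :=
          Metric.isOpen_ball.measurableSet.inter (PercolationPotential.measurableSet_box L)
        obtain ⟨c, hc⟩ := hs.exists_ae_eq_const hm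
          ((convex_ball z ε).inter (PercolationPotential.convex_box L)) inter_subset_right
          (ae_restrict_of_ae_restrict_of_subset (fun w hw => h w hw.1 hw.2) h3)
        rw [ae_restrict_iff' hm] at hc
        refine ⟨c, ε, hε, ?_⟩
        filter_upwards [hc] with w hw h5 h6 using hw ⟨h5, h6⟩)
    have hfin := PercolationPotential.equipotential_of_locally
      (u := u) hL hKb hk (fun z hz => by
        refine h4 z (hKb hz) (PercolationPotential.exists_ball_subset_vacant hXc (hKv hz)) ?_
        intro a b ha hb
        by_contra hab
        exact hdom.2 a b hab ⟨fun _ => z, continuous_const,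
          fun _ => subset_closure (hKv hz), ⟨0, ha⟩, ⟨0, hb⟩⟩)
    exact ⟨k, PercolationPotential.ae_restrict_of_locallyConstAt
      (PercolationPotential.measurableSet_vacant_component hXc x) hKb hk, hfin.1,
      fun v _ hv => hfin.2 v hv⟩
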